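/- For $m\ge 0$ let $S_m$ be the space of complex binary forms of degree $m$, with the action $(g\cdot f)(x)=f(g^{-1}x)$ of $\mathrm{SL}_2(\mathbb C)$. For $V=S_{n_1}\oplus\dots\oplus S_{n_s}$ let $\mathrm{Cov}(V)=\mathbb C[V\oplus\mathbb C^2]^{\mathrm{SL}_2(\mathbb C)}$ be the algebra of covariants, let $\mathrm{Cov}_{d,k}(V)$ be its subspace of elements of degree $d$ in the coefficients of $V$ and of order (degree in $x=(x,y)\in\mathbb C^2$) $k$, and let $C_+=\sum_{d+k>0}\mathrm{Cov}_{d,k}(V)$. A covariant $h\in\mathrm{Cov}_{d,k}(V)$ with $(d,k)\ne(0,0)$ (possibly $h=0$) is *reducible* if it lies in the algebra generated by the covariants of degree $d'\le d$ and order $k'\le k$ with $d'<d$ or $k'<k$. A *minimal basis* of $\mathrm{Cov}(V)$ is a finite family of bihomogeneous elements of $C_+$ whose image in $C_+/C_+^2$ is a basis of this vector space. The *transvectant* of index $r\ge 0$ of two forms $F,G$ of orders $m,p$ is $$(F,G)_r=\Omega_{\alpha\beta}^{r}\,\sigma_\alpha^{m-r}\,\sigma_\beta^{p-r}\bigl(F(x_\alpha)G(x_\beta)\bigr)\quad\text{if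 } r\le\min(m,p),\qquad (F,G)_r=0\quad\text{otherwise},$$ where $\Omega_{\alpha\beta}=\partial_{x_\alpha}\partial_{y_\beta}-\partial_{y_\alpha}\partial_{x_\beta}$ and $\sigma_\alpha=x\,\partial_{x_\alpha}+y\,\partial_{y_\alpha}$. (1) Let $V_1,V_2$ be two spaces of binary forms (finite direct sums of spaces $S_m$), let $f_1,\dots,f_p$ be bihomogeneous generators of the algebra $\mathrm{Cov}(V_1)$ and $g_1,\dots,g_q$ bihomogeneous generators of $\mathrm{Cov}(V_2)$, of orders at most $a$ and at most $b$ respectively (for instance $a=\max_i \mathrm{ord}(f_i)$, $b=\max_j\mathrm{ord}(g_j)$). Let $U=f_1^{\alpha_1}\cdots f_p^{\alpha_p}$, $V=g_1^{\beta_1}\cdots g_q^{\beta_q}$, $r\ge 0$, $u=\mathrm{ord}(U)-r$ and $v=\mathrm{ord}(V)-r$, where $\mathrm{ord}(U)=\sum_i\alpha_i\,\mathrm{ord}(f_i)$ and $\mathrm{ord}(V)=\sum_j\beta_j\,\mathrm{ord}(g_j)$. If $a=0$ or $b=0$, assume in addition that the monomial $UV$ has at least two factors of positive degree, counted with multiplicity.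 If $u+v\ge a+b$, then the transvectant $(U,V)_r$, a covariant of $V_1\oplus V_2$ of degree $\deg U+\deg V$ and order $u+v$, is reducible in $\mathrm{Cov}(V_1\oplus V_2)$. (2) Let $V=S_{n_1}\oplus\dots\oplus S_{n_s}$. For each $i$ let $\mu_i$ be the maximal order of an element of a minimal basis of $\mathrm{Cov}(S_{n_i})$. Then every element $h$ of every minimal basis of $\mathrm{Cov}(V)$ satisfies $\mathrm{ord}(h)\le\sum_{i=1}^s\mu_i$. -/

import Mathlib

open MvPolynomial

noncomputable section

namespace BinaryForms

/-- The space `S_m` of complex binary forms of degree `m`, as homogeneous polynomials in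
`x = X 0` and `y = X 1`. -/
abbrev BinForm (m : ℕ) : Type := homogeneousSubmodule (Fin 2) ℂ m

/-- The substitution `f(x) ↦ f(g⁻¹ x)`. -/
def substInv (g : Matrix.SpecialLinearGroup (Fin 2) ℂ) :
    MvPolynomial (Fin 2) ℂ →ₐ[ℂ] MvPolynomial (Fin 2) ℂ :=
  aeval fun i => ∑ j, C ((g⁻¹ : Matrix.SpecialLinearGroup (Fin 2) ℂ).1 i j) * X j

theorem substInv_mem (g : Matrix.SpecialLinearGroup (Fin 2) ℂ) {m : ℕ} (f : BinForm m) :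
    substInv g f.1 ∈ homogeneousSubmodule (Fin 2) ℂ m := by
  have h : (f.1).IsHomogeneous m := f.2
  have h1 := h.aeval
    (fun i => ∑ j, C ((g⁻¹ : Matrix.SpecialLinearGroup (Fin 2) ℂ).1 i j) * X j) (n := 1)
    (fun i => IsHomogeneous.sum _ _ _ fun j _ => by
      simpa using (isHomogeneous_C (Fin 2) _).mul (isHomogeneous_X ℂ j))
  simpa [substInv] using h1

/-- The action of `SL(2, ℂ)` on binary forms, `(g · f)(x) = f(g⁻¹ x)`. -/
def actForm (g : Matrix.SpecialLinearGroup (Fin 2) ℂ) {m : ℕ} (f : BinForm m) : BinForm m :=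
  ⟨substInv g f.1, substInv_mem g f⟩

/-- The coefficient `a_k` of `f = ∑ k, (m choose k) a_k x^(m-k) y^k`. -/
def formCoeff {m : ℕ} (f : BinForm m) (k : Fin (m + 1)) : ℂ :=
  coeff (Finsupp.single 0 (m - (k : ℕ)) + Finsupp.single 1 (k : ℕ)) f.1 /
    ((m.choose (k : ℕ) : ℕ) : ℂ)

/-- The coordinates on the space of forms `⨁ i, S_{n i}`: `⟨i, k⟩` stands for the coefficient
`a_k` of the `i`-th form. -/
abbrev CoeffVar {ι : Type*} (n : ι → ℕ) : Type _ := Σ i, Fin (n i + 1)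

/-- The coordinate ring `ℂ[V ⊕ ℂ²]` of `V ⊕ ℂ²` for `V = ⨁ i, S_{n i}`. -/
abbrev CoordRing {ι : Type*} (n : ι → ℕ) : Type _ := MvPolynomial (CoeffVar n ⊕ Fin 2) ℂ

variable {ι : Type*} (n : ι → ℕ)

/-- The value `p(f, x)` of `p ∈ ℂ[V ⊕ ℂ²]` at `f ∈ V` and `x ∈ ℂ²`. -/
def evalAt (f : ∀ i, BinForm (n i)) (x : Fin 2 → ℂ) : CoordRing n →ₐ[ℂ] ℂ :=
  aeval (Sum.elim (fun v : CoeffVar n => formCoeff (f v.1) v.2) x)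

/-- The covariant algebra `Cov(V) = ℂ[V ⊕ ℂ²]^{SL(2, ℂ)}` of `V = ⨁ i, S_{n i}`. -/
def covAlg : Subalgebra ℂ (CoordRing n) where
  carrier := {p | ∀ (g : Matrix.SpecialLinearGroup (Fin 2) ℂ) (f : ∀ i, BinForm (n i))
    (x : Fin 2 → ℂ),
    evalAt n (fun i => actForm g (f i)) (g.1.mulVec x) p = evalAt n f x p}
  mul_mem' := by
    intro p q hp hq g f x
    rw [map_mul, map_mul, hp g f x, hq g f x]
  add_mem' := by
    intro p q hp hq g f x
    rw [map_add, map_add, hp g f x, hq g f x]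
  algebraMap_mem' := by
    intro c g f x
    rw [AlgHom.commutes, AlgHom.commutes]

/-- The bigrading of `ℂ[V ⊕ ℂ²]` by (degree in the coefficients, order in `x`). -/
def bidegWeight : CoeffVar n ⊕ Fin 2 → ℕ × ℕ :=
  Sum.elim (fun _ => (1, 0)) (fun _ => (0, 1))

/-- The space `Cov_{d,k}(V)` of covariants of degree `d` and order `k`. -/
def cov (d k : ℕ) : Submodule ℂ (CoordRing n) :=
  Subalgebra.toSubmodule (covAlg n) ⊓ weightedHomogeneousSubmodule ℂ (bidegWeight n) (d, k)

/-- The ideal `C₊ = ∑_{d + k > 0} Cov_{d,k}(V)` of `Cov(V)`, as a space of polynomials. -/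
def covPlus : Submodule ℂ (CoordRing n) :=
  ⨆ (d : ℕ) (k : ℕ) (_ : 0 < d + k), cov n d k

/-- The space of indecomposables `C₊ / C₊²`. -/
abbrev Indecomposables : Type _ := covPlus n ⧸ (covPlus n ^ 2).submoduleOf (covPlus n)

/-- `h` is a minimal basis of `Cov(V)`: its image in `C₊ / C₊²` is a basis, and its members are
bihomogeneous, `h j` being of degree `d j` and order `k j`. -/
structure IsMinimalBasis {N : ℕ} (h : Fin N → covPlus n) (d k : Fin N → ℕ) : Prop where
  bihomogeneous : ∀ j, (h j : CoordRing n) ∈ cov n (d j) (k j)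
  linearIndependent : LinearIndependent ℂ
    (fun j => (Submodule.Quotient.mk (h j) : Indecomposables n))
  span_eq_top : Submodule.span ℂ
    (Set.range fun j => (Submodule.Quotient.mk (h j) : Indecomposables n)) = ⊤

/-- `f` is a finite family of generators of `Cov(V)`, `f j` being bihomogeneous of degree `d j`
and order `a j`. -/
structure IsGeneratingFamily {N : ℕ} (f : Fin N → CoordRing n) (d a : Fin N → ℕ) : Prop where
  bihomogeneous : ∀ j, f j ∈ cov n (d j) (a j)
  adjoin_eq : Algebra.adjoin ℂ (Set.range f) = covAlg n

/-- The covariant `h` of degree `d` and order `k`, not both zero, is reducible: it lies in the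
algebra generated by the covariants of degree `d' ≤ d` and order `k' ≤ k` with `d' < d` or
`k' < k`. -/
structure IsReducible (d k : ℕ) (h : CoordRing n) : Prop where
  mem : h ∈ cov n d k
  nonconstant : 0 < d + k
  mem_adjoin : h ∈ Algebra.adjoin ℂ
    {p : CoordRing n | ∃ d' k', d' ≤ d ∧ k' ≤ k ∧ (d' < d ∨ k' < k) ∧ p ∈ cov n d' k'}

section Transvectant

variable {τ : Type*}

/-- Polynomials in the parameters `τ` and three points of `ℂ²`:
`x_α` (slot `0`), `x_β` (slot `1`) and `x` (slot `2`). -/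
abbrev ThreePoint (τ : Type*) : Type _ := MvPolynomial (τ ⊕ (Fin 3 × Fin 2)) ℂ

/-- `f(x) ↦ f(x_s)`: write a form in the variables of slot `s`. -/
def place (s : Fin 3) : MvPolynomial (τ ⊕ Fin 2) ℂ →ₐ[ℂ] ThreePoint τ :=
  rename (Sum.map id (fun i => (s, i)))

/-- The partial derivative in the `i`-th coordinate of slot `s`. -/
def partialD (s : Fin 3) (i : Fin 2) : Module.End ℂ (ThreePoint τ) :=
  (pderiv (Sum.inr (s, i) : τ ⊕ (Fin 3 × Fin 2))).toLinearMap

/-- The Cayley operator `Ω_{αβ} = ∂/∂x_α ∂/∂y_β - ∂/∂y_α ∂/∂x_β`. -/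
def cayley : Module.End ℂ (ThreePoint τ) :=
  partialD 0 0 * partialD 1 1 - partialD 0 1 * partialD 1 0

/-- The polarization operator `σ_s = x ∂/∂x_s + y ∂/∂y_s`. -/
def polarization (s : Fin 3) : Module.End ℂ (ThreePoint τ) :=
  LinearMap.mulLeft ℂ (X (Sum.inr (2, 0))) * partialD s 0 +
    LinearMap.mulLeft ℂ (X (Sum.inr (2, 1))) * partialD s 1

/-- The transvectant `(f, g)_r` of forms `f`, `g` of orders `m`, `p` whose coefficients are
polynomials in the parameters `τ`: it is `Ω_{αβ}^r σ_α^(m-r) σ_β^(p-r) f(x_α) g(x_β)` if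
`r ≤ min m p`, and `0` otherwise. In the first case no variable of the slots `x_α`, `x_β` is left,
and the final `rename` only reads the result as a polynomial in `τ` and `x`. -/
def transvectant (m p r : ℕ) (f g : MvPolynomial (τ ⊕ Fin 2) ℂ) : MvPolynomial (τ ⊕ Fin 2) ℂ :=
  if r ≤ min m p then
    rename (Sum.map id Prod.snd)
      ((cayley ^ r * polarization 0 ^ (m - r) * polarization 1 ^ (p - r) :
        Module.End ℂ (ThreePoint τ)) (place 0 f * place 1 g))
  else 0

end Transvectant

section DirectSum

variable {ι₁ ι₂ : Type*} (n₁ : ι₁ → ℕ) (n₂ : ι₂ → ℕ)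

/-- Polynomials on `V₁ ⊕ ℂ²` as polynomials on `V₁ ⊕ V₂ ⊕ ℂ²`. -/
def inclLeft : CoordRing n₁ →ₐ[ℂ] CoordRing (Sum.elim n₁ n₂) :=
  rename (Sum.map (fun v => ⟨Sum.inl v.1, v.2⟩) id)

/-- Polynomials on `V₂ ⊕ ℂ²` as polynomials on `V₁ ⊕ V₂ ⊕ ℂ²`. -/
def inclRight : CoordRing n₂ →ₐ[ℂ] CoordRing (Sum.elim n₁ n₂) :=
  rename (Sum.map (fun v => ⟨Sum.inr v.1, v.2⟩) id)

end DirectSum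

end BinaryForms

end

open BinaryForms

/-! Both statements rest on the property `OrderBound n a`: every covariant of order greater than `a`
is a linear combination of products of two covariants of positive order. Generators or a minimal
basis of orders at most `a` give it (`IsGeneratingFamily.orderBound`, `IsMinimalBasis.orderBound`).
Conversely it bounds the orders in every minimal basis, since such products lie in `C₊²`
(`IsMinimalBasis.order_le`).

The heart is Gordan's reduction (`rawTransvectant_mul_mem`): if `r ≤ ord u`, then `(fu, v)_r` is a
multiple of `f (u, v)_r` plus a combination of the `((f, u)_c, v)_{r-c}` with `1 ≤ c ≤ r`. To see
this, apply `Ω₀₁^c Ω₀₂^i Ω₁₂^j` with `c + i + j = r` to `f(x₀) u(x₁) v(x₂)` and set the three points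
equal. Euler's relation yields a three-term relation between the resulting molecules. Modulo
molecules with larger `c`, those with a given `c` are nonnegative multiples of the one with `i = 0`,
and `((f, u)_c, v)_{r-c}` is a positive multiple of it.

Let `A`, `B` be covariants of `V₁`, `V₂` whose transvectant `(A, B)_r` has order `k ≥ a + b`. As
`(ord A - r) + (ord B - r) = k`, either `ord A ≥ r + a` or `ord B ≥ r + b`. In the first case `A` is
a combination of products `fq` with `0 < ord f ≤ a`, so `ord q ≥ r` and Gordan's reduction applies.
The term `f (q, B)_r` is a product of covariants of positive orders as soon as `a < k`, and the
other terms have smaller index and the same order. Induction on `r` finishes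
(`rawTransvectant_incl_mem`). This is (1) when `a` and `b` are positive, since both factors then
have order less than `k`. If `a` or `b` is `0`, only `r = 0` matters, and `UV` is a product of
generators of smaller degree.

For (2) it is also needed that such transvectants span the covariants of `V₁ ⊕ V₂`
(`cov_sumElim_le_span_transvectantSet`). Leading coefficients turn covariants into highest weight
vectors `w` of `ℂ[V₁] ⊗ ℂ[V₂]`. Let `E₁`, `E₂` be the raising operators of the two factors. If
`E₁^{j+1} w = 0`, then `E₁^j w` is killed by `E₁` and `E₂`, hence is a sum of products of highest
weight vectors. Each of these is, up to a nonzero factor, `E₁^j` of the leading coefficient of a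
`j`-th transvectant. Subtracting lowers `j`. Order bounds therefore add under direct sums
(`OrderBound.sumElim`), and one inducts on the number of summands. -/

noncomputable section

namespace BinaryForms

/-! ### Derivations of polynomial rings, and gradings as their eigenspaces -/

section Derivations

variable {σ σ' : Type*}

/-- Both sides are derivations along `φ`, so the variables decide. Together with the commutator
criteria that follow, this reduces identities between first-order operators to a check on variables.
-/
theorem derivation_comp_algHom (φ : MvPolynomial σ ℂ →ₐ[ℂ] MvPolynomial σ' ℂ)
    (D : Derivation ℂ (MvPolynomial σ ℂ) (MvPolynomial σ ℂ))
    (D' : Derivation ℂ (MvPolynomial σ' ℂ) (MvPolynomial σ' ℂ))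
    (h : ∀ v, D' (φ (X v)) = φ (D (X v))) (p : MvPolynomial σ ℂ) : D' (φ p) = φ (D p) := by
  induction p using MvPolynomial.induction_on with
  | C a => simp [← MvPolynomial.algebraMap_eq]
  | add p q hp hq => simp [hp, hq]
  | mul_X p v hp => simp [hp, h, Derivation.leibniz]

theorem derivation_commutator (D₁ D₂ D₃ : Derivation ℂ (MvPolynomial σ ℂ) (MvPolynomial σ ℂ))
    (h : ∀ v, D₁ (D₂ (X v)) - D₂ (D₁ (X v)) = D₃ (X v)) (p : MvPolynomial σ ℂ) :
    D₁ (D₂ p) - D₂ (D₁ p) = D₃ p := by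
  have : ⁅D₁, D₂⁆ = D₃ := derivation_ext fun v => by rw [Derivation.commutator_apply, h]
  rw [← this, Derivation.commutator_apply]

theorem derivation_commute (D₁ D₂ : Derivation ℂ (MvPolynomial σ ℂ) (MvPolynomial σ ℂ))
    (h : ∀ v, D₁ (D₂ (X v)) = D₂ (D₁ (X v))) (p : MvPolynomial σ ℂ) :
    D₁ (D₂ p) = D₂ (D₁ p) :=
  sub_eq_zero.1 (derivation_commutator D₁ D₂ 0 (fun v => by simp [h]) p)

/-- The diagonal derivation `X v ↦ w v • X v`. -/
def diagDer (w : σ → ℂ) : Derivation ℂ (MvPolynomial σ ℂ) (MvPolynomial σ ℂ) :=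
  mkDerivation ℂ fun v => w v • X v

@[simp]
theorem diagDer_X (w : σ → ℂ) (v : σ) : diagDer w (X v) = w v • X v := mkDerivation_X _ _ _

theorem diagDer_monomial (w : σ → ℂ) (s : σ →₀ ℕ) (r : ℂ) :
    diagDer w (monomial s r) = Finsupp.weight w s • monomial s r := by
  rw [diagDer, mkDerivation_monomial, Finsupp.weight_apply, Finsupp.sum, Finsupp.sum,
    Finset.sum_smul, Finset.smul_sum]
  refine Finset.sum_congr rfl fun v hv => ?_
  have hs : s - Finsupp.single v 1 + Finsupp.single v 1 = s := by
    refine tsub_add_cancel_of_le ?_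
    rw [Finsupp.single_le_iff]
    exact Nat.one_le_iff_ne_zero.2 (Finsupp.mem_support_iff.1 hv)
  rw [smul_eq_mul, mul_smul_comm, X, monomial_mul, hs, smul_monomial, smul_monomial, smul_monomial]
  simp
  ring_nf

theorem coeff_diagDer (w : σ → ℂ) (s : σ →₀ ℕ) (p : MvPolynomial σ ℂ) :
    coeff s (diagDer w p) = Finsupp.weight w s * coeff s p := by
  classical
  induction p using MvPolynomial.induction_on' with
  | monomial t r =>
    rw [diagDer_monomial, coeff_smul, smul_eq_mul, coeff_monomial]
    split_ifs with h
    · rw [h]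
    · simp
  | add p q hp hq => simp [hp, hq, mul_add]

theorem weight_eq_of_diagDer_eq {w : σ → ℂ} {c : ℂ} {p : MvPolynomial σ ℂ}
    (h : diagDer w p = c • p) {s : σ →₀ ℕ} (hs : coeff s p ≠ 0) : Finsupp.weight w s = c := by
  have := coeff_diagDer w s p
  rw [h, coeff_smul, smul_eq_mul] at this
  exact (mul_right_cancel₀ hs this).symm

/-- Monomials are eigenvectors with their weight as eigenvalue. Gradings can thus be handled as
linear equations, which pass easily through commutators. -/
theorem diagDer_eq_iff {w : σ → ℂ} {c : ℂ} {p : MvPolynomial σ ℂ} :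
    diagDer w p = c • p ↔ IsWeightedHomogeneous w p c := by
  refine ⟨fun h s hs => weight_eq_of_diagDer_eq h hs, fun h => ?_⟩
  ext s
  rw [coeff_diagDer, coeff_smul, smul_eq_mul]
  by_cases hs : coeff s p = 0
  · simp [hs]
  · rw [h hs]

theorem weight_map {M M' : Type*} [AddCommMonoid M] [AddCommMonoid M'] (θ : M →+ M') (w : σ → M)
    (s : σ →₀ ℕ) : Finsupp.weight (fun v => θ (w v)) s = θ (Finsupp.weight w s) := by
  simp [Finsupp.weight_apply, Finsupp.sum, map_sum]

theorem isWeightedHomogeneous_map_weight {M M' : Type*} [AddCommMonoid M] [AddCommMonoid M']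
    (θ : M →+ M') {w : σ → M} {m : M} {p : MvPolynomial σ ℂ} (h : IsWeightedHomogeneous w p m) :
    IsWeightedHomogeneous (fun v => θ (w v)) p (θ m) := fun s hs => by
  rw [weight_map, h hs]

/-- A derivation that shifts the weights of the variables by `δ` shifts all weights by `δ`. -/
theorem isWeightedHomogeneous_derivation {M : Type*} [AddCommMonoid M] {w : σ → M} (δ : M)
    (D : Derivation ℂ (MvPolynomial σ ℂ) (MvPolynomial σ ℂ))
    (hD : ∀ v, IsWeightedHomogeneous w (D (X v)) (w v + δ)) {m : M} {p : MvPolynomial σ ℂ}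
    (h : IsWeightedHomogeneous w p m) : IsWeightedHomogeneous w (D p) (m + δ) := by
  have hDD : D = mkDerivation ℂ fun v => D (X v) := derivation_ext fun v => by simp
  rw [as_sum p, map_sum]
  refine IsWeightedHomogeneous.sum _ _ _ fun s hs => ?_
  rw [hDD, mkDerivation_monomial]
  refine (weightedHomogeneousSubmodule ℂ w (m + δ)).smul_mem _ ?_
  refine IsWeightedHomogeneous.sum _ _ _ fun v hv => ?_
  have hs' : s - Finsupp.single v 1 + Finsupp.single v 1 = s := by
    refine tsub_add_cancel_of_le ?_
    rw [Finsupp.single_le_iff]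
    exact Nat.one_le_iff_ne_zero.2 (Finsupp.mem_support_iff.1 hv)
  have h1 : m + δ = Finsupp.weight w (s - Finsupp.single v 1) + (w v + δ) := by
    have h2 : Finsupp.weight w s = m := h (mem_support_iff.1 hs)
    rw [← hs', map_add, Finsupp.weight_single, one_smul] at h2
    rw [← h2, add_assoc]
  rw [h1]
  exact (isWeightedHomogeneous_monomial w _ _ rfl).mul (hD v)

/-- Chain rule: for a curve whose velocity is given by the vector field `D`, differentiating a
polynomial function amounts to applying `D`. -/
theorem hasDerivAt_aeval (D : Derivation ℂ (MvPolynomial σ ℂ) (MvPolynomial σ ℂ))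
    (z : ℂ → σ → ℂ) (t : ℂ) (h : ∀ v, HasDerivAt (fun s => z s v) (aeval (z t) (D (X v))) t)
    (p : MvPolynomial σ ℂ) :
    HasDerivAt (fun s => aeval (z s) p) (aeval (z t) (D p)) t := by
  induction p using MvPolynomial.induction_on with
  | C a => simpa [← MvPolynomial.algebraMap_eq] using hasDerivAt_const t a
  | add p q hp hq => simpa using hp.fun_add hq
  | mul_X p v hp =>
    have := hp.fun_mul (h v)
    simp only [map_mul, aeval_X, Derivation.leibniz, smul_eq_mul, map_add]
    rw [add_comm, mul_comm (z t v)]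
    exact this

end Derivations

/-! ### One-parameter unipotent groups acting on binary forms -/

section OneParameter

/-- The derivation `X i ↦ -∑ j, N i j * X j` on binary forms. -/
def formDer (N : Matrix (Fin 2) (Fin 2) ℂ) :
    Derivation ℂ (MvPolynomial (Fin 2) ℂ) (MvPolynomial (Fin 2) ℂ) :=
  mkDerivation ℂ fun i => -∑ j, N i j • X j

theorem hasDerivAt_coeff_mul {σ : Type*} {P Q : ℂ → MvPolynomial σ ℂ} {P' Q' : MvPolynomial σ ℂ}
    {t : ℂ} (hP : ∀ s, HasDerivAt (fun t => coeff s (P t)) (coeff s P') t)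
    (hQ : ∀ s, HasDerivAt (fun t => coeff s (Q t)) (coeff s Q') t) (s : σ →₀ ℕ) :
    HasDerivAt (fun t => coeff s (P t * Q t)) (coeff s (P' * Q t + P t * Q')) t := by
  classical
  simp only [coeff_add, coeff_mul, ← Finset.sum_add_distrib]
  exact HasDerivAt.fun_sum fun x _ => (hP x.1).fun_mul (hQ x.2)

variable {N : Matrix (Fin 2) (Fin 2) ℂ} (hN : N * N = 0)
  {g : ℂ → Matrix.SpecialLinearGroup (Fin 2) ℂ}
  (hg : ∀ t, ((g t : Matrix.SpecialLinearGroup (Fin 2) ℂ) : Matrix _ _ ℂ) = 1 + t • N)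
  (hg' : ∀ t, (((g t)⁻¹ : Matrix.SpecialLinearGroup (Fin 2) ℂ) : Matrix _ _ ℂ) = 1 - t • N)

include hN hg'

/-- On variables the substitution is affine in `t`, and `N * N = 0` makes `formDer N` kill the
linear term. The velocity is therefore `formDer N` of the moving form at every `t`, not only at `t =
0`. -/
theorem hasDerivAt_coeff_substInv (f : MvPolynomial (Fin 2) ℂ) (t : ℂ) (s : Fin 2 →₀ ℕ) :
    HasDerivAt (fun t => coeff s (substInv (g t) f)) (coeff s (formDer N (substInv (g t) f))) t := by
  induction f using MvPolynomial.induction_on generalizing s with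
  | C a => simpa [← MvPolynomial.algebraMap_eq] using hasDerivAt_const t _
  | add p q hp hq => simpa using (hp s).fun_add (hq s)
  | mul_X p i hp =>
    simp only [map_mul]
    have hX : ∀ t, substInv (g t) (X i) = X i - t • ∑ j, N i j • X j := by
      intro t
      simp only [substInv, aeval_X, hg']
      fin_cases i <;> simp [Fin.sum_univ_two, smul_eq_C_mul, Matrix.one_apply] <;> ring
    have hN' : formDer N (∑ j, N i j • X j) = 0 := by
      have h0 : ∀ k, ∑ j, N i j * N j k = 0 := fun k => by
        have := congrFun (congrFun hN i) k
        rwa [Matrix.mul_apply] at this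
      simp only [map_sum, Derivation.map_smul, formDer, mkDerivation_X, smul_neg, Finset.smul_sum,
        smul_smul, Finset.sum_neg_distrib]
      rw [Finset.sum_comm]
      simp [← Finset.sum_smul, h0]
    have h1 : ∀ s, HasDerivAt (fun t => coeff s (substInv (g t) (X i)))
        (coeff s (formDer N (substInv (g t) (X i)))) t := by
      intro s
      simp only [hX, map_sub, Derivation.map_smul, hN', smul_zero, sub_zero]
      simp only [coeff_sub, coeff_smul, formDer, mkDerivation_X, coeff_neg, smul_eq_mul]
      have := ((hasDerivAt_id t).mul_const (coeff s (∑ j, N i j • X j))).const_sub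
        (coeff s (X i : MvPolynomial (Fin 2) ℂ))
      simpa using this
    have h2 := hasDerivAt_coeff_mul (t := t) hp h1 s
    rw [Derivation.leibniz, smul_eq_mul, smul_eq_mul]
    convert h2 using 2
    ring

end OneParameter

/-! ### The action of the nilpotent matrices on coefficients -/

section CoeffDerivations

variable {ι : Type*} {n : ι → ℕ}

/-- The coordinate `a_{k-1}` for the coordinate `a_k`. -/
def prevVar (v : CoeffVar n) : CoeffVar n := ⟨v.1, ⟨v.2 - 1, by have := v.2.2; omega⟩⟩

/-- The coordinate `a_{k+1}` for the coordinate `a_k`. -/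
def nextVar (v : CoeffVar n) : CoeffVar n := ⟨v.1, ⟨min (v.2 + 1) (n v.1), by omega⟩⟩

/-- The raising operator on coefficients, `a_k ↦ -k a_{k-1}`, with a multiplier on each form. -/
def raiseCoeff (χ : ι → ℂ) (v : CoeffVar n) : MvPolynomial (CoeffVar n) ℂ :=
  -(χ v.1 * ((v.2 : ℕ) : ℂ)) • X (prevVar v)

/-- The lowering operator on coefficients, `a_k ↦ -(m - k) a_{k+1}`, with a multiplier on each
form. -/
def lowerCoeff (χ : ι → ℂ) (v : CoeffVar n) : MvPolynomial (CoeffVar n) ℂ :=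
  -(χ v.1 * ((n v.1 : ℂ) - ((v.2 : ℕ) : ℂ))) • X (nextVar v)

end CoeffDerivations

/-! ### Derivations acting on parameters and on points simultaneously -/

section Slots

variable {τ : Type*}

/-- The derivation of `ℂ[τ][x]` given by `e` on `τ` and by the matrix `N` on `x`. -/
def pointDer (e : τ → MvPolynomial τ ℂ) (N : Matrix (Fin 2) (Fin 2) ℂ) :
    Derivation ℂ (MvPolynomial (τ ⊕ Fin 2) ℂ) (MvPolynomial (τ ⊕ Fin 2) ℂ) :=
  mkDerivation ℂ (Sum.elim (fun t => rename Sum.inl (e t)) fun i => ∑ j, N i j • X (Sum.inr j))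

@[simp]
theorem pointDer_inl (e : τ → MvPolynomial τ ℂ) (N : Matrix (Fin 2) (Fin 2) ℂ) (t : τ) :
    pointDer e N (X (Sum.inl t)) = rename Sum.inl (e t) := mkDerivation_X _ _ _

@[simp]
theorem pointDer_inr (e : τ → MvPolynomial τ ℂ) (N : Matrix (Fin 2) (Fin 2) ℂ) (i : Fin 2) :
    pointDer e N (X (Sum.inr i)) = ∑ j, N i j • X (Sum.inr j) := mkDerivation_X _ _ _

/-- The derivation of `ℂ[τ][x_0, x_1, x_2]` given by `e` on `τ` and by the matrix `N` on every
point. -/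
def slotDer (e : τ → MvPolynomial τ ℂ) (N : Matrix (Fin 2) (Fin 2) ℂ) :
    Derivation ℂ (ThreePoint τ) (ThreePoint τ) :=
  mkDerivation ℂ (Sum.elim (fun t => rename Sum.inl (e t))
    fun a => ∑ j, N a.2 j • X (Sum.inr (a.1, j)))

@[simp]
theorem slotDer_inl (e : τ → MvPolynomial τ ℂ) (N : Matrix (Fin 2) (Fin 2) ℂ) (t : τ) :
    slotDer e N (X (Sum.inl t)) = rename Sum.inl (e t) := mkDerivation_X _ _ _

@[simp]
theorem slotDer_inr (e : τ → MvPolynomial τ ℂ) (N : Matrix (Fin 2) (Fin 2) ℂ) (a : Fin 3 × Fin 2) :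
    slotDer e N (X (Sum.inr a)) = ∑ j, N a.2 j • X (Sum.inr (a.1, j)) := mkDerivation_X _ _ _

end Slots

/-- The nilpotent matrix `x ↦ (y, 0)`. -/
def upperNil : Matrix (Fin 2) (Fin 2) ℂ := !![0, 1; 0, 0]

/-- The nilpotent matrix `x ↦ (0, x)`. -/
def lowerNil : Matrix (Fin 2) (Fin 2) ℂ := !![0, 0; 1, 0]

/-! ### Infinitesimal criterion for covariance -/

section Criterion

variable {ι : Type*} (n : ι → ℕ)

/-- The derivation of `ℂ[V ⊕ ℂ²]` given by the upper nilpotent matrix. -/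
def raiseDer : Derivation ℂ (CoordRing n) (CoordRing n) := pointDer (raiseCoeff 1) upperNil

/-- The derivation of `ℂ[V ⊕ ℂ²]` given by the lower nilpotent matrix. -/
def lowerDer : Derivation ℂ (CoordRing n) (CoordRing n) := pointDer (lowerCoeff 1) lowerNil

variable {n}

/-- The operator is `-y ∂/∂x`, and the binomial normalization gives `a_k ↦ -k a_{k-1}`. The
truncated index `k - 1` at `k = 0` is harmless because of the factor `k`. -/
theorem coeff_formDer_upper {m : ℕ} (f : MvPolynomial (Fin 2) ℂ) (k : ℕ) (hk : k ≤ m) :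
    coeff (Finsupp.single 0 (m - k) + Finsupp.single 1 k) (formDer upperNil f) / (m.choose k : ℂ)
      = -(k : ℂ) * (coeff (Finsupp.single 0 (m - (k - 1)) + Finsupp.single 1 (k - 1)) f /
        (m.choose (k - 1) : ℂ)) := by
  have h : formDer upperNil f = -(X 1 * pderiv 0 f) := by
    have : formDer upperNil = (-X 1 : MvPolynomial (Fin 2) ℂ) • pderiv 0 := by
      refine derivation_ext fun i => ?_
      fin_cases i <;> simp [formDer, upperNil, mkDerivation_X, pderiv_X]
    rw [this]; simp
  rw [h, coeff_neg, coeff_X_mul', coeff_pderiv]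
  rcases k with _ | k
  · simp
  · have h1 : (Finsupp.single (0 : Fin 2) (m - (k + 1)) + Finsupp.single 1 (k + 1)
        - Finsupp.single 1 1 + Finsupp.single 0 1 : Fin 2 →₀ ℕ)
        = Finsupp.single 0 (m - k) + Finsupp.single 1 k := by
      ext i; fin_cases i <;> simp <;> omega
    have h2 : (1 : Fin 2) ∈ (Finsupp.single (0 : Fin 2) (m - (k + 1)) +
        Finsupp.single 1 (k + 1) : Fin 2 →₀ ℕ).support := by simp
    rw [if_pos h2, h1]
    have h3 : ((m.choose (k + 1) : ℕ) : ℂ) * (k + 1) = m.choose k * ((m - (k + 1) : ℕ) + 1) := by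
      have := Nat.choose_succ_right_eq m k
      have h4 : m - k = m - (k + 1) + 1 := by omega
      rw [h4] at this
      exact_mod_cast this
    have h5 : ((m.choose (k + 1) : ℕ) : ℂ) ≠ 0 := by exact_mod_cast (Nat.choose_pos hk).ne'
    have h6 : ((m.choose k : ℕ) : ℂ) ≠ 0 := by
      exact_mod_cast (Nat.choose_pos (by omega : k ≤ m)).ne'
    simp only [Nat.add_sub_cancel]
    generalize coeff (Finsupp.single 0 (m - k) + Finsupp.single 1 k) f = c
    simp
    field_simp
    linear_combination c * h3

/-- The operator is `-x ∂/∂y`. The cut-off `min (k + 1) m` only acts at `k = m`, where the factor `m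
- k` vanishes. -/
theorem coeff_formDer_lower {m : ℕ} (f : MvPolynomial (Fin 2) ℂ) (k : ℕ) (hk : k ≤ m) :
    coeff (Finsupp.single 0 (m - k) + Finsupp.single 1 k) (formDer lowerNil f) / (m.choose k : ℂ)
      = -((m : ℂ) - k) * (coeff (Finsupp.single 0 (m - min (k + 1) m) +
        Finsupp.single 1 (min (k + 1) m)) f / (m.choose (min (k + 1) m) : ℂ)) := by
  have h : formDer lowerNil f = -(X 0 * pderiv 1 f) := by
    have : formDer lowerNil = (-X 0 : MvPolynomial (Fin 2) ℂ) • pderiv 1 := by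
      refine derivation_ext fun i => ?_
      fin_cases i <;> simp [formDer, lowerNil, mkDerivation_X, pderiv_X]
    rw [this]; simp
  rw [h, coeff_neg, coeff_X_mul', coeff_pderiv]
  rcases hk.eq_or_lt with rfl | hk
  · simp
  · have h1 : (Finsupp.single (0 : Fin 2) (m - k) + Finsupp.single 1 k
        - Finsupp.single 0 1 + Finsupp.single 1 1 : Fin 2 →₀ ℕ)
        = Finsupp.single 0 (m - (k + 1)) + Finsupp.single 1 (k + 1) := by
      ext i; fin_cases i <;> simp <;> omega
    have h2 : (0 : Fin 2) ∈ (Finsupp.single (0 : Fin 2) (m - k) +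
        Finsupp.single 1 k : Fin 2 →₀ ℕ).support := by simp; omega
    rw [if_pos h2, h1, min_eq_left (by omega : k + 1 ≤ m)]
    have h3 : ((m.choose (k + 1) : ℕ) : ℂ) * (k + 1) = m.choose k * (m - k) := by
      have := Nat.choose_succ_right_eq m k
      rw [← Nat.cast_sub hk.le]
      exact_mod_cast this
    have h5 : ((m.choose (k + 1) : ℕ) : ℂ) ≠ 0 := by
      exact_mod_cast (Nat.choose_pos (by omega : k + 1 ≤ m)).ne'
    have h6 : ((m.choose k : ℕ) : ℂ) ≠ 0 := by exact_mod_cast (Nat.choose_pos hk.le).ne'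
    generalize coeff (Finsupp.single 0 (m - (k + 1)) + Finsupp.single 1 (k + 1)) f = c
    simp
    field_simp
    linear_combination -c * h3

/-- The coordinates of the point `(f, x)`. -/
def pointCoord (f : ∀ i, BinForm (n i)) (x : Fin 2 → ℂ) : CoeffVar n ⊕ Fin 2 → ℂ :=
  Sum.elim (fun v : CoeffVar n => formCoeff (f v.1) v.2) x

theorem exists_pointCoord_eq (z : CoeffVar n ⊕ Fin 2 → ℂ) : ∃ f x, pointCoord (n := n) f x = z := by
  have hmem : ∀ i, (∑ k : Fin (n i + 1), monomial (Finsupp.single 0 (n i - (k : ℕ)) +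
      Finsupp.single 1 (k : ℕ)) (((n i).choose k : ℂ) * z (Sum.inl ⟨i, k⟩)) :
      MvPolynomial (Fin 2) ℂ) ∈ homogeneousSubmodule (Fin 2) ℂ (n i) := fun i => by
    refine Submodule.sum_mem _ fun k _ => isHomogeneous_monomial _ ?_
    have := k.2
    rw [map_add, Finsupp.degree_single, Finsupp.degree_single]
    omega
  refine ⟨fun i => ⟨_, hmem i⟩, fun j => z (Sum.inr j), ?_⟩
  ext v
  rcases v with ⟨i, k⟩ | j
  · simp only [pointCoord, Sum.elim_inl, formCoeff, coeff_sum, coeff_monomial]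
    rw [Finset.sum_eq_single k]
    · have : (((n i).choose k : ℕ) : ℂ) ≠ 0 := by
        exact_mod_cast (Nat.choose_pos (Nat.lt_succ_iff.1 k.2)).ne'
      simp [this]
    · intro l _ hl
      rw [if_neg]
      intro h
      have := DFunLike.congr_fun h 1
      simp at this
      exact hl (Fin.ext this)
    · simp
  · rfl

theorem eq_zero_of_evalAt {p : CoordRing n} (h : ∀ f x, evalAt n f x p = 0) : p = 0 := by
  refine MvPolynomial.funext fun z => ?_
  obtain ⟨f, x, rfl⟩ := exists_pointCoord_eq z
  have := h f x
  rw [map_zero]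
  exact this

theorem substInv_mul (g h : Matrix.SpecialLinearGroup (Fin 2) ℂ) (p : MvPolynomial (Fin 2) ℂ) :
    substInv (g * h) p = substInv g (substInv h p) := by
  have : substInv (g * h) = (substInv g).comp (substInv h) := by
    refine algHom_ext fun i => ?_
    simp only [substInv, AlgHom.comp_apply, aeval_X, map_sum, map_mul, mul_inv_rev]
    simp only [Matrix.SpecialLinearGroup.coe_mul, Matrix.mul_apply, Fin.sum_univ_two, map_add,
      map_mul, ← MvPolynomial.algebraMap_eq, AlgHom.commutes]
    ring
  rw [this]; rfl

theorem substInv_one (p : MvPolynomial (Fin 2) ℂ) : substInv 1 p = p := by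
  have : substInv 1 = AlgHom.id ℂ _ := by
    refine algHom_ext fun i => ?_
    fin_cases i <;> simp [substInv, Matrix.one_apply]
  rw [this]; rfl

theorem actForm_mul (g h : Matrix.SpecialLinearGroup (Fin 2) ℂ) {m : ℕ} (f : BinForm m) :
    actForm (g * h) f = actForm g (actForm h f) := Subtype.ext (substInv_mul g h f.1)

theorem actForm_one {m : ℕ} (f : BinForm m) : actForm 1 f = f := Subtype.ext (substInv_one f.1)

section OneParameter

variable {N : Matrix (Fin 2) (Fin 2) ℂ} (hN : N * N = 0)
  {g : ℂ → Matrix.SpecialLinearGroup (Fin 2) ℂ}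
  (hg : ∀ t, ((g t : Matrix.SpecialLinearGroup (Fin 2) ℂ) : Matrix _ _ ℂ) = 1 + t • N)
  (hg' : ∀ t, (((g t)⁻¹ : Matrix.SpecialLinearGroup (Fin 2) ℂ) : Matrix _ _ ℂ) = 1 - t • N)
  {e : CoeffVar n → MvPolynomial (CoeffVar n) ℂ}
  (he : ∀ (f : ∀ i, BinForm (n i)) (v : CoeffVar n),
    coeff (Finsupp.single 0 (n v.1 - (v.2 : ℕ)) + Finsupp.single 1 (v.2 : ℕ))
      (formDer N (f v.1).1) / ((n v.1).choose v.2 : ℂ)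
      = aeval (fun v : CoeffVar n => formCoeff (f v.1) v.2) (e v))

include hN hg hg' he

theorem hasDerivAt_evalAt (f : ∀ i, BinForm (n i)) (x : Fin 2 → ℂ) (p : CoordRing n) (t : ℂ) :
    HasDerivAt (fun t => evalAt n (fun i => actForm (g t) (f i)) ((g t).1.mulVec x) p)
      (evalAt n (fun i => actForm (g t) (f i)) ((g t).1.mulVec x) (pointDer e N p)) t := by
  refine hasDerivAt_aeval (pointDer e N)
    (fun t => pointCoord (fun i => actForm (g t) (f i)) ((g t).1.mulVec x)) t (fun v => ?_) p
  rcases v with v | j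
  · have h1 := (hasDerivAt_coeff_substInv hN hg' (f v.1).1 t
      (Finsupp.single 0 (n v.1 - (v.2 : ℕ)) + Finsupp.single 1 (v.2 : ℕ))).div_const
      ((n v.1).choose v.2 : ℂ)
    have h2 := he (fun i => actForm (g t) (f i)) v
    have h3 : aeval (pointCoord (fun i => actForm (g t) (f i)) ((g t).1.mulVec x))
        (pointDer e N (X (Sum.inl v))) =
        aeval (fun v : CoeffVar n => formCoeff (actForm (g t) (f v.1)) v.2) (e v) := by
      rw [pointDer_inl, aeval_rename]; rfl
    rw [h3, ← h2]
    exact h1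
  · have h0 : ∀ k, ∑ i, N j i * N i k = 0 := fun k => by
      have := congrFun (congrFun hN j) k
      rwa [Matrix.mul_apply] at this
    have h3 : aeval (pointCoord (fun i => actForm (g t) (f i)) ((g t).1.mulVec x))
        (pointDer e N (X (Sum.inr j))) = N.mulVec x j := by
      rw [pointDer_inr, map_sum]
      have : ∀ k, (g t).1.mulVec x k = x k + t * N.mulVec x k := fun k => by
        rw [hg, Matrix.add_mulVec, Matrix.one_mulVec, Matrix.smul_mulVec]; rfl
      simp only [map_smul, aeval_X, pointCoord, Sum.elim_inr, this, smul_eq_mul, mul_add,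
        Finset.sum_add_distrib]
      have h4 : ∑ k, N j k * (t * N.mulVec x k) = t * (N * N).mulVec x j := by
        rw [← Matrix.mulVec_mulVec, Matrix.mulVec, dotProduct, Finset.mul_sum]
        exact Finset.sum_congr rfl fun _ _ => by ring
      rw [h4, hN]
      simp [Matrix.mulVec, dotProduct]
    rw [h3]
    have : (fun t => pointCoord (fun i => actForm (g t) (f i)) ((g t).1.mulVec x) (Sum.inr j))
        = fun t => x j + t * N.mulVec x j := by
      ext t
      simp only [pointCoord, Sum.elim_inr]
      rw [hg, Matrix.add_mulVec, Matrix.one_mulVec, Matrix.smul_mulVec]; rfl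
    rw [this]
    simpa using ((hasDerivAt_id t).mul_const (N.mulVec x j)).const_add (x j)

/-- Along an orbit, the derivative of the value of `p` is the value of `pointDer e N p` at the
moving point. If it vanishes the value is constant; if the value is constant, `t = 0` shows that
`pointDer e N p` vanishes at every point. -/
theorem pointDer_eq_zero_iff (p : CoordRing n) :
    pointDer e N p = 0 ↔ ∀ t (f : ∀ i, BinForm (n i)) (x : Fin 2 → ℂ),
      evalAt n (fun i => actForm (g t) (f i)) ((g t).1.mulVec x) p = evalAt n f x p := by
  have g0 : g 0 = 1 := by
    ext i j
    rw [hg]; simp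
  have g0x : ∀ x, (g 0).1.mulVec x = x := fun x => by
    rw [hg]; simp
  constructor
  · intro h t f x
    have h1 := hasDerivAt_evalAt hN hg hg' he f x p
    simp only [h, map_zero] at h1
    have := is_const_of_deriv_eq_zero (fun t => (h1 t).differentiableAt)
      (fun t => (h1 t).deriv) t 0
    simp only [g0, actForm_one] at this
    rw [this]
    simp
  · intro h
    refine eq_zero_of_evalAt fun f x => ?_
    have h1 := hasDerivAt_evalAt hN hg hg' he f x p 0
    simp only [h] at h1
    rw [g0x] at h1
    simp only [g0, actForm_one] at h1
    exact h1.unique (hasDerivAt_const _ _)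

end OneParameter

/-- The upper unipotent matrices. -/
def upperUnip (t : ℂ) : Matrix.SpecialLinearGroup (Fin 2) ℂ := ⟨!![1, t; 0, 1], by simp⟩

/-- The lower unipotent matrices. -/
def lowerUnip (t : ℂ) : Matrix.SpecialLinearGroup (Fin 2) ℂ := ⟨!![1, 0; t, 1], by simp⟩

theorem coe_upperUnip (t : ℂ) : (upperUnip t : Matrix (Fin 2) (Fin 2) ℂ) = !![1, t; 0, 1] := rfl

theorem coe_lowerUnip (t : ℂ) : (lowerUnip t : Matrix (Fin 2) (Fin 2) ℂ) = !![1, 0; t, 1] := rfl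

theorem raiseDer_eq_zero_iff (p : CoordRing n) :
    raiseDer n p = 0 ↔ ∀ t (f : ∀ i, BinForm (n i)) (x : Fin 2 → ℂ),
      evalAt n (fun i => actForm (upperUnip t) (f i)) ((upperUnip t).1.mulVec x) p
        = evalAt n f x p := by
  refine pointDer_eq_zero_iff (g := upperUnip) ?_ ?_ ?_ ?_ p
  · ext i j; fin_cases i <;> fin_cases j <;> simp [upperNil]
  · intro t; ext i j; fin_cases i <;> fin_cases j <;> simp [upperUnip, upperNil]
  · intro t
    ext i j; fin_cases i <;> fin_cases j <;>
      simp [upperNil, Matrix.SpecialLinearGroup.coe_inv, coe_upperUnip, Matrix.adjugate_fin_two]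
  · intro f v
    rw [coeff_formDer_upper _ _ (Nat.lt_succ_iff.1 v.2.2), raiseCoeff, map_smul, aeval_X]
    simp [formCoeff, prevVar]

theorem lowerDer_eq_zero_iff (p : CoordRing n) :
    lowerDer n p = 0 ↔ ∀ t (f : ∀ i, BinForm (n i)) (x : Fin 2 → ℂ),
      evalAt n (fun i => actForm (lowerUnip t) (f i)) ((lowerUnip t).1.mulVec x) p
        = evalAt n f x p := by
  refine pointDer_eq_zero_iff (g := lowerUnip) ?_ ?_ ?_ ?_ p
  · ext i j; fin_cases i <;> fin_cases j <;> simp [lowerNil]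
  · intro t; ext i j; fin_cases i <;> fin_cases j <;> simp [lowerUnip, lowerNil]
  · intro t
    ext i j; fin_cases i <;> fin_cases j <;>
      simp [lowerNil, Matrix.SpecialLinearGroup.coe_inv, coe_lowerUnip, Matrix.adjugate_fin_two]
  · intro f v
    rw [coeff_formDer_lower _ _ (Nat.lt_succ_iff.1 v.2.2), lowerCoeff, map_smul, aeval_X]
    simp [formCoeff, nextVar]

/-- Covariance is invariance under the Lie algebra. -/
theorem mem_covAlg_iff (p : CoordRing n) :
    p ∈ covAlg n ↔ raiseDer n p = 0 ∧ lowerDer n p = 0 := by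
  rw [raiseDer_eq_zero_iff, lowerDer_eq_zero_iff]
  refine ⟨fun h => ⟨fun t => h _, fun t => h _⟩, fun ⟨hU, hL⟩ => ?_⟩
  let Q : Matrix.SpecialLinearGroup (Fin 2) ℂ → Prop := fun g =>
    ∀ (f : ∀ i, BinForm (n i)) (x : Fin 2 → ℂ),
      evalAt n (fun i => actForm g (f i)) (g.1.mulVec x) p = evalAt n f x p
  have hmul : ∀ g h, Q g → Q h → Q (g * h) := fun g h hg hh f x => by
    rw [← hh f x, ← hg (fun i => actForm h (f i)) (h.1.mulVec x)]
    simp only [actForm_mul, Matrix.SpecialLinearGroup.coe_mul, Matrix.mulVec_mulVec]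
  have hU : ∀ t, Q (upperUnip t) := hU
  have hL : ∀ t, Q (lowerUnip t) := hL
  -- Bruhat decomposition: a matrix with nonzero lower left entry is a product upper · lower · upper
  -- of unipotent matrices.
  have hne : ∀ g : Matrix.SpecialLinearGroup (Fin 2) ℂ, g.1 1 0 ≠ 0 → Q g := fun g hc => by
    have hdet := g.det_coe
    rw [Matrix.det_fin_two] at hdet
    have : g = upperUnip ((g.1 0 0 - 1) / g.1 1 0) * lowerUnip (g.1 1 0) *
        upperUnip ((g.1 1 1 - 1) / g.1 1 0) := by
      ext i j
      fin_cases i <;> fin_cases j <;>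
        simp [coe_upperUnip, coe_lowerUnip, Matrix.SpecialLinearGroup.coe_mul, Matrix.mul_apply,
          Fin.sum_univ_two] <;> field_simp <;>
        first | ring1 | linear_combination hdet | linear_combination -hdet
    rw [this]
    exact hmul _ _ (hmul _ _ (hU _) (hL _)) (hU _)
  change ∀ g, Q g
  intro g
  by_cases hc : g.1 1 0 = 0
  · have hdet := g.det_coe
    rw [Matrix.det_fin_two] at hdet
    have ha : g.1 0 0 ≠ 0 := by
      intro ha
      rw [ha, hc] at hdet
      simp at hdet
    -- If the lower left entry is zero, multiplication by `lowerUnip 1` puts the nonzero entry `g 0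
    -- 0` in its place.
    have h1 : lowerUnip (-1) * lowerUnip 1 = 1 := by
      ext i j
      fin_cases i <;> fin_cases j <;>
        simp [coe_lowerUnip, Matrix.SpecialLinearGroup.coe_mul]
    rw [← one_mul g, ← h1, mul_assoc]
    refine hmul _ _ (hL _) (hne _ ?_)
    rw [Matrix.SpecialLinearGroup.coe_mul, Matrix.mul_apply]
    simpa [coe_lowerUnip, Fin.sum_univ_two, hc] using ha
  · exact hne g hc

end Criterion

/-! ### Cayley, Euler and merging operators on three points -/

section SlotOperators

variable {τ : Type*}

/-- The Cayley operator of the slots `s` and `t`. -/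
def slotCayley (s t : Fin 3) : Module.End ℂ (ThreePoint τ) :=
  partialD s 0 * partialD t 1 - partialD s 1 * partialD t 0

/-- Putting all three points equal to `x`. -/
def diagonal : ThreePoint τ →ₐ[ℂ] MvPolynomial (τ ⊕ Fin 2) ℂ := rename (Sum.map id Prod.snd)

/-- The transvectant without its numerical factor. -/
def rawTransvectant (r : ℕ) (f g : MvPolynomial (τ ⊕ Fin 2) ℂ) : MvPolynomial (τ ⊕ Fin 2) ℂ :=
  diagonal ((slotCayley 0 1 ^ r) (place 0 f * place 1 g))

/-- Renumbering, or merging, the slots. -/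
def slotMap (φ : Fin 3 → Fin 3) : ThreePoint τ →ₐ[ℂ] ThreePoint τ :=
  rename (Sum.map id (Prod.map φ id))

/-- The Euler operator of a slot. -/
def slotEuler (s : Fin 3) : Derivation ℂ (ThreePoint τ) (ThreePoint τ) :=
  diagDer (Sum.elim 0 fun a => if a.1 = s then 1 else 0)

/-- The Euler operator in `x`. -/
def orderDer : Derivation ℂ (MvPolynomial (τ ⊕ Fin 2) ℂ) (MvPolynomial (τ ⊕ Fin 2) ℂ) :=
  diagDer (Sum.elim 0 1)

theorem partialD_apply (s : Fin 3) (i : Fin 2) (p : ThreePoint τ) :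
    partialD s i p = pderiv (Sum.inr (s, i)) p := rfl

theorem partialD_mul (s : Fin 3) (i : Fin 2) (p q : ThreePoint τ) :
    partialD s i (p * q) = partialD s i p * q + p * partialD s i q := by
  simp only [partialD_apply, pderiv_mul]

theorem slotCayley_apply (s t : Fin 3) (p : ThreePoint τ) :
    slotCayley s t p = partialD s 0 (partialD t 1 p) - partialD s 1 (partialD t 0 p) := rfl

theorem pderiv_pderiv_X {σ : Type*} (a b v : σ) :
    pderiv a (pderiv b (X v : MvPolynomial σ ℂ)) = 0 := by
  classical
  rw [pderiv_X]
  by_cases h : v = b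
  · subst h; simp
  · simp [Ne.symm h]

theorem pderiv_comm {σ : Type*} (a b : σ) (p : MvPolynomial σ ℂ) :
    pderiv a (pderiv b p) = pderiv b (pderiv a p) :=
  derivation_commute _ _ (fun v => by rw [pderiv_pderiv_X, pderiv_pderiv_X]) p

theorem partialD_commute (s t : Fin 3) (i j : Fin 2) :
    Commute (partialD (τ := τ) s i) (partialD t j) :=
  LinearMap.ext fun p => pderiv_comm _ _ p

theorem slotCayley_commute_partialD (s t u : Fin 3) (i : Fin 2) :
    Commute (slotCayley (τ := τ) s t) (partialD u i) :=
  ((partialD_commute _ _ _ _).mul_left (partialD_commute _ _ _ _)).sub_left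
    ((partialD_commute _ _ _ _).mul_left (partialD_commute _ _ _ _))

theorem slotCayley_commute (s t u v : Fin 3) :
    Commute (slotCayley (τ := τ) s t) (slotCayley u v) :=
  ((slotCayley_commute_partialD _ _ _ _).mul_right (slotCayley_commute_partialD _ _ _ _)).sub_right
    ((slotCayley_commute_partialD _ _ _ _).mul_right (slotCayley_commute_partialD _ _ _ _))

theorem partialD_place_self (s : Fin 3) (i : Fin 2) (f : MvPolynomial (τ ⊕ Fin 2) ℂ) :
    partialD s i (place s f) = place s (pderiv (Sum.inr i) f) := by
  classical
  refine derivation_comp_algHom (place s) (pderiv (Sum.inr i)) (pderiv (Sum.inr (s, i))) ?_ f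
  rintro (t | j)
  · simp [place, pderiv_X]
  · by_cases h : j = i <;> simp [place, pderiv_X, h]

theorem partialD_place_of_ne {s t : Fin 3} (h : s ≠ t) (i : Fin 2)
    (f : MvPolynomial (τ ⊕ Fin 2) ℂ) : partialD t i (place s f) = 0 := by
  classical
  have := derivation_comp_algHom (place (τ := τ) s) 0 (pderiv (Sum.inr (t, i))) ?_ f
  · simpa [partialD_apply] using this
  rintro (t | j)
  · simp [place, pderiv_X]
  · simp [place, pderiv_X, h]

theorem slotCayley_place_mul_place (f g : MvPolynomial (τ ⊕ Fin 2) ℂ) :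
    slotCayley 0 1 (place 0 f * place 1 g) =
      place 0 (pderiv (Sum.inr 0) f) * place 1 (pderiv (Sum.inr 1) g) -
      place 0 (pderiv (Sum.inr 1) f) * place 1 (pderiv (Sum.inr 0) g) := by
  simp [slotCayley_apply, partialD_mul, partialD_place_self, partialD_place_of_ne]

theorem slotCayley_mul_of_const {s t : Fin 3} {H : ThreePoint τ} (hs : ∀ i, partialD s i H = 0)
    (ht : ∀ i, partialD t i H = 0) (G : ThreePoint τ) :
    slotCayley s t (H * G) = H * slotCayley s t G := by
  simp [slotCayley_apply, partialD_mul, hs, ht, mul_sub]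

theorem slotCayley_pow_mul_of_const {s t : Fin 3} {H : ThreePoint τ}
    (hs : ∀ i, partialD s i H = 0) (ht : ∀ i, partialD t i H = 0) (r : ℕ) (G : ThreePoint τ) :
    (slotCayley s t ^ r) (H * G) = H * (slotCayley s t ^ r) G := by
  induction r generalizing G with
  | zero => rfl
  | succ r ih => rw [pow_succ, Module.End.mul_apply, slotCayley_mul_of_const hs ht, ih]; rfl

theorem diagonal_place (s : Fin 3) (f : MvPolynomial (τ ⊕ Fin 2) ℂ) :
    diagonal (place s f) = f := by
  rw [diagonal, place, rename_rename]
  convert rename_id_apply f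
  ext v; rcases v with t | j <;> rfl

theorem partialD_slotMap {φ : Fin 3 → Fin 3} (hφ : Function.Injective φ) (s : Fin 3) (i : Fin 2)
    (G : ThreePoint τ) : partialD (φ s) i (slotMap φ G) = slotMap φ (partialD s i G) :=
  pderiv_rename (f := Sum.map id (Prod.map φ id)) (x := Sum.inr (s, i))
    (Sum.map_injective.2 ⟨Function.injective_id, hφ.prodMap Function.injective_id⟩) G

theorem slotCayley_slotMap {φ : Fin 3 → Fin 3} (hφ : Function.Injective φ) (s t : Fin 3)
    (G : ThreePoint τ) : slotCayley (φ s) (φ t) (slotMap φ G) = slotMap φ (slotCayley s t G) := by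
  simp only [slotCayley_apply, partialD_slotMap hφ, map_sub]

theorem slotCayley_pow_slotMap {φ : Fin 3 → Fin 3} (hφ : Function.Injective φ) (s t : Fin 3)
    (r : ℕ) (G : ThreePoint τ) :
    (slotCayley (φ s) (φ t) ^ r) (slotMap φ G) = slotMap φ ((slotCayley s t ^ r) G) := by
  induction r generalizing G with
  | zero => rfl
  | succ r ih => rw [pow_succ, Module.End.mul_apply, slotCayley_slotMap hφ, ih]; rfl

theorem slotMap_place (φ : Fin 3 → Fin 3) (s : Fin 3) (f : MvPolynomial (τ ⊕ Fin 2) ℂ) :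
    slotMap φ (place s f) = place (φ s) f := by
  rw [slotMap, place, rename_rename, place]
  have : (Sum.map id (Prod.map φ id) ∘ Sum.map id fun i => (s, i) : τ ⊕ Fin 2 → _) =
      Sum.map id fun i => (φ s, i) := by
    funext v; rcases v with t | j <;> rfl
  rw [this]

theorem diagonal_slotMap (φ : Fin 3 → Fin 3) (G : ThreePoint τ) :
    diagonal (slotMap φ G) = diagonal G := by
  rw [slotMap, diagonal, rename_rename]
  have : (Sum.map id Prod.snd ∘ Sum.map id (Prod.map φ id) : τ ⊕ (Fin 3 × Fin 2) → _) =
      Sum.map id Prod.snd := by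
    funext v; rcases v with t | j <;> rfl
  rw [this]

/-- Merging the slots `0` and `1`. -/
theorem partialD_zero_merge (i : Fin 2) (G : ThreePoint τ) :
    partialD 0 i (slotMap ![0, 0, 1] G) = slotMap ![0, 0, 1] (partialD 0 i G + partialD 1 i G) := by
  classical
  refine derivation_comp_algHom (slotMap ![0, 0, 1])
    (pderiv (Sum.inr (0, i)) + pderiv (Sum.inr (1, i))) (pderiv (Sum.inr (0, i))) ?_ G
  rintro (t | ⟨s, j⟩)
  · simp [slotMap, pderiv_X]
  · fin_cases s <;> by_cases h : j = i <;> simp [slotMap, pderiv_X, h]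

theorem partialD_one_merge (i : Fin 2) (G : ThreePoint τ) :
    partialD 1 i (slotMap ![0, 0, 1] G) = slotMap ![0, 0, 1] (partialD 2 i G) := by
  classical
  refine derivation_comp_algHom (slotMap ![0, 0, 1])
    (pderiv (Sum.inr (2, i))) (pderiv (Sum.inr (1, i))) ?_ G
  rintro (t | ⟨s, j⟩)
  · simp [slotMap, pderiv_X]
  · fin_cases s <;> by_cases h : j = i <;> simp [slotMap, pderiv_X, h]

/-- Leibniz rule: a derivative in the merged point is the sum of the derivatives in the two original
points. -/
theorem slotCayley_merge (G : ThreePoint τ) :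
    slotCayley 0 1 (slotMap ![0, 0, 1] G) =
      slotMap ![0, 0, 1] ((slotCayley 0 2 + slotCayley 1 2 : Module.End ℂ (ThreePoint τ)) G) := by
  rw [LinearMap.add_apply]
  simp only [slotCayley_apply, partialD_zero_merge, partialD_one_merge, map_sub, map_add]
  ring

theorem slotCayley_pow_merge (r : ℕ) (G : ThreePoint τ) :
    (slotCayley 0 1 ^ r) (slotMap ![0, 0, 1] G) =
      slotMap ![0, 0, 1] (((slotCayley 0 2 + slotCayley 1 2 : Module.End ℂ (ThreePoint τ)) ^ r) G) := by
  induction r generalizing G with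
  | zero => rfl
  | succ r ih => rw [pow_succ, Module.End.mul_apply, slotCayley_merge, ih, pow_succ]; rfl

theorem slotEuler_place_self (s : Fin 3) (f : MvPolynomial (τ ⊕ Fin 2) ℂ) :
    slotEuler s (place s f) = place s (orderDer f) := by
  refine derivation_comp_algHom (place s) orderDer (slotEuler s) ?_ f
  rintro (t | j) <;> simp [place, slotEuler, orderDer]

theorem slotEuler_place_of_ne {s t : Fin 3} (h : s ≠ t) (f : MvPolynomial (τ ⊕ Fin 2) ℂ) :
    slotEuler t (place s f) = 0 := by
  have := derivation_comp_algHom (place (τ := τ) s) 0 (slotEuler t) ?_ f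
  · simpa using this
  rintro (t | j) <;> simp [place, slotEuler, h]

theorem slotEuler_partialD (s t : Fin 3) (i : Fin 2) (p : ThreePoint τ) :
    slotEuler s (partialD t i p) =
      partialD t i (slotEuler s p) - (if t = s then 1 else 0 : ℂ) • partialD t i p := by
  classical
  have := derivation_commutator (slotEuler s) (pderiv (Sum.inr (t, i)))
    (-(if t = s then 1 else 0 : ℂ) • pderiv (Sum.inr (t, i))) ?_ p
  · rw [sub_eq_iff_eq_add] at this
    rw [partialD_apply, partialD_apply, this, Derivation.smul_apply]
    module
  rintro (u | ⟨u, j⟩)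
  · simp [slotEuler, pderiv_X]
  · simp only [slotEuler, diagDer_X, Sum.elim_inr, Derivation.map_smul, pderiv_X,
      Derivation.smul_apply]
    by_cases h : (Sum.inr (u, j) : τ ⊕ (Fin 3 × Fin 2)) = Sum.inr (t, i)
    · obtain ⟨rfl, rfl⟩ := Prod.ext_iff.1 (Sum.inr_injective h)
      by_cases hu : u = s <;> simp [hu]
    · simp [Ne.symm h]

theorem slotEuler_slotCayley (s t u : Fin 3) (p : ThreePoint τ) :
    slotEuler s (slotCayley t u p) = slotCayley t u (slotEuler s p) -
      ((if t = s then 1 else 0 : ℂ) + (if u = s then 1 else 0)) • slotCayley t u p := by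
  simp only [slotCayley_apply, map_sub, slotEuler_partialD, map_smul]
  module

theorem slotEuler_slotCayley_pow {s t u : Fin 3} {p : ThreePoint τ} {c : ℂ}
    (h : slotEuler s p = c • p) (r : ℕ) :
    slotEuler s ((slotCayley t u ^ r) p) =
      (c - r * ((if t = s then 1 else 0 : ℂ) + (if u = s then 1 else 0))) •
        (slotCayley t u ^ r) p := by
  induction r with
  | zero => simp [h]
  | succ r ih =>
    rw [pow_succ', Module.End.mul_apply, slotEuler_slotCayley, ih, map_smul]
    push_cast
    module

theorem slotEuler_eq (s : Fin 3) (p : ThreePoint τ) :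
    slotEuler s p = X (Sum.inr (s, 0)) * partialD s 0 p + X (Sum.inr (s, 1)) * partialD s 1 p := by
  classical
  have : slotEuler (τ := τ) s = (X (Sum.inr (s, 0)) : ThreePoint τ) • pderiv (Sum.inr (s, 0)) +
      (X (Sum.inr (s, 1)) : ThreePoint τ) • pderiv (Sum.inr (s, 1)) := by
    refine derivation_ext ?_
    rintro (u | ⟨u, j⟩)
    · simp [slotEuler, pderiv_X]
    · by_cases h : u = s
      · subst h
        fin_cases j <;> simp [slotEuler, pderiv_X]
      · simp [slotEuler, pderiv_X, h]
  rw [this]; rfl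

theorem diagonal_X (s : Fin 3) (i : Fin 2) :
    diagonal (X (Sum.inr (s, i)) : ThreePoint τ) = X (Sum.inr i) := by
  simp [diagonal]

theorem diagonal_euler {s : Fin 3} {p : ThreePoint τ} {c : ℂ} (h : slotEuler s p = c • p) :
    X (Sum.inr 0) * diagonal (partialD s 0 p) + X (Sum.inr 1) * diagonal (partialD s 1 p) =
      c • diagonal p := by
  rw [← map_smul, ← h, slotEuler_eq, map_add, map_mul, map_mul, diagonal_X, diagonal_X]

/-- The three-term relation between the Cayley operators of three forms. -/
theorem diagonal_slotCayley_relation {G : ThreePoint τ} {m n p : ℂ}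
    (h0 : slotEuler 0 G = m • G) (h1 : slotEuler 1 G = n • G) (h2 : slotEuler 2 G = p • G) :
    n • diagonal (slotCayley 0 2 G) - m • diagonal (slotCayley 1 2 G) =
      p • diagonal (slotCayley 0 1 G) := by
  -- A Plücker-type identity for the three gradient vectors. Contracting it with `x` on the
  -- diagonal, Euler's relation replaces each outer derivative by the order in that slot.
  have key : ∀ i, partialD 1 i (slotCayley 0 2 G) - partialD 0 i (slotCayley 1 2 G) =
      partialD 2 i (slotCayley 0 1 G) := by
    intro i
    simp only [slotCayley_apply, partialD_apply, map_sub]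
    have c10 : ∀ (i j : Fin 2) (p : ThreePoint τ), pderiv (Sum.inr (1, i))
        (pderiv (Sum.inr (0, j)) p) = pderiv (Sum.inr (0, j)) (pderiv (Sum.inr (1, i)) p) :=
      fun i j p => pderiv_comm _ _ p
    have c20 : ∀ (i j : Fin 2) (p : ThreePoint τ), pderiv (Sum.inr (2, i))
        (pderiv (Sum.inr (0, j)) p) = pderiv (Sum.inr (0, j)) (pderiv (Sum.inr (2, i)) p) :=
      fun i j p => pderiv_comm _ _ p
    have c21 : ∀ (i j : Fin 2) (p : ThreePoint τ), pderiv (Sum.inr (2, i))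
        (pderiv (Sum.inr (1, j)) p) = pderiv (Sum.inr (1, j)) (pderiv (Sum.inr (2, i)) p) :=
      fun i j p => pderiv_comm _ _ p
    fin_cases i <;> simp only [Fin.zero_eta, Fin.mk_one, c10, c20, c21] <;> ring
  have e1 : slotEuler 1 (slotCayley 0 2 G) = n • slotCayley 0 2 G := by
    rw [slotEuler_slotCayley, h1]; simp
  have e0 : slotEuler 0 (slotCayley 1 2 G) = m • slotCayley 1 2 G := by
    rw [slotEuler_slotCayley, h0]; simp
  have e2 : slotEuler 2 (slotCayley 0 1 G) = p • slotCayley 0 1 G := by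
    rw [slotEuler_slotCayley, h2]; simp
  rw [← diagonal_euler e1, ← diagonal_euler e0, ← diagonal_euler e2, ← key, ← key, map_sub, map_sub]
  ring

/-- The eigenvalues of a slot Euler operator count factors from that slot, so they are natural
numbers. This is how excessive differentiation is seen to give zero. -/
theorem slotEuler_eq_zero_of_neg {s : Fin 3} {p : ThreePoint τ} {k : ℤ} (hk : k < 0)
    (h : slotEuler s p = (k : ℂ) • p) : p = 0 := by
  ext t
  by_contra hne
  have := weight_eq_of_diagDer_eq h hne
  have h2 : ∃ l : ℕ, Finsupp.weight (M := ℂ) (Sum.elim (0 : τ → ℂ)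
      fun a : Fin 3 × Fin 2 => if a.1 = s then 1 else 0) t = l := by
    refine ⟨Finsupp.weight (Sum.elim (0 : τ → ℕ)
      fun a : Fin 3 × Fin 2 => if a.1 = s then 1 else 0) t, ?_⟩
    have := weight_map (Nat.castAddMonoidHom ℂ) (Sum.elim (0 : τ → ℕ)
      fun a : Fin 3 × Fin 2 => if a.1 = s then 1 else 0) t
    simp only [Nat.coe_castAddMonoidHom] at this
    rw [← this]
    congr 2
    ext v; rcases v with v | v <;> simp
  obtain ⟨l, hl⟩ := h2
  rw [this] at hl
  have : k = l := by exact_mod_cast hl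
  omega

end SlotOperators

/-! ### Molecular covariants of three forms and Gordan's lemma -/

section Molecules

variable {τ : Type*}

theorem rawTransvectant_zero (f g : MvPolynomial (τ ⊕ Fin 2) ℂ) :
    rawTransvectant 0 f g = f * g := by
  rw [rawTransvectant, pow_zero, Module.End.one_apply, map_mul, diagonal_place, diagonal_place]

theorem rawTransvectant_add_left (r : ℕ) (f f' g : MvPolynomial (τ ⊕ Fin 2) ℂ) :
    rawTransvectant r (f + f') g = rawTransvectant r f g + rawTransvectant r f' g := by
  simp only [rawTransvectant, map_add, add_mul]

theorem rawTransvectant_smul_left (r : ℕ) (c : ℂ) (f g : MvPolynomial (τ ⊕ Fin 2) ℂ) :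
    rawTransvectant r (c • f) g = c • rawTransvectant r f g := by
  simp only [rawTransvectant, map_smul, smul_mul_assoc]

theorem rawTransvectant_zero_left (r : ℕ) (g : MvPolynomial (τ ⊕ Fin 2) ℂ) :
    rawTransvectant r 0 g = 0 := by
  simp only [rawTransvectant, map_zero, zero_mul]

theorem slotCayley_swap (s t : Fin 3) (G : ThreePoint τ) : slotCayley s t G = -slotCayley t s G := by
  simp only [slotCayley_apply, partialD_apply]
  rw [pderiv_comm (Sum.inr (s, 0)), pderiv_comm (Sum.inr (s, 1))]
  ring

theorem rawTransvectant_swap (r : ℕ) (f g : MvPolynomial (τ ⊕ Fin 2) ℂ) :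
    rawTransvectant r f g = (-1 : ℂ) ^ r • rawTransvectant r g f := by
  have hinj : Function.Injective (![1, 0, 2] : Fin 3 → Fin 3) := by decide
  have h : ∀ G : ThreePoint τ, (slotCayley 0 1 ^ r) (slotMap ![1, 0, 2] G) =
      (-1 : ℂ) ^ r • slotMap ![1, 0, 2] ((slotCayley 0 1 ^ r) G) := by
    intro G
    have h1 : ∀ G : ThreePoint τ, slotCayley 0 1 (slotMap ![1, 0, 2] G) =
        (-1 : ℂ) • slotMap ![1, 0, 2] (slotCayley 0 1 G) := fun G => by
      rw [← slotCayley_slotMap hinj, slotCayley_swap, neg_one_smul]; rfl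
    induction r generalizing G with
    | zero => simp
    | succ r ih =>
      rw [pow_succ, Module.End.mul_apply, h1, map_smul, ih, smul_smul, ← pow_succ']; rfl
  have h2 : place (τ := τ) 0 f * place 1 g = slotMap ![1, 0, 2] (place 0 g * place 1 f) := by
    rw [map_mul, slotMap_place, slotMap_place, mul_comm]; rfl
  rw [rawTransvectant, h2, h, map_smul, diagonal_slotMap, rawTransvectant]

/-- The product of three forms in three different points. -/
def triple (f u v : MvPolynomial (τ ⊕ Fin 2) ℂ) : ThreePoint τ := place 0 f * place 1 u * place 2 v

/-- The operator with `c`, `i`, `j` bonds between the three pairs of slots. -/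
def bonds (τ : Type*) (c i j : ℕ) : Module.End ℂ (ThreePoint τ) :=
  slotCayley 0 1 ^ c * slotCayley 0 2 ^ i * slotCayley 1 2 ^ j

/-- The molecular covariant with `c`, `i`, `j` bonds between the three pairs of forms. -/
def molecule (f u v : MvPolynomial (τ ⊕ Fin 2) ℂ) (c i j : ℕ) : MvPolynomial (τ ⊕ Fin 2) ℂ :=
  diagonal (bonds τ c i j (triple f u v))

/-- The linear combinations of products of forms in the slots `0` and `1`. -/
def twoSlot (τ : Type*) : Submodule ℂ (ThreePoint τ) :=
  Submodule.span ℂ {H | ∃ f g, H = place 0 f * place 1 g}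

theorem slotCayley_mem_twoSlot {H : ThreePoint τ} (h : H ∈ twoSlot τ) :
    slotCayley 0 1 H ∈ twoSlot τ := by
  induction h using Submodule.span_induction with
  | mem x hx =>
    obtain ⟨f, g, rfl⟩ := hx
    rw [slotCayley_place_mul_place]
    exact Submodule.sub_mem _ (Submodule.subset_span ⟨_, _, rfl⟩) (Submodule.subset_span ⟨_, _, rfl⟩)
  | zero => simp
  | add x y _ _ hx hy => rw [map_add]; exact Submodule.add_mem _ hx hy
  | smul c x _ hx => rw [map_smul]; exact Submodule.smul_mem _ _ hx

theorem slotCayley_pow_mem_twoSlot (f g : MvPolynomial (τ ⊕ Fin 2) ℂ) (c : ℕ) :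
    (slotCayley 0 1 ^ c) (place 0 f * place 1 g) ∈ twoSlot τ := by
  induction c with
  | zero => exact Submodule.subset_span ⟨_, _, rfl⟩
  | succ c ih => rw [pow_succ', Module.End.mul_apply]; exact slotCayley_mem_twoSlot ih

/-- Nothing depends on slot `2`, so merging the other two slots only leaves slot `0`. This allows a
transvectant to be placed as an argument of another one. -/
theorem merge_of_mem_twoSlot {H : ThreePoint τ} (h : H ∈ twoSlot τ) :
    slotMap ![0, 0, 1] H = place 0 (diagonal H) := by
  induction h using Submodule.span_induction with
  | mem x hx =>
    obtain ⟨f, g, rfl⟩ := hx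
    simp only [map_mul, slotMap_place, diagonal_place]; rfl
  | zero => simp
  | add x y _ _ hx hy => rw [map_add, hx, hy, map_add, map_add]
  | smul c x _ hx => rw [map_smul, hx, map_smul, map_smul]

theorem slotCayley_pow_triple (f u v : MvPolynomial (τ ⊕ Fin 2) ℂ) (c : ℕ) :
    (slotCayley 0 1 ^ c) (triple f u v) = place 2 v * (slotCayley 0 1 ^ c) (place 0 f * place 1 u) := by
  rw [triple, mul_comm, slotCayley_pow_mul_of_const]
  · exact fun i => partialD_place_of_ne (by decide) i v
  · exact fun i => partialD_place_of_ne (by decide) i v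

/-- With `(f, u)_c` in the merged slot, the outer operator becomes `(Ω₀₂ + Ω₁₂)^q` on the triple
product. The operators commute, so the binomial theorem applies. -/
theorem rawTransvectant_rawTransvectant (f u v : MvPolynomial (τ ⊕ Fin 2) ℂ) (c q : ℕ) :
    rawTransvectant q (rawTransvectant c f u) v =
      ∑ i ∈ Finset.range (q + 1), (q.choose i : ℂ) • molecule f u v c i (q - i) := by
  have h1 : place (τ := τ) 0 (rawTransvectant c f u) * place 1 v =
      slotMap ![0, 0, 1] ((slotCayley 0 1 ^ c) (triple f u v)) := by
    rw [slotCayley_pow_triple, map_mul, merge_of_mem_twoSlot (slotCayley_pow_mem_twoSlot f u c),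
      slotMap_place, mul_comm]
    rfl
  rw [rawTransvectant, h1, slotCayley_pow_merge, diagonal_slotMap,
    (slotCayley_commute 0 2 1 2).add_pow, LinearMap.sum_apply, map_sum]
  refine Finset.sum_congr rfl fun i _ => ?_
  rw [molecule, ← map_smul, ← LinearMap.smul_apply, ← Module.End.mul_apply]
  congr 2
  rw [bonds]
  have h2 : Commute (slotCayley (τ := τ) 0 2 ^ i * slotCayley 1 2 ^ (q - i)) (slotCayley 0 1 ^ c) :=
    Commute.mul_left ((slotCayley_commute _ _ _ _).pow_pow _ _)
      ((slotCayley_commute _ _ _ _).pow_pow _ _)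
  rw [mul_assoc (slotCayley 0 1 ^ c), ← h2.eq, ← nsmul_eq_mul', smul_mul_assoc, Nat.cast_smul_eq_nsmul]

theorem mul_rawTransvectant (f u v : MvPolynomial (τ ⊕ Fin 2) ℂ) (r : ℕ) :
    f * rawTransvectant r u v = molecule f u v 0 0 r := by
  have hinj : Function.Injective (![1, 2, 0] : Fin 3 → Fin 3) := by decide
  have h1 : place (τ := τ) 1 u * place 2 v = slotMap ![1, 2, 0] (place 0 u * place 1 v) := by
    rw [map_mul, slotMap_place, slotMap_place]; rfl
  have h2 := slotCayley_pow_slotMap (τ := τ) hinj 0 1 r (place 0 u * place 1 v)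
  rw [molecule, bonds, pow_zero, pow_zero, one_mul, one_mul, triple, mul_assoc, slotCayley_pow_mul_of_const,
    h1, map_mul, diagonal_place, rawTransvectant]
  · rw [← diagonal_slotMap ![1, 2, 0], ← h2]; rfl
  · exact fun i => partialD_place_of_ne (by decide) i f
  · exact fun i => partialD_place_of_ne (by decide) i f

variable {f u v : MvPolynomial (τ ⊕ Fin 2) ℂ} {m n p : ℕ}
  (hf : orderDer f = (m : ℂ) • f) (hu : orderDer u = (n : ℂ) • u) (hv : orderDer v = (p : ℂ) • v)

include hf hu hv

theorem slotEuler_molecule (c i j : ℕ) :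
    let G := bonds τ c i j (triple f u v)
    slotEuler 0 G = ((m : ℂ) - c - i) • G ∧ slotEuler 1 G = ((n : ℂ) - c - j) • G ∧
      slotEuler 2 G = ((p : ℂ) - i - j) • G := by
  intro G
  have e0 : slotEuler 0 (triple f u v) = (m : ℂ) • triple f u v := by
    simp [triple, Derivation.leibniz, slotEuler_place_self, slotEuler_place_of_ne, hf]
    ring_nf
  have e1 : slotEuler 1 (triple f u v) = (n : ℂ) • triple f u v := by
    simp [triple, Derivation.leibniz, slotEuler_place_self, slotEuler_place_of_ne, hu]
    try ring_nf
  have e2 : slotEuler 2 (triple f u v) = (p : ℂ) • triple f u v := by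
    simp [triple, Derivation.leibniz, slotEuler_place_self, slotEuler_place_of_ne, hv]
    try ring_nf
  refine ⟨?_, ?_, ?_⟩
  · have := slotEuler_slotCayley_pow (t := 0) (u := 1) (slotEuler_slotCayley_pow (t := 0) (u := 2)
      (slotEuler_slotCayley_pow (t := 1) (u := 2) e0 j) i) c
    refine this.trans ?_
    change _ • G = _
    congr 1
    simp
    ring
  · have := slotEuler_slotCayley_pow (t := 0) (u := 1) (slotEuler_slotCayley_pow (t := 0) (u := 2)
      (slotEuler_slotCayley_pow (t := 1) (u := 2) e1 j) i) c
    refine this.trans ?_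
    change _ • G = _
    congr 1
    simp
    ring
  · have := slotEuler_slotCayley_pow (t := 0) (u := 1) (slotEuler_slotCayley_pow (t := 0) (u := 2)
      (slotEuler_slotCayley_pow (t := 1) (u := 2) e2 j) i) c
    refine this.trans ?_
    change _ • G = _
    congr 1
    simp
    ring

theorem molecule_relation (c i j : ℕ) :
    ((n : ℂ) - c - j) • molecule f u v c (i + 1) j - ((m : ℂ) - c - i) • molecule f u v c i (j + 1) =
      ((p : ℂ) - i - j) • molecule f u v (c + 1) i j := by
  obtain ⟨h0, h1, h2⟩ := slotEuler_molecule hf hu hv c i j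
  have := diagonal_slotCayley_relation h0 h1 h2
  have e1 : slotCayley 0 2 * bonds τ c i j = bonds τ c (i + 1) j := by
    rw [bonds, bonds, pow_succ' _ i, ← mul_assoc, ← mul_assoc, ← mul_assoc,
      ((slotCayley_commute 0 2 0 1).pow_right c).eq]
  have e2 : slotCayley 1 2 * bonds τ c i j = bonds τ c i (j + 1) := by
    rw [bonds, bonds, pow_succ' _ j, ← mul_assoc (slotCayley 1 2), ← mul_assoc _ (slotCayley 1 2),
      (((slotCayley_commute 1 2 0 1).pow_right c).mul_right
        ((slotCayley_commute 1 2 0 2).pow_right i)).eq]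
  have e3 : slotCayley 0 1 * bonds τ c i j = bonds τ (c + 1) i j := by
    rw [bonds, bonds, pow_succ' _ c]
    simp only [mul_assoc]
  simpa only [molecule, ← Module.End.mul_apply, e1, e2, e3] using this

theorem molecule_eq_zero (c i j : ℕ) (h : m < c + i) : molecule f u v c i j = 0 := by
  obtain ⟨h0, -, -⟩ := slotEuler_molecule hf hu hv c i j
  have h3 : ((m : ℂ) - c - i) = (((m : ℤ) - c - i : ℤ) : ℂ) := by push_cast; ring
  rw [h3] at h0
  rw [molecule, slotEuler_eq_zero_of_neg (by omega) h0, map_zero]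

variable {K : Submodule ℂ (MvPolynomial (τ ⊕ Fin 2) ℂ)} {r : ℕ}

/-- Modulo molecules with more bonds between `f` and `u`, all molecules are nonnegative multiples
of one of them. -/
theorem exists_molecule_sub_mem (hr : r ≤ n) (c : ℕ)
    (hK : ∀ i j, c + 1 + i + j = r → molecule f u v (c + 1) i j ∈ K) (i j : ℕ)
    (hij : c + i + j = r) :
    ∃ l : ℝ, 0 ≤ l ∧ molecule f u v c i j - (l : ℂ) • molecule f u v c 0 (r - c) ∈ K := by
  induction i generalizing j with
  | zero =>
    refine ⟨1, zero_le_one, ?_⟩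
    have : j = r - c := by omega
    rw [this]
    simp
  | succ i ih =>
    -- Too many derivatives fall on `f`, so the molecule is zero and the multiple `0` will do.
    by_cases hm : m < c + (i + 1)
    · exact ⟨0, le_rfl, by rw [molecule_eq_zero hf hu hv c (i + 1) j hm]; simp⟩
    obtain ⟨l, hl, hmem⟩ := ih (j + 1) (by omega)
    have h1 := molecule_relation hf hu hv c i j
    -- From `c + (i + 1) + j = r ≤ n`. This is where the index must not exceed the order of `u`: the
    -- three-term relation is divided by this number, and its sign makes the multiple nonnegative.
    have hpos : 0 < (n : ℝ) - c - j := by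
      have : ((c + j + 1 : ℕ) : ℝ) ≤ n := by exact_mod_cast (by omega : c + j + 1 ≤ n)
      push_cast at this
      linarith
    have hnn : 0 ≤ (m : ℝ) - c - i := by
      have : ((c + i : ℕ) : ℝ) ≤ m := by exact_mod_cast (by omega : c + i ≤ m)
      push_cast at this
      linarith
    have hne : ((n : ℂ) - c - j) ≠ 0 := by
      have : (((n : ℝ) - c - j : ℝ) : ℂ) ≠ 0 := by exact_mod_cast hpos.ne'
      simpa using this
    refine ⟨((m : ℝ) - c - i) / ((n : ℝ) - c - j) * l, by positivity, ?_⟩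
    have h2 : molecule f u v c (i + 1) j -
        ((((m : ℝ) - c - i) / ((n : ℝ) - c - j) * l : ℝ) : ℂ) • molecule f u v c 0 (r - c) =
        (((m : ℂ) - c - i) / ((n : ℂ) - c - j)) •
          (molecule f u v c i (j + 1) - (l : ℂ) • molecule f u v c 0 (r - c)) +
        (((p : ℂ) - i - j) / ((n : ℂ) - c - j)) • molecule f u v (c + 1) i j := by
      have h3 : molecule f u v c (i + 1) j = ((n : ℂ) - c - j)⁻¹ •
          (((m : ℂ) - c - i) • molecule f u v c i (j + 1) +
            ((p : ℂ) - i - j) • molecule f u v (c + 1) i j) := by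
        rw [← h1, add_sub_cancel, smul_smul, inv_mul_cancel₀ hne, one_smul]
      rw [h3]
      push_cast
      simp only [div_eq_mul_inv]
      module
    rw [h2]
    exact K.add_mem (K.smul_mem _ hmem) (K.smul_mem _ (hK i j (by omega)))

theorem molecule_mem_of_base (hr : r ≤ n) (c : ℕ)
    (hK : ∀ i j, c + 1 + i + j = r → molecule f u v (c + 1) i j ∈ K)
    (h0 : molecule f u v c 0 (r - c) ∈ K) (i j : ℕ) (hij : c + i + j = r) :
    molecule f u v c i j ∈ K := by
  obtain ⟨l, -, h⟩ := exists_molecule_sub_mem hf hu hv hr c hK i j hij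
  simpa using K.add_mem h (K.smul_mem (l : ℂ) h0)

/-- Modulo `K`, the iterated transvectant is `S` times the base molecule. The term `i = 0`
contributes `1` to `S` and the others are nonnegative, so `S` is invertible. The nonnegativity of
the multiples was recorded for this purpose. -/
theorem molecule_base_mem (hr : r ≤ n) (c : ℕ) (hc : c ≤ r)
    (hK : ∀ i j, c + 1 + i + j = r → molecule f u v (c + 1) i j ∈ K)
    (hT : rawTransvectant (r - c) (rawTransvectant c f u) v ∈ K) :
    molecule f u v c 0 (r - c) ∈ K := by
  have hex : ∀ i, ∃ l : ℝ, 0 ≤ l ∧ (i + c < r → molecule f u v c (i + 1) (r - c - (i + 1)) -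
      (l : ℂ) • molecule f u v c 0 (r - c) ∈ K) := by
    intro i
    by_cases hi : i + c < r
    · obtain ⟨l, hl, h⟩ := exists_molecule_sub_mem hf hu hv hr c hK (i + 1) (r - c - (i + 1))
        (by omega)
      exact ⟨l, hl, fun _ => h⟩
    · exact ⟨0, le_rfl, fun h => absurd h hi⟩
  choose l hl hmem using hex
  set q := r - c with hq
  rw [rawTransvectant_rawTransvectant, Finset.sum_range_succ'] at hT
  have h1 : ∑ i ∈ Finset.range q, ((q.choose (i + 1) : ℕ) : ℂ) •
      (molecule f u v c (i + 1) (q - (i + 1)) - (l i : ℂ) • molecule f u v c 0 q) ∈ K :=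
    K.sum_mem fun i hi => K.smul_mem _ (hmem i (by have := Finset.mem_range.1 hi; omega))
  have h2 := K.sub_mem hT h1
  set S : ℝ := 1 + ∑ i ∈ Finset.range q, ((q.choose (i + 1) : ℕ) : ℝ) * l i with hS
  have hSpos : 0 < S := by
    have : 0 ≤ ∑ i ∈ Finset.range q, ((q.choose (i + 1) : ℕ) : ℝ) * l i :=
      Finset.sum_nonneg fun i _ => mul_nonneg (Nat.cast_nonneg _) (hl i)
    linarith
  have h3 : (S : ℂ) • molecule f u v c 0 q ∈ K := by
    convert h2 using 1
    rw [hS]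
    push_cast
    simp only [smul_sub, Finset.sum_sub_distrib, smul_smul, ← Finset.sum_smul, Nat.choose_zero_right,
      Nat.cast_one, Nat.sub_zero]
    module
  have hSne : (S : ℂ) ≠ 0 := by exact_mod_cast hSpos.ne'
  have := K.smul_mem (S : ℂ)⁻¹ h3
  rwa [smul_smul, inv_mul_cancel₀ hSne, one_smul] at this

/-- Gordan's lemma: the transvectant of a product `f u` with `v` is congruent to a multiple of
`f (u, v)_r` modulo transvectants of smaller index. -/
theorem rawTransvectant_mul_mem (hr : r ≤ n) (h0 : f * rawTransvectant r u v ∈ K)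
    (hK : ∀ c, 1 ≤ c → c ≤ r → rawTransvectant (r - c) (rawTransvectant c f u) v ∈ K) :
    rawTransvectant r (f * u) v ∈ K := by
  -- Descending induction on the number `c ≥ 1` of bonds between `f` and `u`, starting from `c = r +
  -- 1`, where there are no molecules.
  have main : ∀ e c, c + e = r + 1 → 1 ≤ c → ∀ i j, c + i + j = r → molecule f u v c i j ∈ K := by
    intro e
    induction e with
    | zero => intro c hc _ i j hij; omega
    | succ e ih =>
      intro c hc h1 i j hij
      have hK' := ih (c + 1) (by omega) (by omega)
      exact molecule_mem_of_base hf hu hv hr c hK'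
        (molecule_base_mem hf hu hv hr c (by omega) hK' (hK c h1 (by omega))) i j hij
  have h1 := main r 1 (by omega) le_rfl
  -- Without bonds between `f` and `u`, the base molecule is `f (u, v)_r` itself, which is in `K` by
  -- hypothesis.
  have h2 := molecule_mem_of_base hf hu hv hr 0 (by simpa using h1)
    (by rw [Nat.sub_zero, ← mul_rawTransvectant]; exact h0)
  rw [← rawTransvectant_zero f u, rawTransvectant_rawTransvectant]
  refine K.sum_mem fun i hi => K.smul_mem _ (h2 _ _ ?_)
  have := Finset.mem_range.1 hi
  omega

end Molecules

/-! ### Leibniz rule and covariance of transvectants -/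

section Leibniz

variable {τ τ' : Type*}

theorem place_pointDer (e : τ → MvPolynomial τ ℂ) (N : Matrix (Fin 2) (Fin 2) ℂ) (s : Fin 3)
    (p : MvPolynomial (τ ⊕ Fin 2) ℂ) : slotDer e N (place s p) = place s (pointDer e N p) := by
  refine derivation_comp_algHom _ _ _ ?_ p
  rintro (t | j)
  · simp only [place, rename_X, Sum.map_inl, id, slotDer_inl, pointDer_inl, rename_rename]
    congr 1
  · simp [place]

theorem diagonal_slotDer (e : τ → MvPolynomial τ ℂ) (N : Matrix (Fin 2) (Fin 2) ℂ)
    (p : ThreePoint τ) : pointDer e N (diagonal p) = diagonal (slotDer e N p) := by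
  refine derivation_comp_algHom _ _ _ ?_ p
  rintro (t | j)
  · simp only [diagonal, rename_X, Sum.map_inl, id, slotDer_inl, pointDer_inl, rename_rename]
    congr 1
  · simp [diagonal]

theorem pderiv_inr_rename_inl {κ : Type*} (a : κ) (q : MvPolynomial τ ℂ) :
    pderiv (Sum.inr a) (rename Sum.inl q : MvPolynomial (τ ⊕ κ) ℂ) = 0 := by
  have := derivation_comp_algHom (rename Sum.inl : MvPolynomial τ ℂ →ₐ[ℂ] MvPolynomial (τ ⊕ κ) ℂ) 0
    (pderiv (Sum.inr a)) (fun v => by classical simp [pderiv_X]) q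
  simpa using this

theorem partialD_slotDer (e : τ → MvPolynomial τ ℂ) (N : Matrix (Fin 2) (Fin 2) ℂ) (s : Fin 3)
    (i : Fin 2) (p : ThreePoint τ) :
    partialD s i (slotDer e N p) = slotDer e N (partialD s i p) +
      (N 0 i • partialD s 0 p + N 1 i • partialD s 1 p) := by
  classical
  have := derivation_commutator (pderiv (Sum.inr (s, i))) (slotDer e N)
    (N 0 i • pderiv (Sum.inr (s, 0)) + N 1 i • pderiv (Sum.inr (s, 1))) ?_ p
  · rw [sub_eq_iff_eq_add'] at this
    exact this
  rintro (t | ⟨u, j⟩)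
  · simp only [slotDer_inl, pderiv_inr_rename_inl, Derivation.add_apply, Derivation.smul_apply]
    simp [pderiv_X]
  · simp only [slotDer_inr, pderiv_X, Derivation.add_apply,
      Derivation.smul_apply, Fin.sum_univ_two]
    by_cases h : s = u
    · subst h
      fin_cases i <;> fin_cases j <;> simp
    · simp [Ne.symm h]

/-- `Ω` is a determinant in the derivatives, so a matrix acts on it through its trace. -/
theorem slotCayley_slotDer (e : τ → MvPolynomial τ ℂ) {N : Matrix (Fin 2) (Fin 2) ℂ}
    (hN : N 0 0 + N 1 1 = 0) (s t : Fin 3) (p : ThreePoint τ) :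
    slotCayley s t (slotDer e N p) = slotDer e N (slotCayley s t p) := by
  simp only [slotCayley_apply, partialD_slotDer, map_add, map_sub, map_smul]
  rw [eq_neg_of_add_eq_zero_left hN]
  module

theorem slotCayley_pow_slotDer (e : τ → MvPolynomial τ ℂ) {N : Matrix (Fin 2) (Fin 2) ℂ}
    (hN : N 0 0 + N 1 1 = 0) (s t : Fin 3) (r : ℕ) (p : ThreePoint τ) :
    (slotCayley s t ^ r) (slotDer e N p) = slotDer e N ((slotCayley s t ^ r) p) := by
  induction r with
  | zero => rfl
  | succ r ih => rw [pow_succ', Module.End.mul_apply, ih, slotCayley_slotDer e hN]; rfl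

/-- The infinitesimal covariance of transvectants. The nilpotent matrices give the two equations of
covariance, and `N = 0` with the Euler operator on parameters gives the degree. -/
theorem pointDer_rawTransvectant (e : τ → MvPolynomial τ ℂ) {N : Matrix (Fin 2) (Fin 2) ℂ}
    (hN : N 0 0 + N 1 1 = 0) (r : ℕ) (f g : MvPolynomial (τ ⊕ Fin 2) ℂ) :
    pointDer e N (rawTransvectant r f g) =
      rawTransvectant r (pointDer e N f) g + rawTransvectant r f (pointDer e N g) := by
  simp only [rawTransvectant, diagonal_slotDer, ← slotCayley_pow_slotDer e hN, Derivation.leibniz,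
    place_pointDer, smul_eq_mul, map_add]
  rw [add_comm, mul_comm (place 1 g)]

theorem orderDer_diagonal (p : ThreePoint τ) :
    orderDer (diagonal p) = diagonal (slotEuler 0 p + slotEuler 1 p + slotEuler 2 p) := by
  refine derivation_comp_algHom diagonal (slotEuler 0 + slotEuler 1 + slotEuler 2) orderDer ?_ p
  rintro (t | ⟨s, j⟩)
  · simp [diagonal, orderDer, slotEuler]
  · fin_cases s <;> simp [diagonal, orderDer, slotEuler]

theorem slotEuler_place_mul_place {f g : MvPolynomial (τ ⊕ Fin 2) ℂ} {m p : ℂ}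
    (hf : orderDer f = m • f) (hg : orderDer g = p • g) :
    slotEuler 0 (place 0 f * place 1 g) = m • (place 0 f * place 1 g) ∧
    slotEuler 1 (place 0 f * place 1 g) = p • (place 0 f * place 1 g) ∧
    slotEuler 2 (place 0 f * place 1 g) = (0 : ℂ) • (place 0 f * place 1 g) := by
  refine ⟨?_, ?_, ?_⟩ <;>
    simp [Derivation.leibniz, slotEuler_place_self, slotEuler_place_of_ne, hf, hg, mul_comm]

theorem orderDer_rawTransvectant {f g : MvPolynomial (τ ⊕ Fin 2) ℂ} {m p : ℂ}
    (hf : orderDer f = m • f) (hg : orderDer g = p • g) (r : ℕ) :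
    orderDer (rawTransvectant r f g) = (m + p - 2 * r) • rawTransvectant r f g := by
  obtain ⟨h0, h1, h2⟩ := slotEuler_place_mul_place hf hg
  rw [rawTransvectant, orderDer_diagonal, slotEuler_slotCayley_pow h0, slotEuler_slotCayley_pow h1,
    slotEuler_slotCayley_pow h2, ← map_smul]
  simp
  module

theorem rawTransvectant_eq_zero {f g : MvPolynomial (τ ⊕ Fin 2) ℂ} {m : ℕ} {p : ℂ}
    (hf : orderDer f = (m : ℂ) • f) (hg : orderDer g = p • g) {r : ℕ} (h : m < r) :
    rawTransvectant r f g = 0 := by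
  obtain ⟨h0, -, -⟩ := slotEuler_place_mul_place hf hg
  have h1 := slotEuler_slotCayley_pow (t := 0) (u := 1) h0 r
  have h2 : ((m : ℂ) - r * ((if (0 : Fin 3) = 0 then 1 else 0 : ℂ) + if (1 : Fin 3) = 0 then 1 else 0))
      = ((m - r : ℤ) : ℂ) := by simp
  rw [h2] at h1
  rw [rawTransvectant, slotEuler_eq_zero_of_neg (by omega) h1, map_zero]

/-- Renaming the parameters. -/
def renameParam (φ : τ → τ') : MvPolynomial (τ ⊕ Fin 2) ℂ →ₐ[ℂ] MvPolynomial (τ' ⊕ Fin 2) ℂ :=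
  rename (Sum.map φ id)

theorem rawTransvectant_renameParam (φ : τ → τ') (r : ℕ) (f g : MvPolynomial (τ ⊕ Fin 2) ℂ) :
    rawTransvectant r (renameParam φ f) (renameParam φ g) =
      renameParam φ (rawTransvectant r f g) := by
  classical
  let ρ : ThreePoint τ →ₐ[ℂ] ThreePoint τ' := rename (Sum.map φ id)
  have h1 : ∀ s (f : MvPolynomial (τ ⊕ Fin 2) ℂ), place s (renameParam φ f) = ρ (place s f) := by
    intro s f
    simp only [place, renameParam, ρ, rename_rename]
    have : ((Sum.map id fun i => (s, i)) ∘ Sum.map φ id : τ ⊕ Fin 2 → τ' ⊕ (Fin 3 × Fin 2)) =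
      Sum.map φ id ∘ Sum.map id fun i => (s, i) := by
        funext v; rcases v with t | j <;> rfl
    rw [this]
  have h2 : ∀ s i (G : ThreePoint τ), partialD s i (ρ G) = ρ (partialD s i G) := by
    intro s i G
    refine derivation_comp_algHom ρ (pderiv (Sum.inr (s, i))) (pderiv (Sum.inr (s, i))) ?_ G
    rintro (t | ⟨u, j⟩)
    · simp [ρ, pderiv_X]
    · by_cases h : s = u ∧ i = j <;> simp [ρ, pderiv_X, h]
  have h3 : ∀ G : ThreePoint τ, slotCayley 0 1 (ρ G) = ρ (slotCayley 0 1 G) := by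
    intro G
    simp only [slotCayley_apply, h2, map_sub]
  have h4 : ∀ G : ThreePoint τ, (slotCayley 0 1 ^ r) (ρ G) = ρ ((slotCayley 0 1 ^ r) G) := by
    intro G
    induction r with
    | zero => rfl
    | succ r ih => rw [pow_succ', Module.End.mul_apply, ih, h3, pow_succ', Module.End.mul_apply]
  have h5 : ∀ G : ThreePoint τ, diagonal (ρ G) = renameParam φ (diagonal G) := by
    intro G
    simp only [diagonal, renameParam, ρ, rename_rename]
    have : (Sum.map id Prod.snd ∘ Sum.map φ id : τ ⊕ (Fin 3 × Fin 2) → τ' ⊕ Fin 2) =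
      Sum.map φ id ∘ Sum.map id Prod.snd := by
        funext v; rcases v with t | j <;> rfl
    rw [this]
  rw [rawTransvectant, h1, h1, ← map_mul, h4, h5, rawTransvectant]

end Leibniz

/-! ### Comparison of the two normalizations of transvectants -/

section Normalization

variable {τ : Type*}

theorem polarization_apply (s : Fin 3) (G : ThreePoint τ) :
    polarization s G = X (Sum.inr (2, 0)) * partialD s 0 G + X (Sum.inr (2, 1)) * partialD s 1 G :=
  rfl

theorem partialD_X_mul {s : Fin 3} (hs : s ≠ 2) (i j : Fin 2) (G : ThreePoint τ) :
    partialD s i (X (Sum.inr (2, j)) * G) = X (Sum.inr (2, j)) * partialD s i G := by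
  classical
  rw [partialD_mul, partialD_apply _ _ (X _), pderiv_X]
  simp [hs]

/-- Polarization multiplies only by coordinates of slot `2`, which the Cayley operator of the slots
`0` and `1` does not differentiate. -/
theorem slotCayley_polarization (s : Fin 3) (G : ThreePoint τ) :
    slotCayley 0 1 (polarization s G) = polarization s (slotCayley 0 1 G) := by
  have h : ∀ i : Fin 2, slotCayley 0 1 (partialD s i G) = partialD s i (slotCayley 0 1 G) :=
    fun i => LinearMap.congr_fun (slotCayley_commute_partialD 0 1 s i).eq G
  rw [polarization_apply, polarization_apply, ← h, ← h]
  simp only [slotCayley_apply, map_add, partialD_X_mul (by decide : (0 : Fin 3) ≠ 2),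
    partialD_X_mul (by decide : (1 : Fin 3) ≠ 2)]
  ring

theorem slotEuler_X_mul {s : Fin 3} (hs : s ≠ 2) (j : Fin 2) (G : ThreePoint τ) :
    slotEuler s (X (Sum.inr (2, j)) * G) = X (Sum.inr (2, j)) * slotEuler s G := by
  simp [Derivation.leibniz, slotEuler, Ne.symm hs]

theorem slotEuler_polarization_self {s : Fin 3} (hs : s ≠ 2) {G : ThreePoint τ} {c : ℂ}
    (h : slotEuler s G = c • G) : slotEuler s (polarization s G) = (c - 1) • polarization s G := by
  simp only [polarization_apply, map_add, slotEuler_X_mul hs, slotEuler_partialD, h, map_smul]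
  simp only [if_true, mul_sub, mul_smul_comm]
  module

theorem slotEuler_polarization_of_ne {s t : Fin 3} (hs : s ≠ 2) (hst : t ≠ s) {G : ThreePoint τ}
    {c : ℂ} (h : slotEuler s G = c • G) : slotEuler s (polarization t G) = c • polarization t G := by
  simp only [polarization_apply, map_add, slotEuler_X_mul hs, slotEuler_partialD, h, map_smul]
  simp only [hst, if_false, mul_smul_comm, zero_smul, sub_zero]
  module

theorem diagonal_polarization {s : Fin 3} {G : ThreePoint τ} {c : ℂ} (h : slotEuler s G = c • G) :
    diagonal (polarization s G) = c • diagonal G := by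
  rw [polarization_apply, map_add, map_mul, map_mul, diagonal_X, diagonal_X, diagonal_euler h]

theorem diagonal_polarization_pow {s : Fin 3} (hs : s ≠ 2) (a : ℕ) {G : ThreePoint τ}
    (h : slotEuler s G = (a : ℂ) • G) :
    diagonal ((polarization s ^ a) G) = (a.factorial : ℂ) • diagonal G := by
  induction a generalizing G with
  | zero => simp
  | succ a ih =>
    rw [pow_succ, Module.End.mul_apply, ih, diagonal_polarization h, smul_smul, Nat.factorial_succ]
    · push_cast; ring_nf
    · rw [slotEuler_polarization_self hs h]; push_cast; ring_nf

theorem slotEuler_polarization_pow_of_ne {s t : Fin 3} (hs : s ≠ 2) (hst : t ≠ s) (a : ℕ)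
    {G : ThreePoint τ} {c : ℂ} (h : slotEuler s G = c • G) :
    slotEuler s ((polarization t ^ a) G) = c • (polarization t ^ a) G := by
  induction a with
  | zero => simpa using h
  | succ a ih =>
    rw [pow_succ', Module.End.mul_apply, slotEuler_polarization_of_ne hs hst ih]

/-- The polarizations can be applied after `Ω^r`. On the diagonal each acts as an Euler operator and
lowers the order by one; the successive orders multiply to the factorials. -/
theorem transvectant_eq_smul {f g : MvPolynomial (τ ⊕ Fin 2) ℂ} {m p r : ℕ}
    (hf : orderDer f = (m : ℂ) • f) (hg : orderDer g = (p : ℂ) • g) (hr : r ≤ min m p) :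
    transvectant m p r f g =
      (((m - r).factorial * (p - r).factorial : ℕ) : ℂ) • rawTransvectant r f g := by
  have hcomm : ∀ s, Commute (slotCayley (τ := τ) 0 1) (polarization s) := fun s =>
    LinearMap.ext fun G => slotCayley_polarization s G
  obtain ⟨h0, h1, -⟩ := slotEuler_place_mul_place hf hg
  have hm : r ≤ m := hr.trans (min_le_left _ _)
  have hp : r ≤ p := hr.trans (min_le_right _ _)
  have e0 := slotEuler_slotCayley_pow (t := 0) (u := 1) h0 r
  have e1 := slotEuler_slotCayley_pow (t := 0) (u := 1) h1 r
  rw [transvectant, if_pos hr]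
  change diagonal ((slotCayley 0 1 ^ r * polarization 0 ^ (m - r) * polarization 1 ^ (p - r) :
    Module.End ℂ (ThreePoint τ)) (place 0 f * place 1 g)) = _
  rw [(((hcomm 0).pow_pow _ _).eq), mul_assoc, (((hcomm 1).pow_pow _ _).eq), Module.End.mul_apply,
    Module.End.mul_apply, diagonal_polarization_pow (by decide),
    diagonal_polarization_pow (by decide), smul_smul, rawTransvectant]
  · push_cast; rfl
  · rw [e1]; push_cast [hp]; simp
  · rw [slotEuler_polarization_pow_of_ne (by decide) (by decide) _ e0]
    push_cast [hm]; simp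

end Normalization

/-! ### Spaces of covariants as common kernels, and reindexing of the forms -/

section Covariants

variable {ι ι' : Type*} {n : ι → ℕ}

/-- The Euler operator in the parameters. -/
def degreeDer (τ : Type*) : Derivation ℂ (MvPolynomial (τ ⊕ Fin 2) ℂ) (MvPolynomial (τ ⊕ Fin 2) ℂ) :=
  pointDer X 0

theorem degreeDer_eq (τ : Type*) : degreeDer τ = diagDer (Sum.elim 1 0) := by
  refine derivation_ext ?_
  rintro (t | j) <;> simp [degreeDer]

theorem isWeightedHomogeneous_bidegWeight_iff (p : CoordRing n) (d k : ℕ) :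
    IsWeightedHomogeneous (bidegWeight n) p (d, k) ↔
      degreeDer _ p = (d : ℂ) • p ∧ orderDer p = (k : ℂ) • p := by
  have hd : (fun v => (Nat.castAddMonoidHom ℂ).comp (AddMonoidHom.fst ℕ ℕ) (bidegWeight n v)) =
      (Sum.elim 1 0 : CoeffVar n ⊕ Fin 2 → ℂ) := by
    funext v; rcases v with v | j <;> simp [bidegWeight]
  have hk : (fun v => (Nat.castAddMonoidHom ℂ).comp (AddMonoidHom.snd ℕ ℕ) (bidegWeight n v)) =
      (Sum.elim 0 1 : CoeffVar n ⊕ Fin 2 → ℂ) := by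
    funext v; rcases v with v | j <;> simp [bidegWeight]
  rw [degreeDer_eq, orderDer, diagDer_eq_iff, diagDer_eq_iff]
  constructor
  · intro h
    refine ⟨?_, ?_⟩
    · rw [← hd]
      exact isWeightedHomogeneous_map_weight ((Nat.castAddMonoidHom ℂ).comp (AddMonoidHom.fst ℕ ℕ)) h
    · rw [← hk]
      exact isWeightedHomogeneous_map_weight ((Nat.castAddMonoidHom ℂ).comp (AddMonoidHom.snd ℕ ℕ)) h
  · rintro ⟨h1, h2⟩ s hs
    have e1 := h1 hs
    have e2 := h2 hs
    rw [← hd, weight_map] at e1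
    rw [← hk, weight_map] at e2
    refine Prod.ext ?_ ?_
    · exact Nat.cast_injective (R := ℂ) e1
    · exact Nat.cast_injective (R := ℂ) e2

/-- The working description of `Cov_{d,k}`: four linear differential equations, stable under
products, transvectants and reindexing. -/
theorem mem_cov_iff {p : CoordRing n} {d k : ℕ} :
    p ∈ cov n d k ↔ raiseDer n p = 0 ∧ lowerDer n p = 0 ∧ degreeDer _ p = (d : ℂ) • p ∧
      orderDer p = (k : ℂ) • p := by
  rw [cov, Submodule.mem_inf, Subalgebra.mem_toSubmodule, mem_covAlg_iff,
    mem_weightedHomogeneousSubmodule, isWeightedHomogeneous_bidegWeight_iff, and_assoc]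

theorem orderDer_of_mem_cov {p : CoordRing n} {d k : ℕ} (h : p ∈ cov n d k) :
    orderDer p = (k : ℂ) • p := (mem_cov_iff.1 h).2.2.2

theorem mul_mem_cov {p q : CoordRing n} {d₁ k₁ d₂ k₂ : ℕ} (hp : p ∈ cov n d₁ k₁)
    (hq : q ∈ cov n d₂ k₂) : p * q ∈ cov n (d₁ + d₂) (k₁ + k₂) :=
  ⟨(covAlg n).mul_mem hp.1 hq.1, IsWeightedHomogeneous.mul hp.2 hq.2⟩

theorem one_mem_cov : (1 : CoordRing n) ∈ cov n 0 0 :=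
  ⟨(covAlg n).one_mem, isWeightedHomogeneous_one ℂ _⟩

theorem pow_mem_cov {p : CoordRing n} {d k : ℕ} (hp : p ∈ cov n d k) (a : ℕ) :
    p ^ a ∈ cov n (a * d) (a * k) := by
  induction a with
  | zero => simpa using one_mem_cov
  | succ a ih => rw [pow_succ, Nat.succ_mul, Nat.succ_mul]; exact mul_mem_cov ih hp

theorem prod_mem_cov {κ : Type*} (s : Finset κ) {f : κ → CoordRing n} {d k : κ → ℕ}
    (h : ∀ i ∈ s, f i ∈ cov n (d i) (k i)) :
    ∏ i ∈ s, f i ∈ cov n (∑ i ∈ s, d i) (∑ i ∈ s, k i) := by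
  classical
  induction s using Finset.induction_on with
  | empty => simpa using one_mem_cov
  | insert a s ha ih =>
    rw [Finset.prod_insert ha, Finset.sum_insert ha, Finset.sum_insert ha]
    exact mul_mem_cov (h a (Finset.mem_insert_self _ _))
      (ih fun i hi => h i (Finset.mem_insert_of_mem hi))

/-- Each of the first three equations passes to the transvectant by the Leibniz rule, and each `Ω`
lowers the order by two. -/
theorem rawTransvectant_mem_cov {p q : CoordRing n} {d₁ k₁ d₂ k₂ k r : ℕ} (hp : p ∈ cov n d₁ k₁)
    (hq : q ∈ cov n d₂ k₂) (hk : k + 2 * r = k₁ + k₂) :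
    rawTransvectant r p q ∈ cov n (d₁ + d₂) k := by
  obtain ⟨p1, p2, p3, p4⟩ := mem_cov_iff.1 hp
  obtain ⟨q1, q2, q3, q4⟩ := mem_cov_iff.1 hq
  have hzero : ∀ f : CoordRing n, rawTransvectant r f 0 = 0 := fun f => by simp [rawTransvectant]
  have hsmul : ∀ (c : ℂ) (f g : CoordRing n),
      rawTransvectant r f (c • g) = c • rawTransvectant r f g := fun c f g => by
    simp only [rawTransvectant, map_smul, mul_smul_comm]
  refine mem_cov_iff.2 ⟨?_, ?_, ?_, ?_⟩
  · unfold raiseDer at *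
    rw [pointDer_rawTransvectant _ (by simp [upperNil]), p1, q1, rawTransvectant_zero_left, hzero,
      add_zero]
  · unfold lowerDer at *
    rw [pointDer_rawTransvectant _ (by simp [lowerNil]), p2, q2, rawTransvectant_zero_left, hzero,
      add_zero]
  · unfold degreeDer at *
    rw [pointDer_rawTransvectant _ (by simp), p3, q3, rawTransvectant_smul_left, hsmul]
    push_cast
    module
  · rw [orderDer_rawTransvectant p4 q4]
    congr 1
    have : ((k + 2 * r : ℕ) : ℂ) = ((k₁ + k₂ : ℕ) : ℂ) := by rw [hk]
    push_cast at this
    linear_combination -this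

/-- Polynomials on the sum of the forms with indices in the range of `φ`, as polynomials on the sum
of all the forms. -/
def reindex (φ : ι → ι') (n' : ι' → ℕ) : CoordRing (fun i => n' (φ i)) →ₐ[ℂ] CoordRing n' :=
  renameParam fun v : CoeffVar fun i => n' (φ i) => (⟨φ v.1, v.2⟩ : CoeffVar n')

variable (φ : ι → ι') (n' : ι' → ℕ)

theorem pointDer_raise_reindex (χ : ι' → ℂ) (N : Matrix (Fin 2) (Fin 2) ℂ)
    (p : CoordRing fun i => n' (φ i)) : pointDer (raiseCoeff χ) N (reindex φ n' p) =
      reindex φ n' (pointDer (raiseCoeff fun i => χ (φ i)) N p) := by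
  refine derivation_comp_algHom _ _ _ ?_ p
  rintro (t | j)
  · simp [reindex, renameParam, raiseCoeff, prevVar]
  · simp [reindex, renameParam]

theorem pointDer_lower_reindex (χ : ι' → ℂ) (N : Matrix (Fin 2) (Fin 2) ℂ)
    (p : CoordRing fun i => n' (φ i)) : pointDer (lowerCoeff χ) N (reindex φ n' p) =
      reindex φ n' (pointDer (lowerCoeff fun i => χ (φ i)) N p) := by
  refine derivation_comp_algHom _ _ _ ?_ p
  rintro (t | j)
  · simp [reindex, renameParam, lowerCoeff, nextVar]
  · simp [reindex, renameParam]

theorem degreeDer_reindex (p : CoordRing fun i => n' (φ i)) :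
    degreeDer _ (reindex φ n' p) = reindex φ n' (degreeDer _ p) := by
  refine derivation_comp_algHom _ _ _ ?_ p
  rintro (t | j) <;> simp [reindex, renameParam, degreeDer]

theorem orderDer_reindex (p : CoordRing fun i => n' (φ i)) :
    orderDer (reindex φ n' p) = reindex φ n' (orderDer p) := by
  refine derivation_comp_algHom _ _ _ ?_ p
  rintro (t | j) <;> simp [reindex, renameParam, orderDer]

theorem raiseDer_reindex (p : CoordRing fun i => n' (φ i)) :
    raiseDer n' (reindex φ n' p) = reindex φ n' (raiseDer _ p) :=
  pointDer_raise_reindex φ n' 1 upperNil p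

theorem lowerDer_reindex (p : CoordRing fun i => n' (φ i)) :
    lowerDer n' (reindex φ n' p) = reindex φ n' (lowerDer _ p) :=
  pointDer_lower_reindex φ n' 1 lowerNil p

variable {φ n'}

theorem reindex_mem_cov {p : CoordRing fun i => n' (φ i)} {d k : ℕ} (h : p ∈ cov _ d k) :
    reindex φ n' p ∈ cov n' d k := by
  obtain ⟨h1, h2, h3, h4⟩ := mem_cov_iff.1 h
  refine mem_cov_iff.2 ⟨?_, ?_, ?_, ?_⟩
  · rw [raiseDer_reindex, h1, map_zero]
  · rw [lowerDer_reindex, h2, map_zero]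
  · rw [degreeDer_reindex, h3, map_smul]
  · rw [orderDer_reindex, h4, map_smul]

theorem mem_cov_of_reindex_mem_cov (hφ : Function.Injective (reindex φ n'))
    {p : CoordRing fun i => n' (φ i)} {d k : ℕ} (h : reindex φ n' p ∈ cov n' d k) :
    p ∈ cov _ d k := by
  obtain ⟨h1, h2, h3, h4⟩ := mem_cov_iff.1 h
  refine mem_cov_iff.2 ⟨?_, ?_, ?_, ?_⟩ <;> apply hφ
  · rw [← raiseDer_reindex, h1, map_zero]
  · rw [← lowerDer_reindex, h2, map_zero]
  · rw [← degreeDer_reindex, h3, map_smul]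
  · rw [← orderDer_reindex, h4, map_smul]

theorem reindex_rawTransvectant (r : ℕ) (p q : CoordRing fun i => n' (φ i)) :
    rawTransvectant r (reindex φ n' p) (reindex φ n' q) = reindex φ n' (rawTransvectant r p q) :=
  rawTransvectant_renameParam _ r p q

end Covariants

/-! ### Order bounds -/

section OrderBound

variable {ι : Type*} (n : ι → ℕ)

/-- The products of two covariants of positive orders and of total degree `d` and order `k`, the
first factor being of order at most `a`. -/
def prodSet (a d k : ℕ) : Set (CoordRing n) :=
  {p | ∃ d₁ k₁ d₂ k₂ f q, d₁ + d₂ = d ∧ k₁ + k₂ = k ∧ 0 < k₁ ∧ k₁ ≤ a ∧ f ∈ cov n d₁ k₁ ∧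
    q ∈ cov n d₂ k₂ ∧ p = f * q}

/-- The products of two covariants of positive orders and of total degree `d` and order `k`. -/
def decomposableSet (d k : ℕ) : Set (CoordRing n) :=
  {p | ∃ d₁ k₁ d₂ k₂ f q, d₁ + d₂ = d ∧ k₁ + k₂ = k ∧ 0 < k₁ ∧ 0 < k₂ ∧ f ∈ cov n d₁ k₁ ∧
    q ∈ cov n d₂ k₂ ∧ p = f * q}

/-- Every covariant of order greater than `a` is a combination of products of covariants of
positive smaller orders. -/
def OrderBound (a : ℕ) : Prop :=
  ∀ d k, a < k → ∀ p ∈ cov n d k, p ∈ Submodule.span ℂ (decomposableSet n d k)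

variable {n}

/-- The first factor is split again, its second part being moved into the other factor, until its
order is at most `a`. A covariant already of order at most `a` takes the cofactor `1`, so the second
factor may have order `0`. -/
theorem OrderBound.mem_span_prodSet {a : ℕ} (h : OrderBound n a) {d k : ℕ} (hk : 0 < k)
    {p : CoordRing n} (hp : p ∈ cov n d k) : p ∈ Submodule.span ℂ (prodSet n a d k) := by
  induction k using Nat.strong_induction_on generalizing d p with
  | _ k ih =>
    rcases le_or_gt k a with hka | hka
    · exact Submodule.subset_span
        ⟨d, k, 0, 0, p, 1, by simp, by simp, hk, hka, hp, one_mem_cov, by simp⟩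
    · refine Submodule.span_le.2 ?_ (h d k hka p hp)
      rintro _ ⟨d₁, k₁, d₂, k₂, f, q, hd, hk', h1, h2, hf, hq, rfl⟩
      have hf' := ih k₁ (by omega) h1 hf
      refine Submodule.span_induction (p := fun f _ => f * q ∈ Submodule.span ℂ (prodSet n a d k))
        ?_ (by simp) (fun x y _ _ hx hy => ?_) (fun c x _ hx => ?_) hf'
      · rintro _ ⟨d₃, k₃, d₄, k₄, f', q', hd', hk'', h3, h4, hf', hq', rfl⟩
        exact Submodule.subset_span ⟨d₃, k₃, d₄ + d₂, k₄ + k₂, f', q' * q, by omega, by omega, h3, h4,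
          hf', mul_mem_cov hq' hq, by ring⟩
      · rw [add_mul]; exact Submodule.add_mem _ hx hy
      · rw [smul_mul_assoc]; exact Submodule.smul_mem _ _ hx

end OrderBound

/-! ### Reduction of transvectants of large order -/

section Core

variable {ι₁ ι₂ : Type*} {n₁ : ι₁ → ℕ} {n₂ : ι₂ → ℕ} {a b d k : ℕ}
  {K : Submodule ℂ (CoordRing (Sum.elim n₁ n₂))}

theorem inclLeft_mem_cov {p : CoordRing n₁} {d k : ℕ} (h : p ∈ cov n₁ d k) :
    inclLeft n₁ n₂ p ∈ cov (Sum.elim n₁ n₂) d k :=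
  reindex_mem_cov (φ := Sum.inl) (n' := Sum.elim n₁ n₂) h

theorem inclRight_mem_cov {p : CoordRing n₂} {d k : ℕ} (h : p ∈ cov n₂ d k) :
    inclRight n₁ n₂ p ∈ cov (Sum.elim n₁ n₂) d k :=
  reindex_mem_cov (φ := Sum.inr) (n' := Sum.elim n₁ n₂) h

/-- The inductive step for transvectants whose left factor has large order. -/
theorem rawTransvectant_reindex_mem {ι ι' : Type*} {n' : ι' → ℕ} {φ : ι → ι'} {a d k r : ℕ}
    {K : Submodule ℂ (CoordRing n')} (h₁ : OrderBound (fun i => n' (φ i)) a) (hak : a < k)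
    (hK : ∀ d₁ k₁ d₂ k₂ p q, d₁ + d₂ = d → k₁ + k₂ = k → 0 < k₁ → 0 < k₂ → p ∈ cov n' d₁ k₁ →
      q ∈ cov n' d₂ k₂ → p * q ∈ K)
    (hr : 0 < r) {d₁ k₁ d₂ k₂ : ℕ} {A : CoordRing fun i => n' (φ i)} {B : CoordRing n'}
    (hA : A ∈ cov _ d₁ k₁) (hB : B ∈ cov n' d₂ k₂) (hd : d₁ + d₂ = d) (hk : k₁ + k₂ = k + 2 * r)
    (hr₁ : r + a ≤ k₁)
    (ih : ∀ c, 1 ≤ c → c ≤ r → c ≤ a → ∀ A' ∈ cov (fun i => n' (φ i)) d₁ (k₁ - 2 * c),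
      rawTransvectant (r - c) (reindex φ n' A') B ∈ K) :
    rawTransvectant r (reindex φ n' A) B ∈ K := by
  have hA' := h₁.mem_span_prodSet (by omega) hA
  refine Submodule.span_induction (p := fun A _ => rawTransvectant r (reindex φ n' A) B ∈ K)
    ?_ (by simp [rawTransvectant_zero_left]) (fun x y _ _ hx hy => ?_) (fun c x _ hx => ?_) hA'
  · rintro _ ⟨d₃, k₃, d₄, k₄, f, q, hd', hk', h3, h4, hf, hq, rfl⟩
    rw [map_mul]
    have of := orderDer_of_mem_cov (reindex_mem_cov (n' := n') hf)
    have oq := orderDer_of_mem_cov (reindex_mem_cov (n' := n') hq)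
    have oB := orderDer_of_mem_cov hB
    -- Gordan's lemma needs `r ≤ k₄`. This holds because `k₄ = k₁ - k₃`, `k₃ ≤ a` and `r + a ≤ k₁`.
    refine rawTransvectant_mul_mem of oq oB (by omega) ?_ fun c hc1 hc2 => ?_
    -- The factors `f` and `(q, B)_r` have orders `k₃` and `k - k₃`, both positive because `k₃ ≤ a <
    -- k`.
    · refine hK d₃ k₃ (d₄ + d₂) (k - k₃) _ _ (by omega) (by omega) h3 (by omega)
        (reindex_mem_cov hf) (rawTransvectant_mem_cov (reindex_mem_cov hq) hB (by omega))
    · rw [reindex_rawTransvectant]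
      -- `(f, q)_c` vanishes for `c > ord f`, so only `c ≤ k₃ ≤ a` has to be treated by induction.
      rcases le_or_gt c k₃ with hc | hc
      · refine ih c hc1 hc2 (by omega) _ ?_
        rw [← hd']
        exact rawTransvectant_mem_cov hf hq (by omega)
      · rw [rawTransvectant_eq_zero (orderDer_of_mem_cov hf) (orderDer_of_mem_cov hq) hc, map_zero,
          rawTransvectant_zero_left]
        exact K.zero_mem
  · rw [map_add, rawTransvectant_add_left]; exact K.add_mem hx hy
  · rw [map_smul, rawTransvectant_smul_left]; exact K.smul_mem _ hx

/-- The product case of the main reduction. -/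
theorem reindex_mul_mem {ι ι' : Type*} {n' : ι' → ℕ} {φ : ι → ι'} {a d k : ℕ}
    {K : Submodule ℂ (CoordRing n')} (h₁ : OrderBound (fun i => n' (φ i)) a) (hak : a < k)
    (hK : ∀ d₁ k₁ d₂ k₂ p q, d₁ + d₂ = d → k₁ + k₂ = k → 0 < k₁ → 0 < k₂ → p ∈ cov n' d₁ k₁ →
      q ∈ cov n' d₂ k₂ → p * q ∈ K)
    {d₁ d₂ : ℕ} {A : CoordRing fun i => n' (φ i)} {B : CoordRing n'}
    (hA : A ∈ cov _ d₁ k) (hB : B ∈ cov n' d₂ 0) (hd : d₁ + d₂ = d) :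
    reindex φ n' A * B ∈ K := by
  have hA' := h₁.mem_span_prodSet (by omega) hA
  refine Submodule.span_induction (p := fun A _ => reindex φ n' A * B ∈ K)
    ?_ (by simp) (fun x y _ _ hx hy => ?_) (fun c x _ hx => ?_) hA'
  · rintro _ ⟨d₃, k₃, d₄, k₄, f, q, hd', hk', h3, h4, hf, hq, rfl⟩
    rw [map_mul, mul_assoc]
    exact hK d₃ k₃ (d₄ + d₂) k₄ _ _ (by omega) (by omega) h3 (by omega)
        (reindex_mem_cov hf) (by simpa using mul_mem_cov (reindex_mem_cov (n' := n') hq) hB)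
  · rw [map_add, add_mul]; exact K.add_mem hx hy
  · rw [map_smul, smul_mul_assoc]; exact K.smul_mem _ hx

/-- Transvectants of order `k ≥ a + b` lie in every space that contains the products of two
covariants of positive orders. -/
theorem rawTransvectant_incl_mem (h₁ : OrderBound n₁ a) (h₂ : OrderBound n₂ b) (hab : a + b ≤ k)
    (ha : a < k) (hb : b < k)
    (hK : ∀ d₁ k₁ d₂ k₂ p q, d₁ + d₂ = d → k₁ + k₂ = k → 0 < k₁ → 0 < k₂ →
      p ∈ cov (Sum.elim n₁ n₂) d₁ k₁ → q ∈ cov (Sum.elim n₁ n₂) d₂ k₂ → p * q ∈ K)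
    (r : ℕ) {d₁ k₁ d₂ k₂ : ℕ} {A : CoordRing n₁} {B : CoordRing n₂} (hA : A ∈ cov n₁ d₁ k₁)
    (hB : B ∈ cov n₂ d₂ k₂) (hd : d₁ + d₂ = d) (hk : k₁ + k₂ = k + 2 * r) (hr₁ : r ≤ k₁)
    (hr₂ : r ≤ k₂) : rawTransvectant r (inclLeft n₁ n₂ A) (inclRight n₁ n₂ B) ∈ K := by
  induction r using Nat.strong_induction_on generalizing d₁ k₁ d₂ k₂ A B with
  | _ r ih =>
    have hA' := inclLeft_mem_cov (n₂ := n₂) hA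
    have hB' := inclRight_mem_cov (n₁ := n₁) hB
    rcases Nat.eq_zero_or_pos r with rfl | hr
    · rw [rawTransvectant_zero]
      -- For index `0` the transvectant is the product. If one factor has order `0`, the other has
      -- order `k`, above its bound, and decomposes by itself.
      rcases Nat.eq_zero_or_pos k₁ with rfl | h1
      · have : k₂ = k := by omega
        subst this
        rw [mul_comm]
        exact reindex_mul_mem (φ := Sum.inr) (n' := Sum.elim n₁ n₂) h₂ hb hK hB hA' (by omega)
      rcases Nat.eq_zero_or_pos k₂ with rfl | h2
      · have : k₁ = k := by omega
        subst this
        exact reindex_mul_mem (φ := Sum.inl) (n' := Sum.elim n₁ n₂) h₁ ha hK hA hB' (by omega)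
      exact hK _ _ _ _ _ _ hd (by omega) h1 h2 hA' hB'
    -- Since `k₁ + k₂ = k + 2r ≥ (r + a) + (r + b)`, the left factor or the right one is large
    -- enough. The second case reduces to the first by antisymmetry, which only costs a sign.
    · rcases le_or_gt (r + a) k₁ with hu | hu
      · exact rawTransvectant_reindex_mem (φ := Sum.inl) (n' := Sum.elim n₁ n₂) h₁ ha hK hr hA hB' hd
          (by omega) hu fun c hc1 hc2 hc3 A' hA' =>
            ih (r - c) (by omega) hA' hB hd (by omega) (by omega) (by omega)
      · rw [rawTransvectant_swap]
        refine K.smul_mem _ ?_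
        refine rawTransvectant_reindex_mem (φ := Sum.inr) (n' := Sum.elim n₁ n₂) h₂ hb hK hr hB hA'
          (by omega) (by omega) (by omega) fun c hc1 hc2 hc3 B' hB' => ?_
        rw [rawTransvectant_swap]
        exact K.smul_mem _ (ih (r - c) (by omega) hA hB' hd (by omega) (by omega) (by omega))

end Core

/-! ### Injectivity of the raising operator on low weights -/

section SlTwo

variable {V : Type*} [AddCommGroup V] [Module ℂ V]

/-- In a representation of `sl₂` with weights bounded below, `E ^ i` is injective on the weight
spaces of weight at most `-i`. -/
theorem eq_zero_of_raise_pow_eq_zero (E F : Module.End ℂ V) (W : ℤ → Submodule ℂ V) (b : ℤ)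
    (hF : ∀ μ, ∀ x ∈ W μ, F x ∈ W (μ - 2)) (hE : ∀ μ, ∀ x ∈ W μ, E x ∈ W (μ + 2))
    (hEF : ∀ μ, ∀ x ∈ W μ, E (F x) - F (E x) = (μ : ℂ) • x) (hb : ∀ μ < b, ∀ x ∈ W μ, x = 0)
    (i : ℕ) (μ : ℤ) (hμ : μ ≤ -i) (x : V) (hx : x ∈ W μ) (h : (E ^ i) x = 0) : x = 0 := by
  -- The rule `[E^{i+1}, F] = (i + 1) E^i (H + i)`, on weight vectors.
  have hcomm : ∀ (i : ℕ) (μ : ℤ), ∀ x ∈ W μ,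
      (E ^ (i + 1)) (F x) = F ((E ^ (i + 1)) x) + (((i : ℂ) + 1) * (μ + i)) • (E ^ i) x := by
    intro i
    induction i with
    | zero =>
      intro μ x hx
      have := hEF μ x hx
      simp only [zero_add, pow_one, pow_zero, Module.End.one_apply, Nat.cast_zero, one_mul,
        add_zero]
      rw [← this]; abel
    | succ i ih =>
      intro μ x hx
      have h1 := ih (μ + 2) (E x) (hE μ x hx)
      have h2 : E (F x) = F (E x) + (μ : ℂ) • x := by rw [← hEF μ x hx]; abel
      rw [pow_succ E (i + 1), Module.End.mul_apply, h2, map_add, h1, map_smul,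
        Module.End.mul_apply, ← Module.End.mul_apply (E ^ i) E, ← pow_succ]
      push_cast
      module
  -- Outer induction on the distance to the lowest weight, inner induction on `i`. If `E^{i+1} x =
  -- 0`, then `E^{i+2}` kills `F x`, of weight `μ - 2`, so `F x = 0`. The rule above becomes `(i +
  -- 1)(μ + i) E^i x = 0`, and `μ + i < 0`.
  have main : ∀ N : ℕ, ∀ μ : ℤ, μ < b + N → ∀ i : ℕ, μ ≤ -i → ∀ x ∈ W μ, (E ^ i) x = 0 → x = 0 := by
    intro N
    induction N with
    | zero => intro μ hμ i _ x hx _; exact hb μ (by simpa using hμ) x hx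
    | succ N ihN =>
      intro μ hμ i
      induction i with
      | zero => intro _ x _ h; simpa using h
      | succ i ihi =>
        intro hi x hx h
        have h1 := hcomm i μ x hx
        rw [h, map_zero, zero_add] at h1
        have h2 : (E ^ (i + 2)) (F x) = 0 := by
          rw [pow_succ', Module.End.mul_apply, h1, map_smul, ← Module.End.mul_apply, ← pow_succ', h,
            smul_zero]
        have h3 : F x = 0 := ihN (μ - 2) (by push_cast at hμ; omega) (i + 2)
          (by push_cast at hi ⊢; omega) _ (hF μ x hx) h2
        rw [h3, map_zero] at h1
        have h4 : ((i : ℂ) + 1) * (μ + i) ≠ 0 := by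
          refine mul_ne_zero (by exact_mod_cast Nat.succ_ne_zero i) ?_
          have : μ + i ≠ 0 := by push_cast at hi; omega
          exact_mod_cast this
        exact ihi (by push_cast at hi; omega) x hx ((smul_eq_zero.1 h1.symm).resolve_left h4)
  obtain ⟨N, hN⟩ : ∃ N : ℕ, μ < b + N := ⟨(μ - b + 1).toNat, by omega⟩
  exact main N μ hN i hμ x hx h

end SlTwo

/-! ### The `sl₂`-triples acting on `ℂ[V]` -/

section Operators

variable {ι : Type*} {n : ι → ℕ}

/-- The raising operator on `ℂ[V]`, acting on the forms with multiplier `1`. -/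
def raiseOp (n : ι → ℕ) (ε : ι → ℕ) :
    Derivation ℂ (MvPolynomial (CoeffVar n) ℂ) (MvPolynomial (CoeffVar n) ℂ) :=
  mkDerivation ℂ (raiseCoeff fun i => (ε i : ℂ))

/-- The lowering operator on `ℂ[V]`, acting on the forms with multiplier `1`. -/
def lowerOp (n : ι → ℕ) (ε : ι → ℕ) :
    Derivation ℂ (MvPolynomial (CoeffVar n) ℂ) (MvPolynomial (CoeffVar n) ℂ) :=
  mkDerivation ℂ (lowerCoeff fun i => (ε i : ℂ))

/-- The weight of a coefficient. -/
def coeffWeight (n : ι → ℕ) (ε : ι → ℕ) (v : CoeffVar n) : ℤ := ε v.1 * ((n v.1 : ℤ) - 2 * (v.2 : ℕ))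

/-- The weight operator on `ℂ[V]`. -/
def weightOp (n : ι → ℕ) (ε : ι → ℕ) :
    Derivation ℂ (MvPolynomial (CoeffVar n) ℂ) (MvPolynomial (CoeffVar n) ℂ) :=
  diagDer fun v => (coeffWeight n ε v : ℂ)

/-- The Euler operator on `ℂ[V]`. -/
def degreeOp (n : ι → ℕ) (ε : ι → ℕ) :
    Derivation ℂ (MvPolynomial (CoeffVar n) ℂ) (MvPolynomial (CoeffVar n) ℂ) :=
  diagDer fun v => (ε v.1 : ℂ)

theorem raiseOp_X (ε : ι → ℕ) (v : CoeffVar n) : raiseOp n ε (X v) =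
    -((ε v.1 : ℂ) * ((v.2 : ℕ) : ℂ)) • X (prevVar v) := mkDerivation_X _ _ _

theorem lowerOp_X (ε : ι → ℕ) (v : CoeffVar n) : lowerOp n ε (X v) =
    -((ε v.1 : ℂ) * ((n v.1 : ℂ) - ((v.2 : ℕ) : ℂ))) • X (nextVar v) := mkDerivation_X _ _ _

theorem raiseOp_lowerOp_X (ε δ : ι → ℕ) (v : CoeffVar n) : raiseOp n ε (lowerOp n δ (X v)) =
    ((ε v.1 : ℂ) * δ v.1 * (((n v.1 : ℂ) - ((v.2 : ℕ) : ℂ)) * (((v.2 : ℕ) : ℂ) + 1))) • X v := by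
  rw [lowerOp_X, Derivation.map_smul, raiseOp_X, smul_smul]
  have hv := v.2.2
  rcases (Nat.lt_succ_iff.1 hv).eq_or_lt with h | h
  · simp [h]
  · have h1 : prevVar (nextVar v) = v := by
      rcases v with ⟨i, k, hk⟩
      simp only [prevVar, nextVar] at h ⊢
      congr 2
      omega
    have h2 : ((nextVar v).2 : ℕ) = v.2 + 1 := by simp only [nextVar]; omega
    rw [h1, h2]
    congr 1
    simp only [nextVar]
    push_cast
    ring

theorem lowerOp_raiseOp_X (ε δ : ι → ℕ) (v : CoeffVar n) : lowerOp n ε (raiseOp n δ (X v)) =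
    ((ε v.1 : ℂ) * δ v.1 * (((v.2 : ℕ) : ℂ) * ((n v.1 : ℂ) - ((v.2 : ℕ) : ℂ) + 1))) • X v := by
  rw [raiseOp_X, Derivation.map_smul, lowerOp_X, smul_smul]
  have hv := v.2.2
  rcases Nat.eq_zero_or_pos (v.2 : ℕ) with h | h
  · simp [h]
  · have h1 : nextVar (prevVar v) = v := by
      rcases v with ⟨i, k, hk⟩
      simp only [prevVar, nextVar] at h ⊢
      congr 2
      omega
    have h2 : ((prevVar v).2 : ℕ) = v.2 - 1 := rfl
    rw [h1, h2, Nat.cast_sub h]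
    congr 1
    simp only [prevVar]
    push_cast
    ring

/-- The condition on `ε` says that its values are `0` or `1`. It selects the summands that `sl₂`
acts on, so that the action on all of `V` and those on `V₁` or `V₂` alone are treated together. -/
theorem raiseOp_lowerOp_sub {ε : ι → ℕ} (hε : ∀ i, ε i * ε i = ε i)
    (p : MvPolynomial (CoeffVar n) ℂ) :
    raiseOp n ε (lowerOp n ε p) - lowerOp n ε (raiseOp n ε p) = weightOp n ε p := by
  refine derivation_commutator _ _ _ (fun v => ?_) p
  rw [raiseOp_lowerOp_X, lowerOp_raiseOp_X, weightOp, diagDer_X, ← sub_smul]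
  congr 1
  have : (ε v.1 : ℂ) * ε v.1 = ε v.1 := by exact_mod_cast hε v.1
  rw [this, coeffWeight]
  push_cast
  ring

theorem weightOp_raiseOp_sub {ε : ι → ℕ} (hε : ∀ i, ε i * ε i = ε i)
    (p : MvPolynomial (CoeffVar n) ℂ) :
    weightOp n ε (raiseOp n ε p) - raiseOp n ε (weightOp n ε p) = (2 : ℂ) • raiseOp n ε p := by
  refine derivation_commutator (weightOp n ε) (raiseOp n ε) ((2 : ℂ) • raiseOp n ε) (fun v => ?_) p
  rw [Derivation.smul_apply, weightOp, diagDer_X, Derivation.map_smul, raiseOp_X,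
    Derivation.map_smul, diagDer_X, smul_smul, smul_smul, smul_smul, ← sub_smul]
  have he : (ε v.1 : ℂ) * ε v.1 = ε v.1 := by exact_mod_cast hε v.1
  rcases Nat.eq_zero_or_pos (v.2 : ℕ) with h | h
  · simp [h]
  · congr 1
    simp only [coeffWeight, prevVar]
    push_cast [h]
    linear_combination (-2 : ℂ) * ((v.2 : ℕ) : ℂ) * he

theorem weightOp_lowerOp_sub {ε : ι → ℕ} (hε : ∀ i, ε i * ε i = ε i)
    (p : MvPolynomial (CoeffVar n) ℂ) :
    weightOp n ε (lowerOp n ε p) - lowerOp n ε (weightOp n ε p) = (-2 : ℂ) • lowerOp n ε p := by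
  refine derivation_commutator (weightOp n ε) (lowerOp n ε) ((-2 : ℂ) • lowerOp n ε) (fun v => ?_) p
  rw [Derivation.smul_apply, weightOp, diagDer_X, Derivation.map_smul, lowerOp_X,
    Derivation.map_smul, diagDer_X, smul_smul, smul_smul, smul_smul, ← sub_smul]
  have he : (ε v.1 : ℂ) * ε v.1 = ε v.1 := by exact_mod_cast hε v.1
  rcases (Nat.lt_succ_iff.1 v.2.2).eq_or_lt with h | h
  · simp [h]
  · congr 1
    have h2 : ((nextVar v).2 : ℕ) = v.2 + 1 := by simp only [nextVar]; omega
    have h3 : (nextVar v).1 = v.1 := rfl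
    have h4 : coeffWeight n ε (nextVar v) = ε v.1 * ((n v.1 : ℤ) - 2 * ((v.2 : ℕ) + 1)) := by
      rw [coeffWeight, h2, h3]; push_cast; rfl
    rw [h4, coeffWeight]
    push_cast
    linear_combination (2 : ℂ) * ((n v.1 : ℂ) - ((v.2 : ℕ) : ℂ)) * he

theorem degreeOp_raiseOp (ε δ : ι → ℕ) (p : MvPolynomial (CoeffVar n) ℂ) :
    degreeOp n ε (raiseOp n δ p) = raiseOp n δ (degreeOp n ε p) := by
  refine derivation_commute _ _ (fun v => ?_) p
  rw [degreeOp, diagDer_X, Derivation.map_smul, raiseOp_X, Derivation.map_smul, diagDer_X, smul_comm]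
  rfl

theorem degreeOp_lowerOp (ε δ : ι → ℕ) (p : MvPolynomial (CoeffVar n) ℂ) :
    degreeOp n ε (lowerOp n δ p) = lowerOp n δ (degreeOp n ε p) := by
  refine derivation_commute _ _ (fun v => ?_) p
  rw [degreeOp, diagDer_X, Derivation.map_smul, lowerOp_X, Derivation.map_smul, diagDer_X, smul_comm]
  rfl

/-- The elements of `ℂ[V]` of degree `d` and weight `μ`. -/
def weightSpace (n : ι → ℕ) (ε : ι → ℕ) (d : ℕ) (μ : ℤ) :
    Submodule ℂ (MvPolynomial (CoeffVar n) ℂ) where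
  carrier := {p | degreeOp n ε p = (d : ℂ) • p ∧ weightOp n ε p = (μ : ℂ) • p}
  add_mem' hp hq := ⟨by rw [map_add, hp.1, hq.1, smul_add], by rw [map_add, hp.2, hq.2, smul_add]⟩
  zero_mem' := by simp
  smul_mem' c p hp := ⟨by rw [Derivation.map_smul, hp.1, smul_comm], by rw [Derivation.map_smul, hp.2, smul_comm]⟩

variable {ε : ι → ℕ} (hε : ∀ i, ε i * ε i = ε i)

include hε in
theorem raiseOp_mem_weightSpace {d : ℕ} {μ : ℤ} {p : MvPolynomial (CoeffVar n) ℂ}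
    (h : p ∈ weightSpace n ε d μ) : raiseOp n ε p ∈ weightSpace n ε d (μ + 2) := by
  refine ⟨by rw [degreeOp_raiseOp, h.1, Derivation.map_smul], ?_⟩
  have := weightOp_raiseOp_sub hε p
  rw [h.2, Derivation.map_smul, sub_eq_iff_eq_add] at this
  rw [this]
  push_cast
  module

include hε in
theorem lowerOp_mem_weightSpace {d : ℕ} {μ : ℤ} {p : MvPolynomial (CoeffVar n) ℂ}
    (h : p ∈ weightSpace n ε d μ) : lowerOp n ε p ∈ weightSpace n ε d (μ - 2) := by
  refine ⟨by rw [degreeOp_lowerOp, h.1, Derivation.map_smul], ?_⟩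
  have := weightOp_lowerOp_sub hε p
  rw [h.2, Derivation.map_smul, sub_eq_iff_eq_add] at this
  rw [this]
  push_cast
  module

/-- The coefficients of a form of order `m` have weights between `-m` and `m`. At a fixed degree the
weights are thus bounded, although `ℂ[V]` is infinite dimensional. -/
theorem eq_zero_of_mem_weightSpace [Fintype ι] {d : ℕ} {μ : ℤ} {p : MvPolynomial (CoeffVar n) ℂ}
    (h : p ∈ weightSpace n ε d μ) (hμ : ((∑ i, n i) * d : ℕ) < |μ|) : p = 0 := by
  ext s
  by_contra hs
  have h1 := weight_eq_of_diagDer_eq h.1 hs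
  have h2 := weight_eq_of_diagDer_eq h.2 hs
  have e1 := weight_map (Nat.castAddMonoidHom ℂ) (fun v : CoeffVar n => ε v.1) s
  have e2 := weight_map (Int.castAddHom ℂ) (coeffWeight n ε) s
  simp only [Nat.coe_castAddMonoidHom, Int.coe_castAddHom] at e1 e2
  rw [e1] at h1
  rw [e2] at h2
  have h1' : Finsupp.weight (fun v : CoeffVar n => ε v.1) s = d := by exact_mod_cast h1
  have h2' : Finsupp.weight (coeffWeight n ε) s = μ := by exact_mod_cast h2
  rw [Finsupp.weight_apply, Finsupp.sum] at h1' h2'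
  have : |μ| ≤ ((∑ i, n i) * d : ℕ) := by
    rw [← h1', ← h2', Finset.mul_sum]
    push_cast
    refine (Finset.abs_sum_le_sum_abs _ _).trans (Finset.sum_le_sum fun v _ => ?_)
    have hn : (n v.1 : ℤ) ≤ ∑ i, (n i : ℤ) :=
      Finset.single_le_sum (f := fun i => (n i : ℤ)) (fun i _ => Int.natCast_nonneg _)
        (Finset.mem_univ v.1)
    have hv := v.2.2
    have h3 : |(n v.1 : ℤ) - 2 * (v.2 : ℕ)| ≤ ∑ i, (n i : ℤ) := by
      refine le_trans ?_ hn
      rw [abs_le]; omega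
    simp only [coeffWeight, nsmul_eq_mul, smul_eq_mul, abs_mul, Nat.abs_cast]
    calc (s v : ℤ) * (ε v.1 * |(n v.1 : ℤ) - 2 * (v.2 : ℕ)|)
        ≤ (s v : ℤ) * (ε v.1 * ∑ i, (n i : ℤ)) := by gcongr
      _ = _ := by push_cast; ring
  omega

include hε in
/-- Injectivity of powers of the raising operator on spaces of small weight. -/
theorem eq_zero_of_raiseOp_pow [Fintype ι] {d i : ℕ} {μ : ℤ} {p : MvPolynomial (CoeffVar n) ℂ}
    (hp : p ∈ weightSpace n ε d μ) (hμ : μ ≤ -i)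
    (h : (((raiseOp n ε : Derivation ℂ _ _) : Module.End ℂ (MvPolynomial (CoeffVar n) ℂ)) ^ i) p = 0) :
    p = 0 := by
  refine eq_zero_of_raise_pow_eq_zero (raiseOp n ε : Module.End ℂ (MvPolynomial (CoeffVar n) ℂ))
    (lowerOp n ε : Module.End ℂ (MvPolynomial (CoeffVar n) ℂ)) (weightSpace n ε d)
    (-((∑ i, n i) * d : ℕ)) (fun μ x hx => lowerOp_mem_weightSpace hε hx)
    (fun μ x hx => raiseOp_mem_weightSpace hε hx) (fun μ x hx => ?_) (fun μ hμ x hx => ?_) i μ hμ p hp h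
  · exact (raiseOp_lowerOp_sub hε x).trans hx.2
  · refine eq_zero_of_mem_weightSpace hx ?_
    rw [abs_of_nonpos (by omega)]
    omega

end Operators

/-! ### Covariants and highest weight vectors -/

section LeadingCoefficient

variable {τ ι : Type*} {n : ι → ℕ}

/-- The leading coefficient: the value at `x = (1, 0)`. -/
def leading : MvPolynomial (τ ⊕ Fin 2) ℂ →ₐ[ℂ] MvPolynomial τ ℂ :=
  aeval (Sum.elim X ![1, 0])

theorem leading_rename (q : MvPolynomial τ ℂ) :
    leading (rename Sum.inl q : MvPolynomial (τ ⊕ Fin 2) ℂ) = q := by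
  rw [leading, aeval_rename]
  exact aeval_X_left_apply q

theorem leading_X_zero : leading (X (Sum.inr 0) : MvPolynomial (τ ⊕ Fin 2) ℂ) = 1 := by
  simp [leading]

theorem leading_X_one : leading (X (Sum.inr 1) : MvPolynomial (τ ⊕ Fin 2) ℂ) = 0 := by
  simp [leading]

theorem pointDer_rename (e : τ → MvPolynomial τ ℂ) (N : Matrix (Fin 2) (Fin 2) ℂ)
    (q : MvPolynomial τ ℂ) :
    pointDer e N (rename Sum.inl q) = rename Sum.inl (mkDerivation ℂ e q) :=
  derivation_comp_algHom _ _ _ (fun v => by simp [mkDerivation_X]) q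

/-- The condition on `N` says that it kills the point `(1, 0)`, so restriction to this point is
compatible with the derivations. -/
theorem leading_pointDer (e : τ → MvPolynomial τ ℂ) {N : Matrix (Fin 2) (Fin 2) ℂ}
    (hN : ∀ i, N i 0 = 0) (p : MvPolynomial (τ ⊕ Fin 2) ℂ) :
    leading (pointDer e N p) = mkDerivation ℂ e (leading p) := by
  refine (derivation_comp_algHom leading (pointDer e N) (mkDerivation ℂ e) ?_ p).symm
  rintro (t | j)
  · rw [pointDer_inl, leading_rename, leading, aeval_X, Sum.elim_inl, mkDerivation_X]
  · rw [pointDer_inr, Fin.sum_univ_two, hN, zero_smul, zero_add, map_smul, leading_X_one, smul_zero]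
    fin_cases j <;> simp [leading]

theorem leading_pderiv_zero {p : MvPolynomial (τ ⊕ Fin 2) ℂ} {c : ℂ} (h : orderDer p = c • p) :
    leading (pderiv (Sum.inr 0) p) = c • leading p := by
  classical
  have h1 : orderDer p = X (Sum.inr 0) * pderiv (Sum.inr 0) p +
      X (Sum.inr 1) * pderiv (Sum.inr 1) p := by
    have : orderDer (τ := τ) = (X (Sum.inr 0) : MvPolynomial (τ ⊕ Fin 2) ℂ) • pderiv (Sum.inr 0) +
        (X (Sum.inr 1) : MvPolynomial (τ ⊕ Fin 2) ℂ) • pderiv (Sum.inr 1) := by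
      refine derivation_ext ?_
      rintro (t | j)
      · simp [orderDer, pderiv_X]
      · fin_cases j <;> simp [orderDer, pderiv_X]
    rw [this]; rfl
  rw [← map_smul, ← h, h1, map_add, map_mul, map_mul, leading_X_zero, leading_X_one, one_mul,
    zero_mul, add_zero]

theorem orderDer_pderiv {p : MvPolynomial (τ ⊕ Fin 2) ℂ} {c : ℂ} (h : orderDer p = c • p)
    (i : Fin 2) : orderDer (pderiv (Sum.inr i) p) = (c - 1) • pderiv (Sum.inr i) p := by
  classical
  have := derivation_commutator orderDer (pderiv (Sum.inr i)) ((-1 : ℂ) • pderiv (Sum.inr i)) ?_ p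
  · rw [h, Derivation.map_smul, Derivation.smul_apply, sub_eq_iff_eq_add] at this
    rw [this]; module
  rintro (t | j)
  · simp [orderDer, pderiv_X]
  · by_cases hij : j = i
    · subst hij; simp [orderDer]
    · simp [orderDer, pderiv_X, hij]

theorem raiseDer_eq : raiseDer n = pointDer (raiseCoeff fun i => (((1 : ι → ℕ) i : ℕ) : ℂ)) upperNil := by
  rw [raiseDer]
  congr 2
  funext i; simp

theorem lowerDer_eq : lowerDer n = pointDer (lowerCoeff fun i => (((1 : ι → ℕ) i : ℕ) : ℂ)) lowerNil := by
  rw [lowerDer]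
  congr 2
  funext i; simp

theorem degreeOp_one_eq : degreeOp n 1 = mkDerivation ℂ X := by
  rw [degreeOp, diagDer]
  congr 1
  funext v
  simp

theorem leading_mem {p : CoordRing n} {d k : ℕ} (h : p ∈ cov n d k) :
    raiseOp n 1 (leading p) = 0 ∧ leading p ∈ weightSpace n 1 d k := by
  obtain ⟨h1, h2, h3, h4⟩ := mem_cov_iff.1 h
  refine ⟨?_, ?_, ?_⟩
  · have := leading_pointDer (raiseCoeff fun i => (((1 : ι → ℕ) i : ℕ) : ℂ)) (N := upperNil)
      (by intro i; fin_cases i <;> simp [upperNil]) p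
    rw [← raiseDer_eq, h1, map_zero] at this
    exact this.symm
  · have := leading_pointDer (X : CoeffVar n → _) (N := 0) (by simp) p
    change leading (degreeDer _ p) = _ at this
    rw [h3, map_smul] at this
    rw [degreeOp_one_eq, ← this]
  -- `W` is the commutator of the raising and lowering operators, so it kills `p`. Adding the Euler
  -- operator cancels the weight `-1` of the variable `x`. The sum is then compatible with
  -- evaluation at `(1, 0)`, and it multiplies `p` by `k`.
  · let W : Derivation ℂ (CoordRing n) (CoordRing n) :=
      diagDer (Sum.elim (fun v => (coeffWeight n 1 v : ℂ)) ![-1, 1])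
    have hW : ∀ q, raiseDer n (lowerDer n q) - lowerDer n (raiseDer n q) = W q := by
      refine derivation_commutator _ _ _ ?_
      rintro (v | j)
      · have := raiseOp_lowerOp_sub (n := n) (ε := 1) (by simp) (X v)
        rw [raiseDer_eq, lowerDer_eq, pointDer_inl, pointDer_inl, pointDer_rename, pointDer_rename,
          ← map_sub]
        have h5 : mkDerivation ℂ (raiseCoeff fun i => (((1 : ι → ℕ) i : ℕ) : ℂ))
            (lowerCoeff (fun i => (((1 : ι → ℕ) i : ℕ) : ℂ)) v) -
            mkDerivation ℂ (lowerCoeff fun i => (((1 : ι → ℕ) i : ℕ) : ℂ))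
            (raiseCoeff (fun i => (((1 : ι → ℕ) i : ℕ) : ℂ)) v) = weightOp n 1 (X v) := by
          rw [← this, raiseOp, lowerOp, mkDerivation_X, mkDerivation_X]
        rw [h5]
        simp [W, weightOp]
      · fin_cases j <;> simp [raiseDer, lowerDer, W, upperNil, lowerNil]
    have hp : W p = 0 := by rw [← hW, h1, h2, map_zero, map_zero, sub_zero]
    have := derivation_comp_algHom leading (W + orderDer) (weightOp n 1) ?_ p
    · rw [this, Derivation.add_apply, hp, h4, zero_add, map_smul]; simp
    · rintro (v | j)
      · simp [W, orderDer, weightOp, leading]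
      · fin_cases j <;> simp [W, orderDer, weightOp, leading]

/-- The group moves every point with nonzero first coordinate to `(1, 0)`, so the value there is a
value of the leading coefficient. Multiplying `p` by the first coordinate takes care of the
remaining points. -/
theorem eq_zero_of_leading_eq_zero {p : CoordRing n} {d k : ℕ} (h : p ∈ cov n d k)
    (h0 : leading p = 0) : p = 0 := by
  have hmul : p * X (Sum.inr 0) = 0 := by
    refine eq_zero_of_evalAt fun f x => ?_
    rw [map_mul]
    by_cases hx : x 0 = 0
    · simp [evalAt, hx]
    · let g : Matrix.SpecialLinearGroup (Fin 2) ℂ := ⟨!![(x 0)⁻¹, 0; -x 1, x 0], by simp [hx]⟩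
      have hg : g.1.mulVec x = ![1, 0] := by
        ext i
        fin_cases i <;> simp [g, Matrix.mulVec, dotProduct, Fin.sum_univ_two, hx]
        ring
      have h1 := h.1 g f x
      rw [hg] at h1
      have h2 : evalAt n (fun i => actForm g (f i)) ![1, 0] p =
          aeval (fun v : CoeffVar n => formCoeff (actForm g (f v.1)) v.2) (leading p) := by
        have : evalAt n (fun i => actForm g (f i)) ![1, 0] =
            (aeval (fun v : CoeffVar n => formCoeff (actForm g (f v.1)) v.2)).comp leading := by
          refine algHom_ext ?_
          rintro (v | j)
          · simp [evalAt, leading]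
          · fin_cases j <;> simp [evalAt, leading]
        rw [this]; rfl
      rw [← h1, h2, h0, map_zero, zero_mul]
  exact (mul_eq_zero.1 hmul).resolve_right (X_ne_zero _)

theorem raiseOp_lowerOp_pow {A : MvPolynomial (CoeffVar n) ℂ} {d k : ℕ}
    (hA : raiseOp n 1 A = 0) (hw : A ∈ weightSpace n 1 d k) (i : ℕ) :
    (lowerOp n 1)^[i] A ∈ weightSpace n 1 d (k - 2 * i) ∧
    raiseOp n 1 ((lowerOp n 1)^[i + 1] A) = (((i : ℂ) + 1) * (k - i)) • (lowerOp n 1)^[i] A := by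
  induction i with
  | zero =>
    refine ⟨by simpa using hw, ?_⟩
    have := raiseOp_lowerOp_sub (n := n) (ε := 1) (by simp) A
    rw [hA, map_zero, sub_zero, hw.2] at this
    simpa using this
  | succ i ih =>
    have h1 : (lowerOp n 1)^[i + 1] A ∈ weightSpace n 1 d (k - 2 * (i + 1 : ℕ)) := by
      rw [Function.iterate_succ_apply']
      convert lowerOp_mem_weightSpace (by simp) ih.1 using 1
      push_cast; ring_nf
    refine ⟨h1, ?_⟩
    have := raiseOp_lowerOp_sub (n := n) (ε := 1) (by simp) ((lowerOp n 1)^[i + 1] A)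
    rw [ih.2, h1.2, Derivation.map_smul, ← Function.iterate_succ_apply' (lowerOp n 1),
      ← Function.iterate_succ_apply' (lowerOp n 1), sub_eq_iff_eq_add] at this
    rw [this]
    push_cast
    module

/-- Every highest weight vector is the leading coefficient of a covariant. -/
theorem exists_leading_eq [Fintype ι] {A : MvPolynomial (CoeffVar n) ℂ} {d k : ℕ}
    (hA : raiseOp n 1 A = 0) (hw : A ∈ weightSpace n 1 d k) : ∃ p ∈ cov n d k, leading p = A := by
  set F : ℕ → MvPolynomial (CoeffVar n) ℂ := fun i => (lowerOp n 1)^[i] A with hF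
  have hF0 : F 0 = A := rfl
  have hlow : ∀ i, lowerOp n 1 (F i) = F (i + 1) := fun i =>
    (Function.iterate_succ_apply' _ _ _).symm
  have hraise : ∀ i, raiseOp n 1 (F (i + 1)) = (((i : ℂ) + 1) * (k - i)) • F i := fun i =>
    (raiseOp_lowerOp_pow hA hw i).2
  -- The factor `k - i` is zero at `i = k`, so `F (k + 1)` is killed by the raising operator while
  -- having the negative weight `-k - 2`.
  have hend : F (k + 1) = 0 := by
    refine eq_zero_of_raiseOp_pow (i := 1) (ε := 1) (by simp) (raiseOp_lowerOp_pow hA hw (k + 1)).1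
      (by push_cast; omega) ?_
    rw [pow_one]
    change raiseOp n 1 (F (k + 1)) = 0
    rw [hraise]; simp
  let x : CoordRing n := X (Sum.inr 0)
  let y : CoordRing n := X (Sum.inr 1)
  -- The coefficients of `exp(-t)`: the covariant sought is formally `x^k exp(-(y/x) L) A`, with `L`
  -- the lowering operator.
  let c : ℕ → ℂ := fun i => (-1) ^ i / (i.factorial : ℂ)
  have hc : ∀ i, c (i + 1) * (i + 1) = -c i := by
    intro i
    have h1 : ((i.factorial : ℕ) : ℂ) ≠ 0 := by exact_mod_cast i.factorial_ne_zero
    have h2 : ((i : ℂ) + 1) ≠ 0 := by exact_mod_cast Nat.succ_ne_zero i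
    simp only [c, Nat.factorial_succ, pow_succ]
    push_cast
    field_simp
  let t : ℕ → CoordRing n := fun i => c i • (x ^ (k - i) * y ^ i * rename Sum.inl (F i))
  have hLr : ∀ q, lowerDer n (rename Sum.inl q) = rename Sum.inl (lowerOp n 1 q) := fun q => by
    rw [lowerDer_eq, pointDer_rename]; rfl
  have hRr : ∀ q, raiseDer n (rename Sum.inl q) = rename Sum.inl (raiseOp n 1 q) := fun q => by
    rw [raiseDer_eq, pointDer_rename]; rfl
  have hLx : lowerDer n x = 0 := by simp [x, lowerDer, lowerNil]
  have hLy : lowerDer n y = x := by simp [x, y, lowerDer, lowerNil]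
  have hRx : raiseDer n x = y := by simp [x, y, raiseDer, upperNil]
  have hRy : raiseDer n y = 0 := by simp [y, raiseDer, upperNil]
  -- The derivative of a partial sum telescopes to one boundary term. For `m = k` it contains `F (k
  -- + 1) = 0`; in the analogous raising sum it contains the factor `k - m`.
  have hlowsum : ∀ m ≤ k, lowerDer n (∑ i ∈ Finset.range (m + 1), t i) =
      c m • (x ^ (k - m) * y ^ m * rename Sum.inl (F (m + 1))) := by
    intro m
    induction m with
    | zero =>
      intro _
      simp only [t, zero_add, Finset.sum_range_one, Derivation.map_smul, Derivation.leibniz, hLr,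
        hlow, Derivation.leibniz_pow, hLx]
      simp
    | succ m ih =>
      intro hm
      rw [Finset.sum_range_succ, map_add, ih (by omega)]
      have hk : k - m = k - (m + 1) + 1 := by omega
      simp only [t, Derivation.map_smul, Derivation.leibniz, hLr, hlow, Derivation.leibniz_pow, hLx,
        hLy, smul_eq_mul, nsmul_eq_mul, hk, Nat.add_sub_cancel]
      have h3 : c m = -(c (m + 1) * (m + 1)) := by rw [hc, neg_neg]
      rw [h3]
      simp only [smul_eq_C_mul]
      push_cast
      simp only [map_neg, map_mul, map_add, map_natCast, map_one]
      ring
  have hraisesum : ∀ m ≤ k, raiseDer n (∑ i ∈ Finset.range (m + 1), t i) =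
      (c m * (k - m)) • (x ^ (k - m - 1) * y ^ (m + 1) * rename Sum.inl (F m)) := by
    intro m
    induction m with
    | zero =>
      intro _
      simp only [t, zero_add, Finset.sum_range_one, Derivation.map_smul, Derivation.leibniz, hRr,
        hF0, hA, Derivation.leibniz_pow, hRx]
      simp [smul_eq_C_mul]
      ring
    | succ m ih =>
      intro hm
      rw [Finset.sum_range_succ, map_add, ih (by omega)]
      have hk : k - m - 1 = k - (m + 1) := by omega
      simp only [t, Derivation.map_smul, Derivation.leibniz, hRr, hraise, Derivation.leibniz_pow,
        hRx, hRy, smul_eq_mul, nsmul_eq_mul, hk, map_smul]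
      have h3 : c m = -(c (m + 1) * (m + 1)) := by rw [hc, neg_neg]
      rw [h3]
      simp only [smul_eq_C_mul]
      push_cast [hm]
      simp only [map_neg, map_mul, map_add, map_sub, map_natCast, map_one]
      ring
  refine ⟨∑ i ∈ Finset.range (k + 1), t i, mem_cov_iff.2 ⟨?_, ?_, ?_, ?_⟩, ?_⟩
  · rw [hraisesum k le_rfl]; simp
  · rw [hlowsum k le_rfl, hend]; simp
  · rw [map_sum, Finset.smul_sum]
    refine Finset.sum_congr rfl fun i _ => ?_
    have h1 : degreeDer _ (rename Sum.inl (F i)) = (d : ℂ) • (rename Sum.inl (F i) : CoordRing n) := by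
      rw [degreeDer, pointDer_rename, ← degreeOp_one_eq, (raiseOp_lowerOp_pow hA hw i).1.1, map_smul]
    have hx : degreeDer _ x = 0 := by simp [x, degreeDer]
    have hy : degreeDer _ y = 0 := by simp [y, degreeDer]
    simp only [t, Derivation.map_smul, Derivation.leibniz, Derivation.leibniz_pow, h1, hx, hy]
    simp only [smul_zero, mul_zero, add_zero, smul_eq_mul, mul_smul_comm]
    rw [smul_comm]
  · rw [map_sum, Finset.smul_sum]
    refine Finset.sum_congr rfl fun i hi => ?_
    have h1 : orderDer (rename Sum.inl (F i) : CoordRing n) = 0 := by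
      have := derivation_comp_algHom (rename Sum.inl : _ →ₐ[ℂ] CoordRing n) 0 orderDer
        (fun v => by simp [orderDer]) (F i)
      simpa using this
    have hx : orderDer x = x := by simp [x, orderDer]
    have hy : orderDer y = y := by simp [y, orderDer]
    have hpow : ∀ (z : CoordRing n) (a : ℕ), orderDer z = z → orderDer (z ^ a) = (a : ℂ) • z ^ a := by
      intro z a hz
      induction a with
      | zero => simp
      | succ a ih =>
        rw [pow_succ, Derivation.leibniz, hz, ih, smul_eq_mul, smul_eq_mul, mul_smul_comm]
        push_cast
        rw [mul_comm z]
        module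
    have hi' : i ≤ k := by have := Finset.mem_range.1 hi; omega
    simp only [t, Derivation.map_smul, Derivation.leibniz, hpow x _ hx, hpow y _ hy, h1,
      smul_eq_mul]
    rw [Nat.cast_sub hi']
    simp only [smul_eq_C_mul, map_sub, map_natCast]
    ring
  · rw [map_sum, Finset.sum_eq_single 0]
    · simp only [t, map_smul, map_mul, map_pow, x, leading_X_zero, leading_rename, hF0]
      simp [c]
    · intro i _ hi
      simp only [t, map_smul, map_mul, map_pow, y, leading_X_one]
      simp [hi]
    · simp

end LeadingCoefficient

/-! ### Raising the leading coefficient of a transvectant in one argument -/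

section PartialRaising

variable {τ : Type*}

theorem leading_diagonal_X_mul (s : Fin 3) (H : ThreePoint τ) :
    leading (diagonal (X (Sum.inr (s, 1)) * H)) = 0 := by
  rw [map_mul, diagonal_X, map_mul, leading_X_one, zero_mul]

theorem slotCayley_X_mul (H : ThreePoint τ) :
    slotCayley 0 1 (X (Sum.inr (0, 1)) * H) =
      X (Sum.inr (0, 1)) * slotCayley 0 1 H - partialD 1 0 H := by
  classical
  have h : ∀ s i (G : ThreePoint τ), partialD s i (X (Sum.inr (0, 1)) * G) =
      (if s = 0 ∧ i = 1 then G else 0) + X (Sum.inr (0, 1)) * partialD s i G := by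
    intro s i G
    rw [partialD_mul, partialD_apply _ _ (X _), pderiv_X]
    congr 1
    by_cases hs : s = 0 ∧ i = 1
    · simp [hs]
    · rw [if_neg hs, Pi.single_eq_of_ne, zero_mul]
      intro h
      simp only [Sum.inr.injEq, Prod.mk.injEq] at h
      exact hs ⟨h.1.symm, h.2.symm⟩
  simp only [slotCayley_apply, h, one_ne_zero, false_and, if_false, zero_add, true_and, if_true,
    zero_ne_one]
  ring

theorem slotCayley_X_pow_mul (j : ℕ) (H : ThreePoint τ) :
    slotCayley 0 1 (X (Sum.inr (0, 1)) ^ (j + 1) * H) =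
      X (Sum.inr (0, 1)) ^ (j + 1) * slotCayley 0 1 H -
        ((j : ℂ) + 1) • (X (Sum.inr (0, 1)) ^ j * partialD 1 0 H) := by
  classical
  have hX : ∀ (j : ℕ) (G : ThreePoint τ), partialD 1 0 (X (Sum.inr (0, 1)) ^ j * G : ThreePoint τ) =
      X (Sum.inr (0, 1)) ^ j * partialD 1 0 G := by
    intro j G
    rw [partialD_mul, partialD_apply _ _ (X _ ^ j), pderiv_pow, pderiv_X_of_ne (by simp)]
    simp
  induction j with
  | zero => simp [slotCayley_X_mul]
  | succ j ih =>
    rw [pow_succ', mul_assoc, slotCayley_X_mul, ih, hX, mul_sub, mul_smul_comm, ← mul_assoc,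
      ← pow_succ', ← mul_assoc, ← pow_succ']
    push_cast
    module

theorem leading_diagonal_slotCayley_pow_of_lt (r : ℕ) {j : ℕ} (h : r < j) (H : ThreePoint τ) :
    leading (diagonal ((slotCayley 0 1 ^ r) (X (Sum.inr (0, 1)) ^ j * H))) = 0 := by
  induction r generalizing j H with
  | zero =>
    obtain ⟨j, rfl⟩ := Nat.exists_eq_succ_of_ne_zero h.ne'
    rw [pow_succ', mul_assoc]
    exact leading_diagonal_X_mul _ _
  | succ r ih =>
    obtain ⟨j, rfl⟩ := Nat.exists_eq_succ_of_ne_zero (Nat.ne_zero_of_lt h)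
    rw [pow_succ, Module.End.mul_apply, slotCayley_X_pow_mul, map_sub, map_smul, map_sub, map_smul,
      map_sub, map_smul, ih (by omega), ih (by omega), smul_zero, sub_zero]

/-- At the leading coefficient `y = 0`, so each of the `j` factors `y₀` must be consumed by one of
the `j` Cayley operators. This happens in `j!` orders, each consumption leaving `-∂/∂x₁`. -/
theorem leading_diagonal_slotCayley_pow (j : ℕ) (H : ThreePoint τ) :
    leading (diagonal ((slotCayley 0 1 ^ j) (X (Sum.inr (0, 1)) ^ j * H))) =
      ((-1) ^ j * (j.factorial : ℂ)) • leading (diagonal ((partialD 1 0 ^ j) H)) := by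
  induction j generalizing H with
  | zero => simp
  | succ j ih =>
    rw [pow_succ, Module.End.mul_apply, slotCayley_X_pow_mul, map_sub, map_smul, map_sub, map_smul,
      map_sub, map_smul, leading_diagonal_slotCayley_pow_of_lt _ (by omega), ih, zero_sub, smul_smul,
      ← neg_smul, pow_succ (partialD 1 0), Module.End.mul_apply]
    congr 1
    rw [Nat.factorial_succ]
    push_cast
    ring

theorem orderDer_pderiv_pow {p : MvPolynomial (τ ⊕ Fin 2) ℂ} {c : ℂ} (h : orderDer p = c • p)
    (j : ℕ) : orderDer (((pderiv (Sum.inr 0)).toLinearMap ^ j : Module.End ℂ _) p) =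
      (c - j) • ((pderiv (Sum.inr 0)).toLinearMap ^ j : Module.End ℂ _) p := by
  induction j with
  | zero => simp [h]
  | succ j ih =>
    rw [pow_succ', Module.End.mul_apply]
    refine (orderDer_pderiv ih 0).trans ?_
    push_cast
    rw [sub_sub]

theorem leading_pderiv_pow {p : MvPolynomial (τ ⊕ Fin 2) ℂ} {k : ℕ} (h : orderDer p = (k : ℂ) • p)
    {j : ℕ} (hj : j ≤ k) : leading (((pderiv (Sum.inr 0)).toLinearMap ^ j : Module.End ℂ _) p) =
      (k.descFactorial j : ℂ) • leading p := by
  induction j with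
  | zero => simp
  | succ j ih =>
    rw [pow_succ', Module.End.mul_apply]
    refine (leading_pderiv_zero (orderDer_pderiv_pow h j)).trans ?_
    rw [ih (by omega), smul_smul, Nat.descFactorial_succ, Nat.cast_mul, Nat.cast_sub (by omega)]

theorem pointDer_upperNil_pderiv (e : τ → MvPolynomial τ ℂ) (p : MvPolynomial (τ ⊕ Fin 2) ℂ) :
    pointDer e upperNil (pderiv (Sum.inr 0) p) = pderiv (Sum.inr 0) (pointDer e upperNil p) := by
  classical
  refine derivation_commute _ _ ?_ p
  rintro (t | j)
  · simp [pderiv_inr_rename_inl, pderiv_X]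
  · fin_cases j <;> simp [upperNil, pderiv_X]

theorem pointDer_zero_eq (e : τ → MvPolynomial τ ℂ) (p : MvPolynomial (τ ⊕ Fin 2) ℂ) :
    pointDer e 0 p = pointDer e upperNil p - X (Sum.inr 1) * pderiv (Sum.inr 0) p := by
  classical
  have : pointDer e 0 = pointDer e upperNil -
      (X (Sum.inr 1) : MvPolynomial (τ ⊕ Fin 2) ℂ) • pderiv (Sum.inr 0) := by
    refine derivation_ext ?_
    rintro (t | j)
    · simp [pderiv_X]
    · fin_cases j <;> simp [upperNil, pderiv_X]
  rw [this]; rfl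

/-- Raising the first form `j` times in the `j`-th transvectant of `A` and `B`. -/
theorem raise_pow_leading_rawTransvectant {e : τ → MvPolynomial τ ℂ}
    {A B : MvPolynomial (τ ⊕ Fin 2) ℂ} {k₁ k₂ j : ℕ} (hA : pointDer e upperNil A = 0)
    (hB : pointDer e 0 B = 0) (hA' : orderDer A = (k₁ : ℂ) • A) (hB' : orderDer B = (k₂ : ℂ) • B)
    (h₁ : j ≤ k₁) (h₂ : j ≤ k₂) :
    (((mkDerivation ℂ e : Derivation ℂ _ _) : Module.End ℂ (MvPolynomial τ ℂ)) ^ j)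
      (leading (rawTransvectant j A B)) =
      ((j.factorial : ℂ) * (k₁.descFactorial j * k₂.descFactorial j)) • (leading A * leading B) := by
  let Dx : Module.End ℂ (MvPolynomial (τ ⊕ Fin 2) ℂ) := (pderiv (Sum.inr 0)).toLinearMap
  let S : Module.End ℂ (ThreePoint τ) := (slotDer e 0).toLinearMap
  have hAi : ∀ i, pointDer e upperNil ((Dx ^ i) A) = 0 := by
    intro i
    induction i with
    | zero => exact hA
    | succ i ih =>
      rw [pow_succ', Module.End.mul_apply]
      exact (pointDer_upperNil_pderiv e _).trans (by rw [ih, map_zero])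
  -- The operator on coefficients kills `B`. On `A` it acts as `-y ∂/∂x`, because the full raising
  -- operator kills `A`; the same is true of the `x`-derivatives of `A`.
  have hS : ∀ i, (S ^ i) (place 0 A * place 1 B) =
      (-1 : ℂ) ^ i • (X (Sum.inr (0, 1)) ^ i * (place 0 ((Dx ^ i) A) * place 1 B)) := by
    intro i
    induction i with
    | zero => simp
    | succ i ih =>
      have hx : slotDer e 0 (X (Sum.inr (0, 1)) : ThreePoint τ) = 0 := by simp
      rw [pow_succ', Module.End.mul_apply, ih, map_smul]
      change _ • slotDer e 0 _ = _
      rw [Derivation.leibniz, Derivation.leibniz, Derivation.leibniz_pow, place_pointDer,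
        place_pointDer, hB, pointDer_zero_eq, hAi, hx, map_zero, zero_sub, pow_succ' Dx,
        Module.End.mul_apply, map_neg, map_mul]
      have : (place 0 (X (Sum.inr 1)) : ThreePoint τ) = X (Sum.inr (0, 1)) := by simp [place]
      rw [this]
      simp only [smul_eq_mul]
      change _ = (-1 : ℂ) ^ (i + 1) • (_ * (place 0 (pderiv (Sum.inr 0) _) * _))
      simp only [pow_succ, mul_neg, mul_one, neg_smul]
      ring_nf
      rw [smul_neg]
  have hcomm : ∀ i (G : ThreePoint τ),
      (((mkDerivation ℂ e : Derivation ℂ _ _) : Module.End ℂ (MvPolynomial τ ℂ)) ^ i)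
        (leading (diagonal ((slotCayley 0 1 ^ j) G))) =
      leading (diagonal ((slotCayley 0 1 ^ j) ((S ^ i) G))) := by
    intro i
    induction i with
    | zero => intro G; rfl
    | succ i ih =>
      intro G
      rw [pow_succ, Module.End.mul_apply, pow_succ S, Module.End.mul_apply, ← ih]
      congr 1
      change mkDerivation ℂ e _ = leading (diagonal ((slotCayley 0 1 ^ j) (slotDer e 0 G)))
      rw [slotCayley_pow_slotDer e (by simp), ← diagonal_slotDer, leading_pointDer e (by simp)]
  have hpart : ∀ i (F : MvPolynomial (τ ⊕ Fin 2) ℂ), ((partialD 1 0 ^ i) (place 0 F * place 1 B)) =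
      place 0 F * place 1 ((Dx ^ i) B) := by
    intro i F
    induction i with
    | zero => rfl
    | succ i ih =>
      rw [pow_succ', Module.End.mul_apply, ih, partialD_mul, partialD_place_self,
        partialD_place_of_ne (by decide), zero_mul, zero_add, pow_succ']
      rfl
  rw [rawTransvectant, hcomm, hS, map_smul, map_smul, map_smul, leading_diagonal_slotCayley_pow,
    hpart, map_mul, diagonal_place, diagonal_place, map_mul, leading_pderiv_pow hA' h₁,
    leading_pderiv_pow hB' h₂, smul_mul_smul_comm, smul_smul, smul_smul]
  congr 1
  -- The sign from `S ^ j` and the sign from the Cayley operators cancel.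
  rw [← mul_assoc, ← mul_assoc, ← mul_pow]
  norm_num
  ring

end PartialRaising

/-! ### Kernels on tensor products -/

section TensorKernel

open TensorProduct

variable {A A' B B' R : Type*} [AddCommGroup A] [Module ℂ A] [AddCommGroup A'] [Module ℂ A']
  [AddCommGroup B] [Module ℂ B] [AddCommGroup B'] [Module ℂ B'] [AddCommGroup R] [Module ℂ R]

/-- `1 - S T` then has image in the kernel of `T` and fixes that kernel. No finiteness is needed
over a field. -/
theorem exists_generalizedInverse (T : A →ₗ[ℂ] A') : ∃ S : A' →ₗ[ℂ] A, ∀ x, T (S (T x)) = T x := by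
  obtain ⟨s, hs⟩ := T.rangeRestrict.exists_rightInverse_of_surjective T.range_rangeRestrict
  obtain ⟨S, hS⟩ := LinearMap.exists_extend s
  refine ⟨S, fun x => ?_⟩
  have h1 : S (T x) = s (T.rangeRestrict x) := LinearMap.congr_fun hS (T.rangeRestrict x)
  have h2 := LinearMap.congr_fun hs (T.rangeRestrict x)
  rw [h1]
  exact congrArg Subtype.val h2

/-- The intersection of the kernels of `T ⊗ 1` and `1 ⊗ U` is spanned by the tensors of kernel
elements. -/
theorem mem_span_tmul_of_ker (T : A →ₗ[ℂ] A') (U : B →ₗ[ℂ] B') {z : A ⊗[ℂ] B}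
    (hT : T.rTensor B z = 0) (hU : U.lTensor A z = 0) :
    z ∈ Submodule.span ℂ {w | ∃ a b, T a = 0 ∧ U b = 0 ∧ w = a ⊗ₜ[ℂ] b} := by
  obtain ⟨S, hS⟩ := exists_generalizedInverse T
  obtain ⟨S', hS'⟩ := exists_generalizedInverse U
  have h1 : (LinearMap.id - S ∘ₗ T).rTensor B z = z := by
    rw [LinearMap.rTensor_sub, LinearMap.rTensor_comp, LinearMap.sub_apply, LinearMap.comp_apply, hT]
    simp
  have h2 : (LinearMap.id - S' ∘ₗ U).lTensor A z = z := by
    rw [LinearMap.lTensor_sub, LinearMap.lTensor_comp, LinearMap.sub_apply, LinearMap.comp_apply, hU]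
    simp
  have h3 : ∀ y : A ⊗[ℂ] B, (LinearMap.id - S ∘ₗ T).rTensor B ((LinearMap.id - S' ∘ₗ U).lTensor A y) ∈
      Submodule.span ℂ {w | ∃ a b, T a = 0 ∧ U b = 0 ∧ w = a ⊗ₜ[ℂ] b} := by
    intro y
    induction y with
    | zero => simp
    | add x y hx hy => rw [map_add, map_add]; exact Submodule.add_mem _ hx hy
    | tmul a b =>
      rw [LinearMap.lTensor_tmul, LinearMap.rTensor_tmul]
      refine Submodule.subset_span ⟨_, _, ?_, ?_, rfl⟩ <;> simp [hS, hS']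
  rw [← h1, ← h2]
  exact h3 z

/-- Finitely many operators on each factor are packed into one map to a product space, which reduces
to a single pair of maps. -/
theorem mem_span_of_commonKernel {κ : Type*} [Fintype κ] [DecidableEq κ] (e : A ⊗[ℂ] B ≃ₗ[ℂ] R)
    {E : κ → Module.End ℂ A} {F : κ → Module.End ℂ B} {E' F' : κ → Module.End ℂ R}
    (hE : ∀ i a b, E' i (e (a ⊗ₜ b)) = e (E i a ⊗ₜ b))
    (hF : ∀ i a b, F' i (e (a ⊗ₜ b)) = e (a ⊗ₜ F i b)) {z : R} (h₁ : ∀ i, E' i z = 0)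
    (h₂ : ∀ i, F' i z = 0) :
    z ∈ Submodule.span ℂ {w | ∃ a b, (∀ i, E i a = 0) ∧ (∀ i, F i b = 0) ∧ w = e (a ⊗ₜ[ℂ] b)} := by
  obtain ⟨y, rfl⟩ := e.surjective z
  have hE' : ∀ i, (E i).rTensor B y = 0 := by
    intro i
    have : E' i ∘ₗ e.toLinearMap = e.toLinearMap ∘ₗ (E i).rTensor B := TensorProduct.ext' (hE i)
    refine e.injective ?_
    rw [map_zero, ← h₁ i]
    exact (LinearMap.congr_fun this y).symm
  have hF' : ∀ i, (F i).lTensor A y = 0 := by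
    intro i
    have : F' i ∘ₗ e.toLinearMap = e.toLinearMap ∘ₗ (F i).lTensor A := TensorProduct.ext' (hF i)
    refine e.injective ?_
    rw [map_zero, ← h₂ i]
    exact (LinearMap.congr_fun this y).symm
  have hpiE : (LinearMap.pi E).rTensor B y = 0 := by
    have : LinearMap.pi E = ∑ i, LinearMap.single ℂ (fun _ => A) i ∘ₗ E i := by
      ext a i
      simp [LinearMap.sum_apply, Finset.sum_apply, Pi.single_apply]
    rw [this, ← LinearMap.coe_rTensorHom, map_sum, LinearMap.sum_apply]
    refine Finset.sum_eq_zero fun i _ => ?_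
    rw [LinearMap.coe_rTensorHom, LinearMap.rTensor_comp, LinearMap.comp_apply, hE', map_zero]
  have hpiF : (LinearMap.pi F).lTensor A y = 0 := by
    have : LinearMap.pi F = ∑ i, LinearMap.single ℂ (fun _ => B) i ∘ₗ F i := by
      ext a i
      simp [LinearMap.sum_apply, Finset.sum_apply, Pi.single_apply]
    rw [this, ← LinearMap.coe_lTensorHom, map_sum, LinearMap.sum_apply]
    refine Finset.sum_eq_zero fun i _ => ?_
    rw [LinearMap.coe_lTensorHom, LinearMap.lTensor_comp, LinearMap.comp_apply, hF', map_zero]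
  have := Submodule.mem_map_of_mem (f := e.toLinearMap) (mem_span_tmul_of_ker _ _ hpiE hpiF)
  rw [Submodule.map_span] at this
  refine Submodule.span_mono ?_ this
  rintro _ ⟨_, ⟨a, b, ha, hb, rfl⟩, rfl⟩
  exact ⟨a, b, fun i => congrFun ha i, fun i => congrFun hb i, rfl⟩

end TensorKernel

/-! ### Compatibility of the operators with maps of index sets -/

section Embeddings

variable {ι ι' : Type*}

/-- The map `ℂ[⨁ i, S_{n' (φ i)}] → ℂ[⨁ i, S_{n' i}]` induced by `φ`. -/
def coeffMap (φ : ι → ι') (n' : ι' → ℕ) :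
    MvPolynomial (CoeffVar fun i => n' (φ i)) ℂ →ₐ[ℂ] MvPolynomial (CoeffVar n') ℂ :=
  rename fun v : CoeffVar fun i => n' (φ i) => (⟨φ v.1, v.2⟩ : CoeffVar n')

variable (φ : ι → ι') (n' : ι' → ℕ) (ε : ι' → ℕ)

theorem raiseOp_coeffMap (p) :
    raiseOp n' ε (coeffMap φ n' p) = coeffMap φ n' (raiseOp _ (fun i => ε (φ i)) p) := by
  refine derivation_comp_algHom _ _ _ (fun v => ?_) p
  simp [raiseOp_X, coeffMap, prevVar]

theorem degreeOp_coeffMap (p) :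
    degreeOp n' ε (coeffMap φ n' p) = coeffMap φ n' (degreeOp _ (fun i => ε (φ i)) p) := by
  refine derivation_comp_algHom _ _ _ (fun v => ?_) p
  simp [degreeOp, coeffMap]

theorem weightOp_coeffMap (p) :
    weightOp n' ε (coeffMap φ n' p) = coeffMap φ n' (weightOp _ (fun i => ε (φ i)) p) := by
  refine derivation_comp_algHom _ _ _ (fun v => ?_) p
  simp [weightOp, coeffMap, coeffWeight]

theorem raiseOp_zero (n : ι → ℕ) : raiseOp n 0 = 0 := by
  refine derivation_ext fun v => ?_
  simp [raiseOp_X]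

theorem degreeOp_zero (n : ι → ℕ) : degreeOp n 0 = 0 := by
  refine derivation_ext fun v => ?_
  simp [degreeOp]

theorem weightOp_zero (n : ι → ℕ) : weightOp n 0 = 0 := by
  refine derivation_ext fun v => ?_
  simp [weightOp, coeffWeight]

theorem leading_reindex (p : CoordRing fun i => n' (φ i)) :
    leading (reindex φ n' p) = coeffMap φ n' (leading p) := by
  have : leading.comp (reindex φ n') = (coeffMap φ n').comp leading := by
    refine algHom_ext ?_
    rintro (v | j)
    · simp [reindex, renameParam, leading, coeffMap]
    · fin_cases j <;> simp [reindex, renameParam, leading, coeffMap]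
  exact congr($this p)

end Embeddings

/-! ### The tensor decomposition of `ℂ[V₁ ⊕ V₂]` and its highest weight vectors -/

section DirectSum

open TensorProduct

variable {ι₁ ι₂ : Type*} (n₁ : ι₁ → ℕ) (n₂ : ι₂ → ℕ)

/-- `ℂ[V₁] → ℂ[V₁ ⊕ V₂]`. -/
def coeffLeft : MvPolynomial (CoeffVar n₁) ℂ →ₐ[ℂ] MvPolynomial (CoeffVar (Sum.elim n₁ n₂)) ℂ :=
  coeffMap Sum.inl (Sum.elim n₁ n₂)

/-- `ℂ[V₂] → ℂ[V₁ ⊕ V₂]`. -/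
def coeffRight : MvPolynomial (CoeffVar n₂) ℂ →ₐ[ℂ] MvPolynomial (CoeffVar (Sum.elim n₁ n₂)) ℂ :=
  coeffMap Sum.inr (Sum.elim n₁ n₂)

/-- `ℂ[V₁] ⊗ ℂ[V₂] ≃ ℂ[V₁ ⊕ V₂]`. -/
def tensorCoeffEquiv : MvPolynomial (CoeffVar n₁) ℂ ⊗[ℂ] MvPolynomial (CoeffVar n₂) ℂ ≃ₐ[ℂ]
    MvPolynomial (CoeffVar (Sum.elim n₁ n₂)) ℂ :=
  (tensorEquivSum ℂ (CoeffVar n₁) (CoeffVar n₂) ℂ).trans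
    (renameEquiv ℂ (Equiv.sumSigmaDistrib fun i => Fin (Sum.elim n₁ n₂ i + 1)).symm)

theorem tensorCoeffEquiv_tmul (a : MvPolynomial (CoeffVar n₁) ℂ) (b : MvPolynomial (CoeffVar n₂) ℂ) :
    tensorCoeffEquiv n₁ n₂ (a ⊗ₜ b) = coeffLeft n₁ n₂ a * coeffRight n₁ n₂ b := by
  have h1 : (tensorCoeffEquiv n₁ n₂).toAlgHom.comp Algebra.TensorProduct.includeLeft =
      coeffLeft n₁ n₂ := by
    refine algHom_ext fun v => ?_
    simp [tensorCoeffEquiv, coeffLeft, coeffMap]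
    rfl
  have h2 : (tensorCoeffEquiv n₁ n₂).toAlgHom.comp Algebra.TensorProduct.includeRight =
      coeffRight n₁ n₂ := by
    refine algHom_ext fun v => ?_
    simp [tensorCoeffEquiv, coeffRight, coeffMap]
    rfl
  rw [← h1, ← h2]
  simp [← map_mul]

theorem raiseOp_coeffLeft (ε₁ : ι₁ → ℕ) (ε₂ : ι₂ → ℕ) (a) :
    raiseOp (Sum.elim n₁ n₂) (Sum.elim ε₁ ε₂) (coeffLeft n₁ n₂ a) =
      coeffLeft n₁ n₂ (raiseOp n₁ ε₁ a) :=
  raiseOp_coeffMap Sum.inl (Sum.elim n₁ n₂) (Sum.elim ε₁ ε₂) a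

theorem raiseOp_coeffRight (ε₁ : ι₁ → ℕ) (ε₂ : ι₂ → ℕ) (a) :
    raiseOp (Sum.elim n₁ n₂) (Sum.elim ε₁ ε₂) (coeffRight n₁ n₂ a) =
      coeffRight n₁ n₂ (raiseOp n₂ ε₂ a) :=
  raiseOp_coeffMap Sum.inr (Sum.elim n₁ n₂) (Sum.elim ε₁ ε₂) a

theorem degreeOp_coeffLeft (ε₁ : ι₁ → ℕ) (ε₂ : ι₂ → ℕ) (a) :
    degreeOp (Sum.elim n₁ n₂) (Sum.elim ε₁ ε₂) (coeffLeft n₁ n₂ a) =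
      coeffLeft n₁ n₂ (degreeOp n₁ ε₁ a) :=
  degreeOp_coeffMap Sum.inl (Sum.elim n₁ n₂) (Sum.elim ε₁ ε₂) a

theorem degreeOp_coeffRight (ε₁ : ι₁ → ℕ) (ε₂ : ι₂ → ℕ) (a) :
    degreeOp (Sum.elim n₁ n₂) (Sum.elim ε₁ ε₂) (coeffRight n₁ n₂ a) =
      coeffRight n₁ n₂ (degreeOp n₂ ε₂ a) :=
  degreeOp_coeffMap Sum.inr (Sum.elim n₁ n₂) (Sum.elim ε₁ ε₂) a

theorem weightOp_coeffLeft (ε₁ : ι₁ → ℕ) (ε₂ : ι₂ → ℕ) (a) :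
    weightOp (Sum.elim n₁ n₂) (Sum.elim ε₁ ε₂) (coeffLeft n₁ n₂ a) =
      coeffLeft n₁ n₂ (weightOp n₁ ε₁ a) :=
  weightOp_coeffMap Sum.inl (Sum.elim n₁ n₂) (Sum.elim ε₁ ε₂) a

theorem weightOp_coeffRight (ε₁ : ι₁ → ℕ) (ε₂ : ι₂ → ℕ) (a) :
    weightOp (Sum.elim n₁ n₂) (Sum.elim ε₁ ε₂) (coeffRight n₁ n₂ a) =
      coeffRight n₁ n₂ (weightOp n₂ ε₂ a) :=
  weightOp_coeffMap Sum.inr (Sum.elim n₁ n₂) (Sum.elim ε₁ ε₂) a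

/-- The eigenvalue `c` lets one computation serve for the raising operator (`c = 0`), the degree and
the weight. -/
theorem derivation_coeffLeft_mul_coeffRight
    {D₁ : Derivation ℂ (MvPolynomial (CoeffVar n₁) ℂ) (MvPolynomial (CoeffVar n₁) ℂ)}
    {D : Derivation ℂ (MvPolynomial (CoeffVar (Sum.elim n₁ n₂)) ℂ)
      (MvPolynomial (CoeffVar (Sum.elim n₁ n₂)) ℂ)}
    (h₁ : ∀ a, D (coeffLeft n₁ n₂ a) = coeffLeft n₁ n₂ (D₁ a))
    (h₂ : ∀ b, D (coeffRight n₁ n₂ b) = 0) (c : ℂ) (a b) :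
    D (coeffLeft n₁ n₂ a * coeffRight n₁ n₂ b) - c • (coeffLeft n₁ n₂ a * coeffRight n₁ n₂ b) =
      coeffLeft n₁ n₂ (D₁ a - c • a) * coeffRight n₁ n₂ b := by
  rw [Derivation.leibniz, h₁, h₂, smul_zero, zero_add, map_sub, map_smul, sub_mul, smul_mul_assoc,
    smul_eq_mul, mul_comm (coeffRight n₁ n₂ b)]

theorem derivation_coeffLeft_mul_coeffRight'
    {D₂ : Derivation ℂ (MvPolynomial (CoeffVar n₂) ℂ) (MvPolynomial (CoeffVar n₂) ℂ)}
    {D : Derivation ℂ (MvPolynomial (CoeffVar (Sum.elim n₁ n₂)) ℂ)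
      (MvPolynomial (CoeffVar (Sum.elim n₁ n₂)) ℂ)}
    (h₁ : ∀ a, D (coeffLeft n₁ n₂ a) = 0)
    (h₂ : ∀ b, D (coeffRight n₁ n₂ b) = coeffRight n₁ n₂ (D₂ b)) (c : ℂ) (a b) :
    D (coeffLeft n₁ n₂ a * coeffRight n₁ n₂ b) - c • (coeffLeft n₁ n₂ a * coeffRight n₁ n₂ b) =
      coeffLeft n₁ n₂ a * coeffRight n₁ n₂ (D₂ b - c • b) := by
  rw [Derivation.leibniz, h₁, h₂, smul_zero, add_zero, map_sub, map_smul, mul_sub, mul_smul_comm,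
    smul_eq_mul]

/-- The operators whose common kernel consists of the highest weight vectors of degree `d` and
weight `μ`. -/
def highestWeightOps {ι : Type*} (n ε : ι → ℕ) (d : ℕ) (μ : ℤ) :
    Fin 3 → Module.End ℂ (MvPolynomial (CoeffVar n) ℂ) :=
  ![(raiseOp n ε).toLinearMap - (0 : ℂ) • 1, (degreeOp n ε).toLinearMap - (d : ℂ) • 1,
    (weightOp n ε).toLinearMap - (μ : ℂ) • 1]

theorem highestWeightOps_eq_zero_iff {ι : Type*} {n ε : ι → ℕ} {d : ℕ} {μ : ℤ}
    {p : MvPolynomial (CoeffVar n) ℂ} : (∀ i, highestWeightOps n ε d μ i p = 0) ↔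
      raiseOp n ε p = 0 ∧ p ∈ weightSpace n ε d μ := by
  rw [Fin.forall_fin_succ, Fin.forall_fin_two]
  simp only [highestWeightOps, zero_smul, sub_zero]
  exact Iff.and Iff.rfl (Iff.and sub_eq_zero sub_eq_zero)

theorem highestWeightOps_mul_left (d : ℕ) (μ : ℤ) (i : Fin 3) (a b) :
    highestWeightOps (Sum.elim n₁ n₂) (Sum.elim 1 0) d μ i (coeffLeft n₁ n₂ a * coeffRight n₁ n₂ b) =
      coeffLeft n₁ n₂ (highestWeightOps n₁ 1 d μ i a) * coeffRight n₁ n₂ b := by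
  fin_cases i
  · exact derivation_coeffLeft_mul_coeffRight n₁ n₂ (raiseOp_coeffLeft n₁ n₂ _ _)
      (fun b => by rw [raiseOp_coeffRight, raiseOp_zero, Derivation.zero_apply, map_zero]) 0 a b
  · exact derivation_coeffLeft_mul_coeffRight n₁ n₂ (degreeOp_coeffLeft n₁ n₂ _ _)
      (fun b => by rw [degreeOp_coeffRight, degreeOp_zero, Derivation.zero_apply, map_zero]) d a b
  · exact derivation_coeffLeft_mul_coeffRight n₁ n₂ (weightOp_coeffLeft n₁ n₂ _ _)
      (fun b => by rw [weightOp_coeffRight, weightOp_zero, Derivation.zero_apply, map_zero]) μ a b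

theorem highestWeightOps_mul_right (d : ℕ) (μ : ℤ) (i : Fin 3) (a b) :
    highestWeightOps (Sum.elim n₁ n₂) (Sum.elim 0 1) d μ i (coeffLeft n₁ n₂ a * coeffRight n₁ n₂ b) =
      coeffLeft n₁ n₂ a * coeffRight n₁ n₂ (highestWeightOps n₂ 1 d μ i b) := by
  fin_cases i
  · exact derivation_coeffLeft_mul_coeffRight' n₁ n₂ (fun b => by rw [raiseOp_coeffLeft, raiseOp_zero, Derivation.zero_apply, map_zero])
      (raiseOp_coeffRight n₁ n₂ _ _) 0 a b
  · exact derivation_coeffLeft_mul_coeffRight' n₁ n₂ (fun b => by rw [degreeOp_coeffLeft, degreeOp_zero, Derivation.zero_apply, map_zero])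
      (degreeOp_coeffRight n₁ n₂ _ _) d a b
  · exact derivation_coeffLeft_mul_coeffRight' n₁ n₂ (fun b => by rw [weightOp_coeffLeft, weightOp_zero, Derivation.zero_apply, map_zero])
      (weightOp_coeffRight n₁ n₂ _ _) μ a b

/-- The elements of `ℂ[V₁ ⊕ V₂]` killed by both raising operators come from those of `ℂ[V₁]` and
`ℂ[V₂]`. -/
theorem mem_span_of_raiseOp_eq_zero {d₁ d₂ : ℕ} {μ₁ μ₂ : ℤ}
    {z : MvPolynomial (CoeffVar (Sum.elim n₁ n₂)) ℂ}
    (h₁ : raiseOp (Sum.elim n₁ n₂) (Sum.elim 1 0) z = 0)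
    (h₂ : raiseOp (Sum.elim n₁ n₂) (Sum.elim 0 1) z = 0)
    (hw₁ : z ∈ weightSpace (Sum.elim n₁ n₂) (Sum.elim 1 0) d₁ μ₁)
    (hw₂ : z ∈ weightSpace (Sum.elim n₁ n₂) (Sum.elim 0 1) d₂ μ₂) :
    z ∈ Submodule.span ℂ {w | ∃ a b, (raiseOp n₁ 1 a = 0 ∧ a ∈ weightSpace n₁ 1 d₁ μ₁) ∧
      (raiseOp n₂ 1 b = 0 ∧ b ∈ weightSpace n₂ 1 d₂ μ₂) ∧
      w = coeffLeft n₁ n₂ a * coeffRight n₁ n₂ b} := by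
  have := mem_span_of_commonKernel (tensorCoeffEquiv n₁ n₂).toLinearEquiv (E := highestWeightOps n₁ 1 d₁ μ₁)
    (F := highestWeightOps n₂ 1 d₂ μ₂) (E' := highestWeightOps (Sum.elim n₁ n₂) (Sum.elim 1 0) d₁ μ₁)
    (F' := highestWeightOps (Sum.elim n₁ n₂) (Sum.elim 0 1) d₂ μ₂) ?_ ?_ (z := z) (highestWeightOps_eq_zero_iff.2 ⟨h₁, hw₁⟩)
    (highestWeightOps_eq_zero_iff.2 ⟨h₂, hw₂⟩)
  · refine Submodule.span_mono ?_ this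
    rintro w ⟨a, b, ha, hb, rfl⟩
    exact ⟨a, b, highestWeightOps_eq_zero_iff.1 ha, highestWeightOps_eq_zero_iff.1 hb, tensorCoeffEquiv_tmul _ _ _ _⟩
  · intro i a b
    exact (congrArg _ (tensorCoeffEquiv_tmul _ _ _ _)).trans ((highestWeightOps_mul_left _ _ _ _ i a b).trans
      (tensorCoeffEquiv_tmul _ _ _ _).symm)
  · intro i a b
    exact (congrArg _ (tensorCoeffEquiv_tmul _ _ _ _)).trans ((highestWeightOps_mul_right _ _ _ _ i a b).trans
      (tensorCoeffEquiv_tmul _ _ _ _).symm)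

end DirectSum

/-! ### Homogeneous components under derivations -/

section WeightComponents

variable {σ M : Type*} [AddCancelCommMonoid M] {w : σ → M}

/-- Cancellation makes the shift by `δ` injective, so the component `m + δ` of `D p` receives
contributions only from the component `m` of `p`. -/
theorem weightedHomogeneousComponent_derivation (δ : M)
    (D : Derivation ℂ (MvPolynomial σ ℂ) (MvPolynomial σ ℂ))
    (hD : ∀ v, IsWeightedHomogeneous w (D (X v)) (w v + δ)) (m : M) (p : MvPolynomial σ ℂ) :
    weightedHomogeneousComponent w (m + δ) (D p) = D (weightedHomogeneousComponent w m p) := by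
  classical
  have hmon : ∀ s c, IsWeightedHomogeneous w (monomial s c : MvPolynomial σ ℂ) (Finsupp.weight w s) :=
    fun s c => isWeightedHomogeneous_monomial w s c rfl
  rw [as_sum p]
  simp only [map_sum]
  refine Finset.sum_congr rfl fun s _ => ?_
  have h2 := isWeightedHomogeneous_derivation δ D hD (hmon s (coeff s p))
  by_cases h : Finsupp.weight w s = m
  · rw [← h, h2.weightedHomogeneousComponent_same, (hmon _ _).weightedHomogeneousComponent_same]
  · rw [h2.weightedHomogeneousComponent_ne _ (fun h' => h (add_right_cancel h').symm),
      (hmon _ _).weightedHomogeneousComponent_ne _ (Ne.symm h), map_zero]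

theorem weightedHomogeneousComponent_derivation_pow (δ : M)
    (D : Derivation ℂ (MvPolynomial σ ℂ) (MvPolynomial σ ℂ))
    (hD : ∀ v, IsWeightedHomogeneous w (D (X v)) (w v + δ)) (j : ℕ) (m : M) (p : MvPolynomial σ ℂ) :
    weightedHomogeneousComponent w (m + j • δ) (((D : Module.End ℂ (MvPolynomial σ ℂ)) ^ j) p) =
      ((D : Module.End ℂ (MvPolynomial σ ℂ)) ^ j) (weightedHomogeneousComponent w m p) := by
  induction j with
  | zero => simp
  | succ j ih =>
    rw [pow_succ', Module.End.mul_apply, Module.End.mul_apply, ← ih, succ_nsmul, ← add_assoc]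
    exact weightedHomogeneousComponent_derivation δ D hD _ _

end WeightComponents

/-! ### The multigrading of `ℂ[V₁ ⊕ V₂]` and the two partial raising operators -/

section DirectSum

variable {ι₁ ι₂ : Type*} (n₁ : ι₁ → ℕ) (n₂ : ι₂ → ℕ)

/-- The multidegree on `ℂ[V₁ ⊕ V₂]`: degrees and weights in the coefficients of `V₁` and `V₂`. -/
def doubleWeight (v : CoeffVar (Sum.elim n₁ n₂)) : (ℕ × ℤ) × (ℕ × ℤ) :=
  (((Sum.elim 1 0 : ι₁ ⊕ ι₂ → ℕ) v.1, coeffWeight (Sum.elim n₁ n₂) (Sum.elim 1 0) v),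
    ((Sum.elim 0 1 : ι₁ ⊕ ι₂ → ℕ) v.1, coeffWeight (Sum.elim n₁ n₂) (Sum.elim 0 1) v))

variable {n₁ n₂}

theorem mem_weightSpace_of_doubleWeight {p : MvPolynomial (CoeffVar (Sum.elim n₁ n₂)) ℂ}
    {I : (ℕ × ℤ) × (ℕ × ℤ)} (h : IsWeightedHomogeneous (doubleWeight n₁ n₂) p I) :
    p ∈ weightSpace (Sum.elim n₁ n₂) (Sum.elim 1 0) I.1.1 I.1.2 ∧
      p ∈ weightSpace (Sum.elim n₁ n₂) (Sum.elim 0 1) I.2.1 I.2.2 := by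
  have key : ∀ (θ : (ℕ × ℤ) × (ℕ × ℤ) →+ ℂ) (w' : CoeffVar (Sum.elim n₁ n₂) → ℂ) (c : ℂ),
      (∀ v, θ (doubleWeight n₁ n₂ v) = w' v) → θ I = c → diagDer w' p = c • p := by
    intro θ w' c hw hc
    obtain rfl : (fun v => θ (doubleWeight n₁ n₂ v)) = w' := funext hw
    exact hc ▸ diagDer_eq_iff.2 (isWeightedHomogeneous_map_weight θ h)
  exact ⟨⟨key ((Nat.castAddMonoidHom ℂ).comp
      ((AddMonoidHom.fst _ _).comp (AddMonoidHom.fst _ _))) _ _ (fun _ => rfl) rfl,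
    key ((Int.castAddHom ℂ).comp
      ((AddMonoidHom.snd _ _).comp (AddMonoidHom.fst _ _))) _ _ (fun _ => rfl) rfl⟩,
    key ((Nat.castAddMonoidHom ℂ).comp
      ((AddMonoidHom.fst _ _).comp (AddMonoidHom.snd _ _))) _ _ (fun _ => rfl) rfl,
    key ((Int.castAddHom ℂ).comp
      ((AddMonoidHom.snd _ _).comp (AddMonoidHom.snd _ _))) _ _ (fun _ => rfl) rfl⟩

theorem doubleWeight_raiseOp_left (v : CoeffVar (Sum.elim n₁ n₂)) :
    IsWeightedHomogeneous (doubleWeight n₁ n₂)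
      (raiseOp (Sum.elim n₁ n₂) (Sum.elim 1 0) (X v)) (doubleWeight n₁ n₂ v + ((0, 2), (0, 0))) := by
  rw [raiseOp_X]
  rcases v with ⟨i | i, k⟩
  · rcases Nat.eq_zero_or_pos (k : ℕ) with h | h
    · simp [h, isWeightedHomogeneous_zero]
    · refine (weightedHomogeneousSubmodule ℂ _ _).smul_mem _ ?_
      have : doubleWeight n₁ n₂ (prevVar ⟨Sum.inl i, k⟩) =
          doubleWeight n₁ n₂ ⟨Sum.inl i, k⟩ + ((0, 2), (0, 0)) := by
        simp only [doubleWeight, coeffWeight, prevVar]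
        push_cast [h]
        simp
        ring
      rw [← this]
      exact isWeightedHomogeneous_X _ _ _
  · simp [isWeightedHomogeneous_zero]

theorem doubleWeight_raiseOp_right (v : CoeffVar (Sum.elim n₁ n₂)) :
    IsWeightedHomogeneous (doubleWeight n₁ n₂)
      (raiseOp (Sum.elim n₁ n₂) (Sum.elim 0 1) (X v)) (doubleWeight n₁ n₂ v + ((0, 0), (0, 2))) := by
  rw [raiseOp_X]
  rcases v with ⟨i | i, k⟩
  · simp [isWeightedHomogeneous_zero]
  · rcases Nat.eq_zero_or_pos (k : ℕ) with h | h
    · simp [h, isWeightedHomogeneous_zero]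
    · refine (weightedHomogeneousSubmodule ℂ _ _).smul_mem _ ?_
      have : doubleWeight n₁ n₂ (prevVar ⟨Sum.inr i, k⟩) =
          doubleWeight n₁ n₂ ⟨Sum.inr i, k⟩ + ((0, 0), (0, 2)) := by
        simp only [doubleWeight, coeffWeight, prevVar]
        push_cast [h]
        simp
        ring
      rw [← this]
      exact isWeightedHomogeneous_X _ _ _

theorem raiseOp_one_eq (p) : raiseOp (Sum.elim n₁ n₂) 1 p =
    raiseOp (Sum.elim n₁ n₂) (Sum.elim 1 0) p + raiseOp (Sum.elim n₁ n₂) (Sum.elim 0 1) p := by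
  have : raiseOp (Sum.elim n₁ n₂) 1 =
      raiseOp (Sum.elim n₁ n₂) (Sum.elim 1 0) + raiseOp (Sum.elim n₁ n₂) (Sum.elim 0 1) := by
    refine derivation_ext ?_
    rintro ⟨i | i, k⟩ <;> simp [raiseOp_X]
  rw [this]; rfl

theorem degreeOp_one_eq_add (p) : degreeOp (Sum.elim n₁ n₂) 1 p =
    degreeOp (Sum.elim n₁ n₂) (Sum.elim 1 0) p + degreeOp (Sum.elim n₁ n₂) (Sum.elim 0 1) p := by
  have : degreeOp (Sum.elim n₁ n₂) 1 =
      degreeOp (Sum.elim n₁ n₂) (Sum.elim 1 0) + degreeOp (Sum.elim n₁ n₂) (Sum.elim 0 1) := by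
    refine derivation_ext ?_
    rintro ⟨i | i, k⟩ <;> simp [degreeOp]
  rw [this]; rfl

theorem weightOp_one_eq_add (p) : weightOp (Sum.elim n₁ n₂) 1 p =
    weightOp (Sum.elim n₁ n₂) (Sum.elim 1 0) p + weightOp (Sum.elim n₁ n₂) (Sum.elim 0 1) p := by
  have : weightOp (Sum.elim n₁ n₂) 1 =
      weightOp (Sum.elim n₁ n₂) (Sum.elim 1 0) + weightOp (Sum.elim n₁ n₂) (Sum.elim 0 1) := by
    refine derivation_ext ?_
    rintro ⟨i | i, k⟩ <;> simp [weightOp, coeffWeight]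
  rw [this]; rfl

theorem raiseOp_commute (p) :
    raiseOp (Sum.elim n₁ n₂) (Sum.elim 1 0) (raiseOp (Sum.elim n₁ n₂) (Sum.elim 0 1) p) =
      raiseOp (Sum.elim n₁ n₂) (Sum.elim 0 1) (raiseOp (Sum.elim n₁ n₂) (Sum.elim 1 0) p) := by
  refine derivation_commute _ _ ?_ p
  rintro ⟨i | i, k⟩ <;> simp [raiseOp_X, prevVar]

theorem raiseOp_left_mem_weightSpace {d : ℕ} {μ : ℤ}
    {p : MvPolynomial (CoeffVar (Sum.elim n₁ n₂)) ℂ}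
    (h : p ∈ weightSpace (Sum.elim n₁ n₂) 1 d μ) :
    raiseOp (Sum.elim n₁ n₂) (Sum.elim 1 0) p ∈ weightSpace (Sum.elim n₁ n₂) 1 d (μ + 2) := by
  refine ⟨by rw [degreeOp_raiseOp, h.1, Derivation.map_smul], ?_⟩
  have h1 := weightOp_raiseOp_sub (n := Sum.elim n₁ n₂) (ε := Sum.elim 1 0)
    (by rintro (i | i) <;> rfl) p
  have h2 : weightOp (Sum.elim n₁ n₂) (Sum.elim 0 1) (raiseOp (Sum.elim n₁ n₂) (Sum.elim 1 0) p) =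
      raiseOp (Sum.elim n₁ n₂) (Sum.elim 1 0) (weightOp (Sum.elim n₁ n₂) (Sum.elim 0 1) p) := by
    refine derivation_commute _ _ ?_ p
    rintro ⟨i | i, k⟩ <;> simp [raiseOp_X, prevVar, weightOp, coeffWeight]
  have h3 := h.2
  rw [weightOp_one_eq_add] at h3
  rw [weightOp_one_eq_add, h2, sub_eq_iff_eq_add.1 h1, add_assoc, ← map_add, h3,
    Derivation.map_smul]
  push_cast
  module

end DirectSum

/-! ### Transvectants span the covariants of a direct sum -/

section Spanning

variable {ι₁ ι₂ : Type*} (n₁ : ι₁ → ℕ) (n₂ : ι₂ → ℕ)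

/-- The transvectants, of degree `d` and order `k`, of covariants of `V₁` and of `V₂`. -/
def transvectantSet (d k : ℕ) : Set (CoordRing (Sum.elim n₁ n₂)) :=
  {p | ∃ d₁ k₁ d₂ k₂ r A B, A ∈ cov n₁ d₁ k₁ ∧ B ∈ cov n₂ d₂ k₂ ∧ d₁ + d₂ = d ∧
    k₁ + k₂ = k + 2 * r ∧ r ≤ k₁ ∧ r ≤ k₂ ∧
    p = rawTransvectant r (inclLeft n₁ n₂ A) (inclRight n₁ n₂ B)}

variable {n₁ n₂}

theorem mem_cov_of_mem_transvectantSet {d k : ℕ} {p : CoordRing (Sum.elim n₁ n₂)}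
    (h : p ∈ transvectantSet n₁ n₂ d k) : p ∈ cov (Sum.elim n₁ n₂) d k := by
  obtain ⟨d₁, k₁, d₂, k₂, r, A, B, hA, hB, rfl, hk, -, -, rfl⟩ := h
  exact rawTransvectant_mem_cov (inclLeft_mem_cov hA) (inclRight_mem_cov hB) hk.symm

theorem raiseOp_pow_leading_rawTransvectant {d₁ k₁ d₂ k₂ j : ℕ} {A : CoordRing n₁}
    {B : CoordRing n₂} (hA : A ∈ cov n₁ d₁ k₁) (hB : B ∈ cov n₂ d₂ k₂) (h₁ : j ≤ k₁) (h₂ : j ≤ k₂) :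
    ((raiseOp (Sum.elim n₁ n₂) (Sum.elim 1 0) : Module.End ℂ _) ^ j)
      (leading (rawTransvectant j (inclLeft n₁ n₂ A) (inclRight n₁ n₂ B))) =
      ((j.factorial : ℂ) * (k₁.descFactorial j * k₂.descFactorial j)) •
        (coeffLeft n₁ n₂ (leading A) * coeffRight n₁ n₂ (leading B)) := by
  have h3 := raise_pow_leading_rawTransvectant
    (e := raiseCoeff fun i => (((Sum.elim 1 0 : ι₁ ⊕ ι₂ → ℕ) i : ℕ) : ℂ))
    (A := inclLeft n₁ n₂ A) (B := inclRight n₁ n₂ B) (k₁ := k₁) (k₂ := k₂) (j := j) ?_ ?_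
    (orderDer_of_mem_cov (inclLeft_mem_cov hA)) (orderDer_of_mem_cov (inclRight_mem_cov hB)) h₁ h₂
  · refine h3.trans ?_
    congr 2
    · exact leading_reindex Sum.inl (Sum.elim n₁ n₂) A
    · exact leading_reindex Sum.inr (Sum.elim n₁ n₂) B
  · refine (pointDer_raise_reindex Sum.inl (Sum.elim n₁ n₂) _ upperNil A).trans ?_
    have h4 := (mem_cov_iff.1 hA).1
    rw [raiseDer_eq] at h4
    exact (congrArg _ h4).trans (map_zero _)
  · refine (pointDer_raise_reindex Sum.inr (Sum.elim n₁ n₂) _ 0 B).trans ?_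
    have h4 : pointDer (raiseCoeff (n := n₂) fun i => (((0 : ι₂ → ℕ) i : ℕ) : ℂ)) 0 = 0 := by
      refine derivation_ext ?_
      rintro (v | j) <;> simp [raiseCoeff]
    exact (congrArg _ (congr($h4 B))).trans (map_zero _)

/-- The sum of the two partial raising operators kills `w`, and they commute, so the second is minus
the first on every iterate of `w`. -/
theorem raiseOp_right_pow_eq {w : MvPolynomial (CoeffVar (Sum.elim n₁ n₂)) ℂ}
    (hw : raiseOp (Sum.elim n₁ n₂) 1 w = 0) (i : ℕ) :
    ((raiseOp (Sum.elim n₁ n₂) (Sum.elim 0 1) : Module.End ℂ _) ^ i) w =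
      (-1 : ℂ) ^ i • ((raiseOp (Sum.elim n₁ n₂) (Sum.elim 1 0) : Module.End ℂ _) ^ i) w := by
  have h21 : raiseOp (Sum.elim n₁ n₂) (Sum.elim 0 1) w = -raiseOp (Sum.elim n₁ n₂) (Sum.elim 1 0) w := by
    rw [raiseOp_one_eq, add_comm] at hw
    exact eq_neg_of_add_eq_zero_left hw
  induction i with
  | zero => simp
  | succ i ih =>
    have hcomm : Commute (raiseOp (Sum.elim n₁ n₂) (Sum.elim 1 0) : Module.End ℂ
        (MvPolynomial (CoeffVar (Sum.elim n₁ n₂)) ℂ)) (raiseOp (Sum.elim n₁ n₂) (Sum.elim 0 1)) :=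
      LinearMap.ext fun p => raiseOp_commute p
    have h := congr($((hcomm.pow_left i).eq) w)
    simp only [Module.End.mul_apply, Derivation.coeFn_coe, h21, map_neg] at h
    rw [pow_succ', Module.End.mul_apply, ih, map_smul, Derivation.coeFn_coe, ← h,
      pow_succ (-1 : ℂ), pow_succ _ i, Module.End.mul_apply, Derivation.coeFn_coe]
    module

theorem eq_of_component_ne_zero {d k d₁ d₂ : ℕ} {μ ν : ℤ}
    {w : MvPolynomial (CoeffVar (Sum.elim n₁ n₂)) ℂ} (hw : w ∈ weightSpace (Sum.elim n₁ n₂) 1 d k)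
    (h0 : weightedHomogeneousComponent (doubleWeight n₁ n₂) ((d₁, μ), (d₂, ν)) w ≠ 0) :
    d₁ + d₂ = d ∧ μ + ν = k := by
  have hyw := mem_weightSpace_of_doubleWeight (weightedHomogeneousComponent_isWeightedHomogeneous
    (w := doubleWeight n₁ n₂) ((d₁, μ), (d₂, ν)) w)
  constructor
  · have h1 := weightedHomogeneousComponent_derivation (w := doubleWeight n₁ n₂) 0
      (degreeOp (Sum.elim n₁ n₂) 1) (fun v => by
        rw [degreeOp, diagDer_X, add_zero]
        exact (weightedHomogeneousSubmodule ℂ _ _).smul_mem _ (isWeightedHomogeneous_X _ _ _))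
      ((d₁, μ), (d₂, ν)) w
    rw [hw.1, map_smul, add_zero, degreeOp_one_eq_add, hyw.1.1, hyw.2.1, ← add_smul] at h1
    exact_mod_cast (smul_left_injective ℂ h0 h1).symm
  · have h1 := weightedHomogeneousComponent_derivation (w := doubleWeight n₁ n₂) 0
      (weightOp (Sum.elim n₁ n₂) 1) (fun v => by
        rw [weightOp, diagDer_X, add_zero]
        exact (weightedHomogeneousSubmodule ℂ _ _).smul_mem _ (isWeightedHomogeneous_X _ _ _))
      ((d₁, μ), (d₂, ν)) w
    rw [hw.2, map_smul, add_zero, weightOp_one_eq_add, hyw.1.2, hyw.2.2, ← add_smul] at h1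
    exact_mod_cast (smul_left_injective ℂ h0 h1).symm

variable [Fintype ι₁] [Fintype ι₂]

/-- Products of highest weight vectors of weights at least `j` come from `j`-th transvectants. -/
theorem mem_map_raiseOp_pow {d₁ d₂ d k j : ℕ} {μ₁ μ₂ : ℤ} (hd : d₁ + d₂ = d)
    (hμ : μ₁ + μ₂ = k + 2 * j) (h₁ : j ≤ μ₁) (h₂ : j ≤ μ₂) {a : MvPolynomial (CoeffVar n₁) ℂ}
    {b : MvPolynomial (CoeffVar n₂) ℂ} (ha : raiseOp n₁ 1 a = 0) (ha' : a ∈ weightSpace n₁ 1 d₁ μ₁)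
    (hb : raiseOp n₂ 1 b = 0) (hb' : b ∈ weightSpace n₂ 1 d₂ μ₂) :
    coeffLeft n₁ n₂ a * coeffRight n₁ n₂ b ∈
      ((Submodule.span ℂ (transvectantSet n₁ n₂ d k)).map leading.toLinearMap).map
        ((raiseOp (Sum.elim n₁ n₂) (Sum.elim 1 0) : Module.End ℂ _) ^ j) := by
  lift μ₁ to ℕ using by omega
  lift μ₂ to ℕ using by omega
  obtain ⟨A, hA, rfl⟩ := exists_leading_eq ha ha'
  obtain ⟨B, hB, rfl⟩ := exists_leading_eq hb hb'
  have h3 := raiseOp_pow_leading_rawTransvectant hA hB (j := j) (by omega) (by omega)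
  -- The falling factorials are nonzero because `j` is at most both weights.
  have hc : ((j.factorial : ℂ) * (μ₁.descFactorial j * μ₂.descFactorial j)) ≠ 0 := by
    have := Nat.factorial_ne_zero j
    have e1 : μ₁.descFactorial j ≠ 0 := by rw [Ne, Nat.descFactorial_eq_zero_iff_lt]; omega
    have e2 : μ₂.descFactorial j ≠ 0 := by rw [Ne, Nat.descFactorial_eq_zero_iff_lt]; omega
    exact_mod_cast mul_ne_zero this (mul_ne_zero e1 e2)
  have h4 : leading (rawTransvectant j (inclLeft n₁ n₂ A) (inclRight n₁ n₂ B)) ∈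
      (Submodule.span ℂ (transvectantSet n₁ n₂ d k)).map leading.toLinearMap :=
    Submodule.mem_map_of_mem (f := leading.toLinearMap) (Submodule.subset_span
      ⟨d₁, μ₁, d₂, μ₂, j, A, B, hA, hB, hd, by omega, by omega, by omega, rfl⟩)
  have h5 := Submodule.mem_map_of_mem (f := (raiseOp (Sum.elim n₁ n₂) (Sum.elim 1 0) : Module.End ℂ _) ^ j) h4
  rw [h3] at h5
  exact (Submodule.smul_mem_iff _ hc).1 h5

/-- Let `y` be the component of multidegree `((d₁, μ), (d₂, ν))` and `z = E₁^j y`. As `E₂ = -E₁` on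
`w`, also `z = ± E₂^j y'`, where `y'` is the component with weights `μ + 2j` and `ν - 2j`. Hence
both `E₁` and `E₂` kill `z`. If `z ≠ 0`, injectivity on low weights forces `μ ≥ -j` and `ν ≥ j`, so
`z` is a sum of products of highest weight vectors of weights at least `j`. -/
theorem raiseOp_pow_component_mem {d k j : ℕ} {w : MvPolynomial (CoeffVar (Sum.elim n₁ n₂)) ℂ}
    (hw : raiseOp (Sum.elim n₁ n₂) 1 w = 0) (hw' : w ∈ weightSpace (Sum.elim n₁ n₂) 1 d k)
    (hj : ((raiseOp (Sum.elim n₁ n₂) (Sum.elim 1 0) : Module.End ℂ _) ^ (j + 1)) w = 0)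
    (I : (ℕ × ℤ) × (ℕ × ℤ)) :
    ((raiseOp (Sum.elim n₁ n₂) (Sum.elim 1 0) : Module.End ℂ _) ^ j)
        (weightedHomogeneousComponent (doubleWeight n₁ n₂) I w) ∈
      ((Submodule.span ℂ (transvectantSet n₁ n₂ d k)).map leading.toLinearMap).map
        ((raiseOp (Sum.elim n₁ n₂) (Sum.elim 1 0) : Module.End ℂ _) ^ j) := by
  obtain ⟨⟨d₁, μ⟩, ⟨d₂, ν⟩⟩ := I
  have hzc := weightedHomogeneousComponent_derivation_pow (w := doubleWeight n₁ n₂) _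
    (raiseOp (Sum.elim n₁ n₂) (Sum.elim 1 0)) doubleWeight_raiseOp_left j ((d₁, μ), (d₂, ν)) w
  have hzc' := weightedHomogeneousComponent_derivation_pow (w := doubleWeight n₁ n₂) _
    (raiseOp (Sum.elim n₁ n₂) (Sum.elim 0 1)) doubleWeight_raiseOp_right j
    ((d₁, μ + 2 * j), (d₂, ν - 2 * j)) w
  have hy1 := weightedHomogeneousComponent_derivation_pow (w := doubleWeight n₁ n₂) _
    (raiseOp (Sum.elim n₁ n₂) (Sum.elim 1 0)) doubleWeight_raiseOp_left (j + 1) ((d₁, μ), (d₂, ν)) w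
  have hy1' := weightedHomogeneousComponent_derivation_pow (w := doubleWeight n₁ n₂) _
    (raiseOp (Sum.elim n₁ n₂) (Sum.elim 0 1)) doubleWeight_raiseOp_right (j + 1)
    ((d₁, μ + 2 * j), (d₂, ν - 2 * j)) w
  rw [hj, map_zero] at hy1
  rw [raiseOp_right_pow_eq hw, hj, smul_zero, map_zero] at hy1'
  have hI : (((d₁, μ), (d₂, ν)) : (ℕ × ℤ) × (ℕ × ℤ)) + j • ((0, 2), (0, 0)) =
      ((d₁, μ + 2 * j), (d₂, ν)) := by simp [mul_comm]
  have hI' : (((d₁, μ + 2 * j), (d₂, ν - 2 * j)) : (ℕ × ℤ) × (ℕ × ℤ)) + j • ((0, 0), (0, 2)) =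
      ((d₁, μ + 2 * j), (d₂, ν)) := by simp [mul_comm]
  have hyw := mem_weightSpace_of_doubleWeight (weightedHomogeneousComponent_isWeightedHomogeneous
    (w := doubleWeight n₁ n₂) ((d₁, μ), (d₂, ν)) w)
  have hyw' := mem_weightSpace_of_doubleWeight (weightedHomogeneousComponent_isWeightedHomogeneous
    (w := doubleWeight n₁ n₂) ((d₁, μ + 2 * j), (d₂, ν - 2 * j)) w)
  have hzw := mem_weightSpace_of_doubleWeight (weightedHomogeneousComponent_isWeightedHomogeneous
    (w := doubleWeight n₁ n₂) ((d₁, μ + 2 * j), (d₂, ν))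
      (((raiseOp (Sum.elim n₁ n₂) (Sum.elim 1 0) : Module.End ℂ _) ^ j) w))
  have hdw := eq_of_component_ne_zero (d₁ := d₁) (μ := μ) (d₂ := d₂) (ν := ν) hw'
  rw [hI] at hzc
  rw [hI', raiseOp_right_pow_eq hw, map_smul, hzc] at hzc'
  rw [hzc] at hzw
  generalize weightedHomogeneousComponent (doubleWeight n₁ n₂) ((d₁, μ), (d₂, ν)) w = y at *
  generalize weightedHomogeneousComponent (doubleWeight n₁ n₂)
    ((d₁, μ + 2 * j), (d₂, ν - 2 * j)) w = y' at *
  rw [pow_succ', Module.End.mul_apply, ← hzc', map_smul] at hy1'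
  by_cases hz0 : ((raiseOp (Sum.elim n₁ n₂) (Sum.elim 1 0) : Module.End ℂ _) ^ j) y = 0
  · rw [hz0]; exact Submodule.zero_mem _
  have hy0 : y ≠ 0 := fun h => hz0 (by rw [h, map_zero])
  have hy0' : y' ≠ 0 := fun h => hz0 (by
    rw [h, map_zero] at hzc'
    exact (smul_eq_zero.1 hzc').resolve_left (pow_ne_zero _ (by norm_num)))
  have hz2 := (smul_eq_zero.1 hy1'.symm).resolve_left (pow_ne_zero _ (by norm_num))
  have hy2' : ((raiseOp (Sum.elim n₁ n₂) (Sum.elim 0 1) : Module.End ℂ _) ^ (j + 1)) y' = 0 := by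
    rw [pow_succ', Module.End.mul_apply, ← hzc', map_smul, hz2, smul_zero]
  have hμ : -(j : ℤ) ≤ μ := by
    by_contra hlt
    exact hy0 (eq_zero_of_raiseOp_pow (by rintro (i | i) <;> rfl) hyw.1 (i := j + 1)
      (by push_cast; omega) hy1.symm)
  -- The weight of `y'` for `V₂` is `ν - 2j`; were it at most `-(j + 1)`, then `y'` would be zero.
  have hν : (j : ℤ) ≤ ν := by
    by_contra hlt
    exact hy0' (eq_zero_of_raiseOp_pow (by rintro (i | i) <;> rfl) hyw'.2 (i := j + 1)
      (by push_cast; omega) hy2')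
  obtain ⟨hdeg, hwt⟩ := hdw hy0
  rw [pow_succ', Module.End.mul_apply] at hy1
  refine Submodule.span_le.2 ?_ (mem_span_of_raiseOp_eq_zero n₁ n₂ hy1.symm hz2 hzw.1 hzw.2)
  rintro _ ⟨a, b, ⟨ha, ha'⟩, ⟨hb, hb'⟩, rfl⟩
  have h₁ : (j : ℤ) ≤ μ + 2 * j := by omega
  have hsum : μ + 2 * j + ν = k + 2 * j := by omega
  exact mem_map_raiseOp_pow hdeg hsum h₁ hν ha ha' hb hb'

/-- Induction on the exponent killing `w`: some `t` from the span of transvectants has the same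
image as `w` under the `j`-th power, so `w - t` is killed by a smaller power. -/
theorem mem_map_leading {d k : ℕ} (j : ℕ) {w : MvPolynomial (CoeffVar (Sum.elim n₁ n₂)) ℂ}
    (hw : raiseOp (Sum.elim n₁ n₂) 1 w = 0) (hw' : w ∈ weightSpace (Sum.elim n₁ n₂) 1 d k)
    (hj : ((raiseOp (Sum.elim n₁ n₂) (Sum.elim 1 0) : Module.End ℂ _) ^ j) w = 0) :
    w ∈ (Submodule.span ℂ (transvectantSet n₁ n₂ d k)).map leading.toLinearMap := by
  induction j generalizing w with
  | zero => rw [show w = 0 from hj]; exact Submodule.zero_mem _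
  | succ j ih =>
    have h1 : ((raiseOp (Sum.elim n₁ n₂) (Sum.elim 1 0) : Module.End ℂ _) ^ j) w ∈
        ((Submodule.span ℂ (transvectantSet n₁ n₂ d k)).map leading.toLinearMap).map
          ((raiseOp (Sum.elim n₁ n₂) (Sum.elim 1 0) : Module.End ℂ _) ^ j) := by
      have h2 : w ∈ Submodule.comap ((raiseOp (Sum.elim n₁ n₂) (Sum.elim 1 0) : Module.End ℂ _) ^ j)
          (((Submodule.span ℂ (transvectantSet n₁ n₂ d k)).map leading.toLinearMap).map
          ((raiseOp (Sum.elim n₁ n₂) (Sum.elim 1 0) : Module.End ℂ _) ^ j)) := by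
        rw [← sum_weightedHomogeneousComponent (doubleWeight n₁ n₂) w]
        refine finsum_induction (· ∈ Submodule.comap _ _) (Submodule.zero_mem _)
          (fun _ _ => Submodule.add_mem _) fun I => ?_
        exact raiseOp_pow_component_mem hw hw' hj I
      exact h2
    obtain ⟨t, ht, hte⟩ := h1
    have ht' : raiseOp (Sum.elim n₁ n₂) 1 t = 0 ∧ t ∈ weightSpace (Sum.elim n₁ n₂) 1 d k := by
      obtain ⟨p, hp, rfl⟩ := ht
      have : Submodule.span ℂ (transvectantSet n₁ n₂ d k) ≤ cov (Sum.elim n₁ n₂) d k :=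
        Submodule.span_le.2 fun _ => mem_cov_of_mem_transvectantSet
      exact leading_mem (this hp)
    have := ih (w := w - t) (by rw [map_sub, hw, ht'.1, sub_zero])
      (Submodule.sub_mem _ hw' ht'.2) (by rw [map_sub, hte, sub_self])
    simpa using Submodule.add_mem _ this ht

/-- The covariants of `V₁ ⊕ V₂` are spanned by the transvectants of covariants of `V₁` and of
`V₂`. -/
theorem cov_sumElim_le_span_transvectantSet (d k : ℕ) :
    cov (Sum.elim n₁ n₂) d k ≤ Submodule.span ℂ (transvectantSet n₁ n₂ d k) := by
  intro p hp
  obtain ⟨hw, hw'⟩ := leading_mem hp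
  have hmem : ∀ j : ℕ, ((raiseOp (Sum.elim n₁ n₂) (Sum.elim 1 0) : Module.End ℂ _) ^ j) (leading p) ∈
      weightSpace (Sum.elim n₁ n₂) 1 d (k + 2 * j) := by
    intro j
    induction j with
    | zero => simpa using hw'
    | succ j ih =>
      rw [pow_succ', Module.End.mul_apply]
      have h2 := raiseOp_left_mem_weightSpace ih
      rwa [show (k : ℤ) + 2 * j + 2 = k + 2 * (j + 1 : ℕ) by push_cast; ring] at h2
  -- Raising keeps the degree `d` and adds `2` to the weight, which eventually exceeds the bound
  -- available in that degree.
  have hj := eq_zero_of_mem_weightSpace (hmem ((∑ i, Sum.elim n₁ n₂ i) * d + 1)) (by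
    generalize (∑ i, Sum.elim n₁ n₂ i) * d = N
    rw [abs_of_nonneg (by omega)]
    omega)
  obtain ⟨q, hq, hqe⟩ := mem_map_leading _ hw hw' hj
  have : Submodule.span ℂ (transvectantSet n₁ n₂ d k) ≤ cov (Sum.elim n₁ n₂) d k :=
    Submodule.span_le.2 fun _ => mem_cov_of_mem_transvectantSet
  have h0 := eq_zero_of_leading_eq_zero (Submodule.sub_mem _ hp (this hq))
    (by rw [map_sub, sub_eq_zero]; exact hqe.symm)
  rw [sub_eq_zero.1 h0]
  exact hq

end Spanning

/-! ### Order bounds from generators -/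

section Generators

variable {ι : Type*} {n : ι → ℕ}

/-- A bihomogeneous element of a span of bihomogeneous elements is in the span of those of the same
bidegree. -/
theorem mem_span_inter_cov {S : Set (CoordRing n)} (hS : ∀ x ∈ S, ∃ d k, x ∈ cov n d k)
    {d k : ℕ} {p : CoordRing n} (hp : p ∈ cov n d k) (h : p ∈ Submodule.span ℂ S) :
    p ∈ Submodule.span ℂ (S ∩ cov n d k) := by
  have h1 := Submodule.mem_map_of_mem (f := weightedHomogeneousComponent (bidegWeight n) (d, k)) h
  rw [weightedHomogeneousComponent_eq_self hp.2, Submodule.map_span] at h1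
  refine Submodule.span_le.2 ?_ h1
  rintro _ ⟨x, hx, rfl⟩
  obtain ⟨d', k', hx'⟩ := hS x hx
  by_cases hdk : (d, k) = (d', k')
  · obtain ⟨rfl, rfl⟩ := Prod.mk.inj hdk
    rw [weightedHomogeneousComponent_eq_self hx'.2]
    exact Submodule.subset_span ⟨hx, hx'⟩
  · have h2 : IsWeightedHomogeneous (bidegWeight n) x (d', k') := hx'.2
    rw [h2.weightedHomogeneousComponent_ne _ hdk]
    exact Submodule.zero_mem _

/-- A monomial of order greater than `a` contains a generator of positive order. As that order is at
most `a`, the cofactor still has positive order. Generators of order `0` met before it are absorbed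
into the first factor. -/
theorem IsGeneratingFamily.orderBound {N : ℕ} {f : Fin N → CoordRing n} {df af : Fin N → ℕ}
    (h : IsGeneratingFamily n f df af) {a : ℕ} (ha : ∀ j, af j ≤ a) : OrderBound n a := by
  intro d k hk p hp
  have hcl : ∀ x ∈ Submonoid.closure (Set.range f),
      ∃ d' k', x ∈ cov n d' k' ∧ (a < k' → x ∈ decomposableSet n d' k') := by
    intro x hx
    induction hx using Submonoid.closure_induction_left with
    | one => exact ⟨0, 0, one_mem_cov, fun h => absurd h (Nat.not_lt_zero _)⟩
    | mul_left x hx y _ ih =>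
      obtain ⟨j, rfl⟩ := hx
      obtain ⟨d', k', hy, hy'⟩ := ih
      refine ⟨_, _, mul_mem_cov (h.bihomogeneous j) hy, fun hlt => ?_⟩
      rcases Nat.eq_zero_or_pos (af j) with h0 | h0
      · obtain ⟨d₁, k₁, d₂, k₂, g, q, hd, hk', h1, h2, hg, hq, rfl⟩ := hy' (by omega)
        exact ⟨_, _, _, _, _, _, by omega, by omega, by omega, h2, mul_mem_cov (h.bihomogeneous j) hg,
          hq, (mul_assoc _ _ _).symm⟩
      · exact ⟨_, _, _, _, _, _, rfl, rfl, h0, by have := ha j; omega, h.bihomogeneous j, hy, rfl⟩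
  have h1 : p ∈ Submodule.span ℂ (Submonoid.closure (Set.range f) : Set (CoordRing n)) := by
    rw [← Algebra.adjoin_eq_span, h.adjoin_eq]
    exact hp.1
  refine Submodule.span_le.2 ?_ (mem_span_inter_cov (fun x hx => ?_) hp h1)
  · rintro x ⟨hx, hx'⟩
    obtain ⟨d', k', hx1, hx2⟩ := hcl x hx
    by_cases h0 : x = 0
    · rw [h0]; exact Submodule.zero_mem _
    have h3 : IsWeightedHomogeneous (bidegWeight n) x (d', k') := hx1.2
    have h4 : IsWeightedHomogeneous (bidegWeight n) x (d, k) := hx'.2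
    obtain ⟨rfl, rfl⟩ := Prod.mk.inj (h3.inj_right h0 h4)
    exact Submodule.subset_span (hx2 hk)
  · obtain ⟨d', k', hx1, -⟩ := hcl x hx
    exact ⟨d', k', hx1⟩

end Generators

/-! ### Reducibility of transvectants -/

section Reducibility

theorem sum_filter_pos_le {p : ℕ} (α d : Fin p → ℕ) :
    ∑ i with 0 < d i, α i ≤ ∑ i, α i * d i := by
  rw [Finset.sum_filter]
  refine Finset.sum_le_sum fun i _ => ?_
  split_ifs with h
  · exact Nat.le_mul_of_pos_right _ h
  · exact Nat.zero_le _

/-- The chosen index uses `(α - 1)(d - 1) ≥ 0`; every other factor of positive degree contributes at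
least `1` to the total degree. -/
theorem add_sum_filter_pos_le {p : ℕ} (α d : Fin p → ℕ) {i : Fin p} (hα : 0 < α i) (hd : 0 < d i) :
    d i + ∑ i with 0 < d i, α i ≤ (∑ i, α i * d i) + 1 := by
  rw [Finset.sum_filter, ← Finset.add_sum_erase _ _ (Finset.mem_univ i),
    ← Finset.add_sum_erase _ (fun i => α i * d i) (Finset.mem_univ i), if_pos hd]
  have h1 : ∑ j ∈ Finset.univ.erase i, (if 0 < d j then α j else 0) ≤
      ∑ j ∈ Finset.univ.erase i, α j * d j := by
    refine Finset.sum_le_sum fun j _ => ?_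
    split_ifs with h
    · exact Nat.le_mul_of_pos_right _ h
    · exact Nat.zero_le _
  have h2 : d i + α i ≤ α i * d i + 1 := by
    obtain ⟨x, hx⟩ := Nat.exists_eq_succ_of_ne_zero hα.ne'
    obtain ⟨y, hy⟩ := Nat.exists_eq_succ_of_ne_zero hd.ne'
    rw [hx, hy]
    simp only [Nat.succ_eq_add_one]
    nlinarith [Nat.zero_le (x * y)]
  omega

/-- Each factor of positive degree has smaller degree than the monomial. -/
theorem degree_lt_of_two_le {p q : ℕ} {α d : Fin p → ℕ} {β e : Fin q → ℕ}
    (h : 2 ≤ (∑ i with 0 < d i, α i) + ∑ j with 0 < e j, β j) {i : Fin p} (hi : 0 < α i) :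
    d i < (∑ i, α i * d i) + ∑ j, β j * e j := by
  have h1 := sum_filter_pos_le α d
  have h2 := sum_filter_pos_le β e
  rcases Nat.eq_zero_or_pos (d i) with h0 | h0
  · omega
  · have := add_sum_filter_pos_le α d hi h0
    omega

variable {ι : Type*} {n : ι → ℕ}

theorem prod_pow_mem_cov {p : ℕ} {f : Fin p → CoordRing n} {d a : Fin p → ℕ}
    (h : ∀ i, f i ∈ cov n (d i) (a i)) (α : Fin p → ℕ) :
    ∏ i, f i ^ α i ∈ cov n (∑ i, α i * d i) (∑ i, α i * a i) :=
  prod_mem_cov _ fun i _ => pow_mem_cov (h i) (α i)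

/-- The generators of the algebra in the definition of reducible covariants. -/
def smallerCovariants (n : ι → ℕ) (d k : ℕ) : Set (CoordRing n) :=
  {p : CoordRing n | ∃ d' k', d' ≤ d ∧ k' ≤ k ∧ (d' < d ∨ k' < k) ∧ p ∈ cov n d' k'}

theorem prod_pow_mem_adjoin {p : ℕ} {f : Fin p → CoordRing n} {d a : Fin p → ℕ} {D K : ℕ}
    (h : ∀ i, f i ∈ cov n (d i) (a i)) {α : Fin p → ℕ} (hα : ∀ i, 0 < α i → d i < D)
    (hK : ∑ i, α i * a i ≤ K) :
    ∏ i, f i ^ α i ∈ Algebra.adjoin ℂ (smallerCovariants n D K) := by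
  refine Subalgebra.prod_mem _ fun i _ => ?_
  rcases Nat.eq_zero_or_pos (α i) with h0 | h0
  · rw [h0, pow_zero]; exact one_mem _
  · have h1 : α i * a i ≤ ∑ i, α i * a i :=
      Finset.single_le_sum (f := fun i => α i * a i) (fun i _ => Nat.zero_le _) (Finset.mem_univ i)
    have h2 := Nat.le_mul_of_pos_left (a i) h0
    have h3 : f i ∈ smallerCovariants n D K :=
      ⟨d i, a i, (hα i h0).le, by omega, Or.inl (hα i h0), h i⟩
    exact Subalgebra.pow_mem _ (Algebra.subset_adjoin h3) _

variable {ι₁ ι₂ : Type*} {n₁ : ι₁ → ℕ} {n₂ : ι₂ → ℕ}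

theorem transvectant_mem_cov {d₁ k₁ d₂ k₂ r k : ℕ} {A B : CoordRing n} (hA : A ∈ cov n d₁ k₁)
    (hB : B ∈ cov n d₂ k₂) (hr : r ≤ min k₁ k₂) (hk : k + 2 * r = k₁ + k₂) :
    transvectant k₁ k₂ r A B ∈ cov n (d₁ + d₂) k := by
  rw [transvectant_eq_smul (orderDer_of_mem_cov hA) (orderDer_of_mem_cov hB) hr]
  exact Submodule.smul_mem _ _ (rawTransvectant_mem_cov hA hB hk)

theorem isReducible_transvectant {p q : ℕ} {f : Fin p → CoordRing n₁} {df af : Fin p → ℕ}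
    {g : Fin q → CoordRing n₂} {dg bg : Fin q → ℕ} (hf : IsGeneratingFamily n₁ f df af)
    (hg : IsGeneratingFamily n₂ g dg bg) {a b : ℕ} (ha : ∀ i, af i ≤ a) (hb : ∀ j, bg j ≤ b)
    (α : Fin p → ℕ) (β : Fin q → ℕ) (r : ℕ) {k : ℕ}
    (hk : (k : ℤ) = ((∑ i, α i * af i : ℕ) : ℤ) - r + (((∑ j, β j * bg j : ℕ) : ℤ) - r))
    (hab : a + b ≤ k)
    (h : (0 < a ∧ 0 < b) ∨ 2 ≤ (∑ i with 0 < df i, α i) + (∑ j with 0 < dg j, β j)) :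
    IsReducible (Sum.elim n₁ n₂) ((∑ i, α i * df i) + (∑ j, β j * dg j)) k
      (transvectant (∑ i, α i * af i) (∑ j, β j * bg j) r
        (inclLeft n₁ n₂ (∏ i, f i ^ α i)) (inclRight n₁ n₂ (∏ j, g j ^ β j))) := by
  have hU := prod_pow_mem_cov hf.bihomogeneous α
  have hV := prod_pow_mem_cov hg.bihomogeneous β
  have hU' := inclLeft_mem_cov (n₂ := n₂) hU
  have hV' := inclRight_mem_cov (n₁ := n₁) hV
  -- If `k = 0`, then `a = b = 0`, and two factors of positive degree make the total degree
  -- positive.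
  have hpos : 0 < (∑ i, α i * df i) + (∑ j, β j * dg j) + k := by
    have h1 := sum_filter_pos_le α df
    have h2 := sum_filter_pos_le β dg
    omega
  by_cases hr : r ≤ min (∑ i, α i * af i) (∑ j, β j * bg j)
  swap
  · rw [transvectant, if_neg hr]
    exact ⟨Submodule.zero_mem _, hpos, Subalgebra.zero_mem _⟩
  refine ⟨transvectant_mem_cov hU' hV' hr (by omega), hpos, ?_⟩
  rw [transvectant_eq_smul (orderDer_of_mem_cov hU') (orderDer_of_mem_cov hV') hr]
  refine Subalgebra.smul_mem _ ?_ _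
  change _ ∈ Algebra.adjoin ℂ (smallerCovariants (Sum.elim n₁ n₂) _ k)
  by_cases hpos' : 0 < a ∧ 0 < b
  -- A product of two covariants of positive orders lies in this algebra whatever the degrees, since
  -- both orders are less than `k`.
  · refine rawTransvectant_incl_mem (K := Subalgebra.toSubmodule (Algebra.adjoin ℂ
      (smallerCovariants (Sum.elim n₁ n₂) ((∑ i, α i * df i) + (∑ j, β j * dg j)) k)))
      (hf.orderBound ha) (hg.orderBound hb) hab (by omega) (by omega) ?_ r hU hV rfl (by omega)
      (by omega) (by omega)
    intro d₁ k₁ d₂ k₂ P Q hd hk' h1 h2 hP hQ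
    exact Subalgebra.mul_mem _
      (Algebra.subset_adjoin ⟨d₁, k₁, by omega, by omega, by omega, hP⟩)
      (Algebra.subset_adjoin ⟨d₂, k₂, by omega, by omega, by omega, hQ⟩)
  · have h2 := h.resolve_left hpos'
    -- One of the two monomials has order `0`, which bounds `r`. The transvectant is then a multiple
    -- of `UV`, and each generator occurring has smaller degree than `UV`.
    have hr0 : r = 0 := by
      have h3 : a = 0 → ∑ i, α i * af i = 0 := fun h0 => Finset.sum_eq_zero fun i _ => by
        rw [Nat.le_zero.1 ((ha i).trans h0.le), mul_zero]
      have h4 : b = 0 → ∑ j, β j * bg j = 0 := fun h0 => Finset.sum_eq_zero fun j _ => by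
        rw [Nat.le_zero.1 ((hb j).trans h0.le), mul_zero]
      omega
    subst hr0
    rw [rawTransvectant_zero, map_prod, map_prod]
    simp only [map_pow]
    refine Subalgebra.mul_mem _
      (prod_pow_mem_adjoin (fun i => inclLeft_mem_cov (hf.bihomogeneous i))
        (fun i hi => degree_lt_of_two_le h2 hi) (by omega))
      (prod_pow_mem_adjoin (fun j => inclRight_mem_cov (hg.bihomogeneous j))
        (fun j hj => ?_) (by omega))
    rw [add_comm] at h2 ⊢
    exact degree_lt_of_two_le h2 hj

end Reducibility

/-! ### Minimal bases and order bounds -/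

section MinimalBasis

open scoped Pointwise

variable {ι : Type*} {n : ι → ℕ}

/-- The bihomogeneous elements of `C₊`. -/
def bihomogeneousSet (n : ι → ℕ) : Set (CoordRing n) :=
  {p | ∃ d k, 0 < d + k ∧ p ∈ cov n d k}

theorem covPlus_eq_span : covPlus n = Submodule.span ℂ (bihomogeneousSet n) := by
  refine le_antisymm ?_ (Submodule.span_le.2 ?_)
  · refine iSup_le fun d => iSup_le fun k => iSup_le fun h => fun p hp => ?_
    exact Submodule.subset_span ⟨d, k, h, hp⟩
  · rintro p ⟨d, k, h, hp⟩
    exact Submodule.mem_iSup_of_mem d (Submodule.mem_iSup_of_mem k (Submodule.mem_iSup_of_mem h hp))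

theorem mem_covPlus {p : CoordRing n} {d k : ℕ} (h : 0 < d + k) (hp : p ∈ cov n d k) :
    p ∈ covPlus n := by
  rw [covPlus_eq_span]
  exact Submodule.subset_span ⟨d, k, h, hp⟩

/-- Spanning of the quotient means that `C₊` is the sum of `C₊²` and the span of the basis, and
`C₊²` is spanned by products of bihomogeneous elements. -/
theorem IsMinimalBasis.mem_span {N : ℕ} {h : Fin N → covPlus n} {d k : Fin N → ℕ}
    (hb : IsMinimalBasis n h d k) {p : CoordRing n} (hp : p ∈ covPlus n) :
    p ∈ Submodule.span ℂ (Set.range (fun j => (h j : CoordRing n)) ∪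
      bihomogeneousSet n * bihomogeneousSet n) := by
  rw [Submodule.span_union, ← Submodule.span_mul_span, ← covPlus_eq_span, ← pow_two]
  have h1 : (Submodule.Quotient.mk ⟨p, hp⟩ : Indecomposables n) ∈
      Submodule.span ℂ (Set.range fun j => (Submodule.Quotient.mk (h j) : Indecomposables n)) := by
    rw [hb.span_eq_top]; trivial
  have h2 : (Set.range fun j => (Submodule.Quotient.mk (h j) : Indecomposables n)) =
      ((covPlus n ^ 2).submoduleOf (covPlus n)).mkQ '' Set.range h := by
    rw [← Set.range_comp]; rfl
  rw [h2, ← Submodule.map_span] at h1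
  obtain ⟨s, hs, hse⟩ := h1
  have h3 : (⟨p, hp⟩ : covPlus n) - s ∈ (covPlus n ^ 2).submoduleOf (covPlus n) :=
    (Submodule.Quotient.eq _).1 hse.symm
  have h4 := Submodule.mem_map_of_mem (f := (covPlus n).subtype) hs
  rw [Submodule.map_span, ← Set.range_comp] at h4
  have h5 : p = (s : CoordRing n) + (p - s) := by ring
  rw [h5]
  exact Submodule.add_mem_sup h4 h3

theorem smul_decomposable_mem {d₁ d₂ k : ℕ} {x y : CoordRing n} (hx : x ∈ cov n d₁ 0)
    (hy : y ∈ Submodule.span ℂ (decomposableSet n d₂ k)) :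
    x * y ∈ Submodule.span ℂ (decomposableSet n (d₁ + d₂) k) := by
  refine Submodule.span_induction (p := fun y _ => x * y ∈ Submodule.span ℂ _) ?_ (by simp)
    (fun y z _ _ hy hz => ?_) (fun c y _ hy => ?_) hy
  · rintro _ ⟨d₃, k₃, d₄, k₄, f, q, rfl, rfl, h3, h4, hf, hq, rfl⟩
    refine Submodule.subset_span ⟨d₁ + d₃, k₃, d₄, k₄, x * f, q, by omega, rfl, h3, h4, ?_, hq,
      by ring⟩
    simpa using mul_mem_cov hx hf
  · rw [mul_add]; exact Submodule.add_mem _ hy hz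
  · rw [mul_smul_comm]; exact Submodule.smul_mem _ _ hy

theorem cov_bidegree_unique {p : CoordRing n} {d k d' k' : ℕ} (h : p ∈ cov n d k)
    (h' : p ∈ cov n d' k') (h0 : p ≠ 0) : d = d' ∧ k = k' := by
  have h1 : IsWeightedHomogeneous (bidegWeight n) p (d, k) := h.2
  have h2 : IsWeightedHomogeneous (bidegWeight n) p (d', k') := h'.2
  exact Prod.mk.inj (h1.inj_right h0 h2)

/-- Induction on the degree. In order above `a` no nonzero basis element occurs, only products. A
factor of order `0` has positive degree, so its cofactor has the full order and smaller degree, and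
decomposes by induction. -/
theorem IsMinimalBasis.orderBound {N : ℕ} {h : Fin N → covPlus n} {d k : Fin N → ℕ}
    (hb : IsMinimalBasis n h d k) {a : ℕ} (ha : ∀ j, k j ≤ a) : OrderBound n a := by
  intro D K hK p hp
  induction D using Nat.strong_induction_on generalizing p with
  | _ D ih =>
    have h1 := mem_span_inter_cov ?_ hp (hb.mem_span (mem_covPlus (by omega) hp))
    · refine Submodule.span_le.2 ?_ h1
      rintro x ⟨hx, hxc⟩
      by_cases h0 : x = 0
      · rw [h0]; exact Submodule.zero_mem _
      rcases hx with ⟨j, rfl⟩ | ⟨f, ⟨d₁, k₁, hp₁, hf⟩, g, ⟨d₂, k₂, hp₂, hg⟩, rfl⟩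
      · have h2 := (cov_bidegree_unique (hb.bihomogeneous j) hxc h0).2
        have := ha j
        omega
      · obtain ⟨hd, hk⟩ := cov_bidegree_unique (mul_mem_cov hf hg) hxc h0
        simp only [SetLike.mem_coe]
        rcases Nat.eq_zero_or_pos k₁ with rfl | h1
        · have hkK : k₂ = K := by omega
          subst hkK
          have := smul_decomposable_mem hf (ih d₂ (by omega) g hg)
          rwa [hd] at this
        rcases Nat.eq_zero_or_pos k₂ with rfl | h2
        · have hkK : k₁ = K := by omega
          subst hkK
          have := smul_decomposable_mem hg (ih d₁ (by omega) f hf)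
          rwa [add_comm, hd, mul_comm] at this
        exact Submodule.subset_span ⟨d₁, k₁, d₂, k₂, f, g, hd, hk, h1, h2, hf, hg, rfl⟩
    · rintro x (⟨j, rfl⟩ | ⟨f, ⟨d₁, k₁, -, hf⟩, g, ⟨d₂, k₂, -, hg⟩, rfl⟩)
      · exact ⟨_, _, hb.bihomogeneous j⟩
      · exact ⟨_, _, mul_mem_cov hf hg⟩

/-- Above the bound a basis element would lie in `C₊²`, so its class would be zero, against linear
independence. -/
theorem IsMinimalBasis.order_le {N : ℕ} {h : Fin N → covPlus n} {d k : Fin N → ℕ}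
    (hb : IsMinimalBasis n h d k) {a : ℕ} (ha : OrderBound n a) (j : Fin N) : k j ≤ a := by
  by_contra! hlt
  refine hb.linearIndependent.ne_zero j ((Submodule.Quotient.mk_eq_zero _).2 ?_)
  change (h j : CoordRing n) ∈ covPlus n ^ 2
  refine Submodule.span_le.2 ?_ (ha _ _ hlt _ (hb.bihomogeneous j))
  rintro _ ⟨d₁, k₁, d₂, k₂, f, q, -, -, h1, h2, hf, hq, rfl⟩
  rw [pow_two]
  exact Submodule.mul_mem_mul (mem_covPlus (by omega) hf) (mem_covPlus (by omega) hq)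

end MinimalBasis

/-! ### Additivity of order bounds -/

section Sums

theorem OrderBound.sumElim {ι₁ ι₂ : Type*} [Fintype ι₁] [Fintype ι₂] {n₁ : ι₁ → ℕ} {n₂ : ι₂ → ℕ}
    {a b : ℕ} (h₁ : OrderBound n₁ a) (h₂ : OrderBound n₂ b) :
    OrderBound (Sum.elim n₁ n₂) (a + b) := by
  intro d k hk p hp
  refine Submodule.span_le.2 ?_ (cov_sumElim_le_span_transvectantSet d k hp)
  rintro _ ⟨d₁, k₁, d₂, k₂, r, A, B, hA, hB, hd, hk', hr₁, hr₂, rfl⟩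
  refine rawTransvectant_incl_mem h₁ h₂ hk.le (by omega) (by omega) ?_ r hA hB hd hk' hr₁ hr₂
  intro d₃ k₃ d₄ k₄ f q e1 e2 e3 e4 hf hq
  exact Submodule.subset_span ⟨d₃, k₃, d₄, k₄, f, q, e1, e2, e3, e4, hf, hq, rfl⟩

/-- With no forms every weight is zero, whereas a leading coefficient has the order as its weight.
-/
theorem orderBound_of_isEmpty {ι : Type*} [Fintype ι] [IsEmpty ι] (n : ι → ℕ) : OrderBound n 0 := by
  intro d k hk p hp
  have h := eq_zero_of_mem_weightSpace (leading_mem hp).2 (by simpa using hk)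
  rw [eq_zero_of_leading_eq_zero hp h]
  exact Submodule.zero_mem _

theorem OrderBound.of_equiv {ι ι' : Type*} (φ : ι ≃ ι') {n' : ι' → ℕ} {a : ℕ}
    (h : OrderBound (fun i => n' (φ i)) a) : OrderBound n' a := by
  have hinj : Function.Injective
      (fun v : CoeffVar fun i => n' (φ i) => (⟨φ v.1, v.2⟩ : CoeffVar n')) := by
    rintro ⟨i, k⟩ ⟨j, l⟩ hv
    obtain ⟨h1, h2⟩ := Sigma.mk.inj_iff.1 hv
    obtain rfl := φ.injective h1
    exact congrArg _ (eq_of_heq h2)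
  have hsurj : Function.Surjective
      (fun v : CoeffVar fun i => n' (φ i) => (⟨φ v.1, v.2⟩ : CoeffVar n')) := by
    rintro ⟨i, k⟩
    obtain ⟨i, rfl⟩ := φ.surjective i
    exact ⟨⟨i, k⟩, rfl⟩
  have hinj' : Function.Injective (reindex φ n') :=
    rename_injective _ (Sum.map_injective.2 ⟨hinj, Function.injective_id⟩)
  have hsurj' : Function.Surjective (reindex φ n') :=
    rename_surjective _ (Sum.map_surjective.2 ⟨hsurj, Function.surjective_id⟩)
  intro d k hk p hp
  obtain ⟨p, rfl⟩ := hsurj' p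
  have h1 := Submodule.mem_map_of_mem (f := (reindex φ n').toLinearMap)
    (h d k hk p (mem_cov_of_reindex_mem_cov hinj' hp))
  rw [Submodule.map_span] at h1
  refine Submodule.span_mono ?_ h1
  rintro _ ⟨_, ⟨d₁, k₁, d₂, k₂, f, q, e1, e2, e3, e4, hf, hq, rfl⟩, rfl⟩
  exact ⟨d₁, k₁, d₂, k₂, _, _, e1, e2, e3, e4, reindex_mem_cov hf, reindex_mem_cov hq,
    map_mul (reindex φ n') _ _⟩

theorem orderBound_sum (s : ℕ) (n : Fin s → ℕ) (a : Fin s → ℕ)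
    (h : ∀ i, OrderBound (fun _ : Fin 1 => n i) (a i)) : OrderBound n (∑ i, a i) := by
  induction s with
  | zero => simpa using orderBound_of_isEmpty n
  | succ s ih =>
    have h1 := (ih (fun i => n i.castSucc) (fun i => a i.castSucc) fun i => h _).sumElim
      (h (Fin.last s))
    rw [Fin.sum_univ_castSucc]
    refine OrderBound.of_equiv finSumFinEquiv ?_
    convert h1 using 2 with i
    rcases i with i | i
    · rfl
    · obtain rfl : i = 0 := Subsingleton.elim _ _
      rfl

end Sums

end BinaryForms

end

theorem mainTheorem9 :
    -- reducibility of transvectants of large order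
    (∀ (s₁ s₂ : ℕ) (n₁ : Fin s₁ → ℕ) (n₂ : Fin s₂ → ℕ) (p q : ℕ)
      (f : Fin p → CoordRing n₁) (df af : Fin p → ℕ)
      (g : Fin q → CoordRing n₂) (dg bg : Fin q → ℕ),
      IsGeneratingFamily n₁ f df af → IsGeneratingFamily n₂ g dg bg →
      ∀ a b : ℕ, (∀ i, af i ≤ a) → (∀ j, bg j ≤ b) →
      ∀ (α : Fin p → ℕ) (β : Fin q → ℕ) (r : ℕ) (u v : ℤ),
      u = ((∑ i, α i * af i : ℕ) : ℤ) - r → v = ((∑ j, β j * bg j : ℕ) : ℤ) - r →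
      (a : ℤ) + b ≤ u + v →
      ((0 < a ∧ 0 < b) ∨ 2 ≤ (∑ i with 0 < df i, α i) + (∑ j with 0 < dg j, β j)) →
      IsReducible (Sum.elim n₁ n₂) ((∑ i, α i * df i) + (∑ j, β j * dg j)) (u + v).toNat
        (transvectant (∑ i, α i * af i) (∑ j, β j * bg j) r
          (inclLeft n₁ n₂ (∏ i, f i ^ α i)) (inclRight n₁ n₂ (∏ j, g j ^ β j)))) ∧
    -- the bound for the orders of a minimal basis
    (∀ (s : ℕ) (n : Fin s → ℕ)
      (N : Fin s → ℕ) (F : ∀ i, Fin (N i) → covPlus (fun _ : Fin 1 => n i))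
      (D A : ∀ i, Fin (N i) → ℕ),
      (∀ i, IsMinimalBasis (fun _ : Fin 1 => n i) (F i) (D i) (A i)) →
      ∀ (M : ℕ) (h : Fin M → covPlus n) (d k : Fin M → ℕ), IsMinimalBasis n h d k →
      ∀ j, k j ≤ ∑ i, Finset.univ.sup (A i)) := by
  refine ⟨?_, ?_⟩
  · intro s₁ s₂ n₁ n₂ p q f df af g dg bg hf hg a b ha hb α β r u v hu hv huv h
    exact isReducible_transvectant hf hg ha hb α β r (by omega) (by omega) h
  -- For an empty minimal basis the supremum is `0`, which is a valid bound in that case.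
  · intro s n N F D A hF M h d k hh j
    exact hh.order_le (orderBound_sum s n _ fun i =>
      (hF i).orderBound fun j => Finset.le_sup (f := A i) (Finset.mem_univ j)) j
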